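/- Let $(W,\bar\sigma)$ be a $4$-dimensional real symplectic vector space, $I\subset\mathbb R$ an open interval, and $t\mapsto\Lambda(t)$, $t\in I$, a smooth curve of Lagrangian subspaces of $W$ which is nondecreasing of rank $1$ (for every $t$ the velocity, i.e. the quadratic form $l(t)\mapsto\bar\sigma(l'(t),l(t))$ on $\Lambda(t)$, where $l(\cdot)$ is a curve of vectors with $l(s)\in\Lambda(s)$, is nonnegative of rank $1$) and of constant weight $k$ (for every $\tau\in I$ the function $t\mapsto\det(S_t-S_\tau)$ has a zero of order exactly $k$ at $\tau$, where $t\mapsto S_t$ is a matrix representation of the curve in graph coordinates near $\tau$). *Notation.* For subspaces $\Delta,\Gamma$ transversal to $L$ (all of dimension $2$) let $\langle\Delta,\Gamma,L\rangle:\Delta\to L$ be the linear map with graph $\Gamma=\{v+\langle\Delta,\Gamma,L\rangle v: v\in\Delta\}$. *Invariants.* The generating function of a parametrized curve $\Lambda(\cdot)$ of constant weight $k$ is the function $g_\Lambda(t_0,t_1)$, smooth in a neighbourhood of the diagonal, such that for $t_0\neq t_1$ near the diagonal $$\operatorname{tr}\Bigl(\tfrac{d}{ds}\langle\Lambda(t_1),\Lambda(s),\Lambda(t_0)\rangle\big|_{s=t_1}\circ\tfrac{d}{ds}\langle\Lambda(t_0),\Lambda(s),\Lambda(t_1)\rangle\big|_{s=t_0}\Bigr)=-\frac{k}{(t_0-t_1)^2}-g_\Lambda(t_0,t_1).$$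 The Ricci curvature is $\rho(t)=g_\Lambda(t,t)$. A local parameter $s$ on the curve, $t=\psi(s)$ with $\psi$ smooth and $\psi'\neq0$, is projective if the Ricci curvature of $s\mapsto\Lambda(\psi(s))$ vanishes identically. The fundamental form is the degree four differential on the curve which in a projective parameter $s$ equals $\frac12\,\frac{\partial^2 g_{\Lambda\circ\psi}}{\partial s_1^2}(s_0,s_1)\big|_{s_0=s_1=s}\,(ds)^4$, and $A(t)$ is its density in the parameter $t$: the fundamental form is $A(t)(dt)^4$. *Canonical basis.* For $t\neq\tau$ close to $\tau$ there is $w(t,\tau)\in\Lambda(\tau)$, unique up to sign, with $$\bar\sigma\bigl(v,\tfrac{\partial}{\partial t}\langle\Delta,\Lambda(t),\Lambda(\tau)\rangle v\bigr)=-\bar\sigma(v,w(t,\tau))^2,\qquad v\in\Delta,$$ for every $\Delta$ transversal to $\Lambda(\tau)$. A basis $(e_1(\tau),e_2(\tau))$ of $\Lambda(\tau)$ is canonical if, for a suitable choice of the signs, $w(t,\tau)=e_1(\tau)(t-\tau)^{-2}+e_2(\tau)(t-\tau)^{-1}+O(1)$ as $t\to\tau$. **Statement.** Let $e_1,e_2,\tilde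 f_1,\tilde f_2:I\to W$ be smooth, such that for every $t\in I$ the pair $(e_1(t),e_2(t))$ is a canonical basis of $\Lambda(t)$ and $(e_1,e_2,\tilde f_1,\tilde f_2)(t)$ is a symplectic basis of $W$: $\bar\sigma(e_i,e_j)=\bar\sigma(\tilde f_i,\tilde f_j)=0$, $\bar\sigma(\tilde f_i,e_j)=\delta_{ij}$. Then the structural equation of this frame has the form $$\begin{pmatrix}e_1'\\e_2'\\\tilde f_1'\\\tilde f_2'\end{pmatrix}=\begin{pmatrix}0&3&0&0\\a_{21}&a_{22}&0&4\\a_{31}&a_{41}&0&-a_{21}\\a_{41}&a_{42}&-3&-a_{22}\end{pmatrix}\begin{pmatrix}e_1\\e_2\\\tilde f_1\\\tilde f_2\end{pmatrix}$$ with smooth functions $a_{ij}$ on $I$, the Ricci curvature $\rho$ and the density $A$ of the fundamental form of the curve $\Lambda(\cdot)$ exist on $I$, and $$\rho=-\frac4{15}\Bigl(3a_{21}+2a_{42}+\frac12a_{22}'+\frac12a_{22}^2\Bigr),$$ $$A=\frac{36}{35}\Bigl(-a_{31}+\frac9{64}\rho^2+\frac1{16}\rho''-\frac14a_{21}^2+\frac13a_{41}'+\frac1{12}a_{21}''+\frac1{12}(a_{21}a_{22})'\Bigr).$$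 -/

import Mathlib

open Filter Topology Asymptotics
open scoped ContDiff

namespace GrassmannCurve

noncomputable section

section Grassmannian

variable {W : Type*} [NormedAddCommGroup W] [NormedSpace ℝ W] [FiniteDimensional ℝ W]

/-- The linear map `⟨Δ, Γ, L⟩ : Δ → L` whose graph `{v + ⟨Δ, Γ, L⟩ v | v ∈ Δ}` is `Γ`
(for `Γ` and `Δ` transversal to `L`): minus the projection of `W` onto `L` along `Γ`,
restricted to `Δ`. It is set to `0` if `Γ` is not transversal to `L`. The norm of the
finite-dimensional space `W` serves only as a source of its topology. -/
def graphMap (Δ Γ L : Submodule ℝ W) : Δ →L[ℝ] L :=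
  open scoped Classical in
  if h : IsCompl Γ L then
    LinearMap.toContinuousLinearMap (-((L.projectionOnto Γ h.symm).comp Δ.subtype))
  else 0

/-- The defining property of `⟨Δ, Γ, L⟩`. -/
theorem mem_iff_graphMap {Δ Γ L : Submodule ℝ W} (h : IsCompl Γ L) (v : Δ) (u : L) :
    (v : W) + (u : W) ∈ Γ ↔ u = graphMap Δ Γ L v := by
  have hg : graphMap Δ Γ L v = -(L.projectionOnto Γ h.symm (v : W)) := by
    simp [graphMap, h]
  rw [hg, ← Submodule.projectionOnto_apply_eq_zero_iff h.symm, map_add,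
    Submodule.projectionOnto_apply_left, add_comm, eq_neg_iff_add_eq_zero]

/-- If `Δ` is transversal to `L` too, then `Γ` is exactly the graph of `⟨Δ, Γ, L⟩`. -/
theorem mem_iff_exists_graphMap {Δ Γ L : Submodule ℝ W} (hΔ : IsCompl Δ L)
    (hΓ : IsCompl Γ L) (x : W) :
    x ∈ Γ ↔ ∃ v : Δ, x = (v : W) + (graphMap Δ Γ L v : W) := by
  constructor
  · intro hx
    have hx' : x ∈ Δ ⊔ L := by rw [hΔ.sup_eq_top]; trivial
    obtain ⟨v, hv, u, hu, rfl⟩ := Submodule.mem_sup.1 hx'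
    refine ⟨⟨v, hv⟩, ?_⟩
    rw [← (mem_iff_graphMap hΓ ⟨v, hv⟩ ⟨u, hu⟩).1 hx]
  · rintro ⟨v, rfl⟩
    exact (mem_iff_graphMap hΓ v _).2 rfl

/-- The curve `t ↦ Λ t` of subspaces is smooth at every point of `I`: around each `τ ∈ I` some
graph coordinates `Λ t ↦ ⟨Δ, Λ t, Γ⟩` on the chart of subspaces transversal to `Γ` are smooth
functions of `t`. -/
def IsSmoothCurve (Λ : ℝ → Submodule ℝ W) (I : Set ℝ) : Prop :=
  ∀ τ ∈ I, ∃ Δ Γ : Submodule ℝ W, IsCompl Δ Γ ∧ ∀ᶠ t in 𝓝 τ,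
    IsCompl (Λ t) Γ ∧ ContDiffAt ℝ ∞ (fun s => graphMap Δ (Λ s) Γ) t

/-- The function `φ` has a zero of (finite) order exactly `k` at `τ`. -/
def HasZeroOfOrder (φ : ℝ → ℝ) (τ : ℝ) (k : ℕ) : Prop :=
  (∀ j < k, iteratedDeriv j φ τ = 0) ∧ iteratedDeriv k φ τ ≠ 0

/-- The curve `Λ` of `m`-dimensional subspaces has weight `k` at `τ`: in a matrix coordinate
representation `t ↦ S_t` of the curve near `τ`, the function `t ↦ det (S_t - S_τ)` has a zero of
order `k` at `τ`. -/
def HasWeightAt (m : ℕ) (Λ : ℝ → Submodule ℝ W) (τ : ℝ) (k : ℕ) : Prop :=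
  ∃ (Δ Γ : Submodule ℝ W) (bΔ : Module.Basis (Fin m) ℝ Δ) (bΓ : Module.Basis (Fin m) ℝ Γ),
    IsCompl Δ Γ ∧ IsCompl (Λ τ) Γ ∧
    HasZeroOfOrder (fun t => (LinearMap.toMatrix bΔ bΓ (graphMap Δ (Λ t) Γ : Δ →ₗ[ℝ] Γ) -
      LinearMap.toMatrix bΔ bΓ (graphMap Δ (Λ τ) Γ : Δ →ₗ[ℝ] Γ)).det) τ k

/-- The infinitesimal cross-ratio: the trace of the composition of
`d/ds ⟨Λ t₀, Λ s, Λ t₁⟩` at `s = t₀`, a map from `Λ t₀` to `Λ t₁`, with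
`d/ds ⟨Λ t₁, Λ s, Λ t₀⟩` at `s = t₁`, a map from `Λ t₁` to `Λ t₀`. -/
def crossTrace (Λ : ℝ → Submodule ℝ W) (t₀ t₁ : ℝ) : ℝ :=
  LinearMap.trace ℝ (Λ t₀)
    (((deriv (fun s => graphMap (Λ t₁) (Λ s) (Λ t₀)) t₁).comp
      (deriv (fun s => graphMap (Λ t₀) (Λ s) (Λ t₁)) t₀) : Λ t₀ →L[ℝ] Λ t₀) :
        Λ t₀ →ₗ[ℝ] Λ t₀)

/-- `g` is the generating function of the curve `Λ` of constant weight `k` on `J`: it is smooth on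
a neighbourhood `U` of the diagonal `{(t, t) | t ∈ J}`, and off the diagonal of `U` the infinitesimal
cross-ratio is (well defined and) equal to `-k / (t₀ - t₁)² - g t₀ t₁`. -/
def IsGeneratingFunction (Λ : ℝ → Submodule ℝ W) (J : Set ℝ) (k : ℕ) (g : ℝ → ℝ → ℝ) : Prop :=
  ∃ U : Set (ℝ × ℝ), IsOpen U ∧ (∀ t ∈ J, (t, t) ∈ U) ∧
    ContDiffOn ℝ ∞ (Function.uncurry g) U ∧
    ∀ t₀ t₁ : ℝ, (t₀, t₁) ∈ U → t₀ ≠ t₁ →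
      IsCompl (Λ t₀) (Λ t₁) ∧ crossTrace Λ t₀ t₁ = -(k : ℝ) / (t₀ - t₁) ^ 2 - g t₀ t₁

/-- `ρ` is the (generalized) Ricci curvature of the parametrized curve `Λ` of constant weight `k`
on `J`: the restriction of the generating function to the diagonal. -/
def IsRicciCurvature (Λ : ℝ → Submodule ℝ W) (J : Set ℝ) (k : ℕ) (ρ : ℝ → ℝ) : Prop :=
  ∃ g : ℝ → ℝ → ℝ, IsGeneratingFunction Λ J k g ∧ ∀ t ∈ J, ρ t = g t t

/-- `t = ψ s`, `s ∈ V`, is a local reparametrization of the curve `Λ` on `I` by a parameter `s`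
which is projective, i.e. in which the Ricci curvature vanishes identically;
`g` is the generating function of the curve with respect to `s`. -/
structure IsProjectiveParameter (Λ : ℝ → Submodule ℝ W) (I : Set ℝ) (k : ℕ)
    (ψ : ℝ → ℝ) (V : Set ℝ) (g : ℝ → ℝ → ℝ) : Prop where
  isOpen : IsOpen V
  ordConnected : V.OrdConnected
  mapsTo : Set.MapsTo ψ V I
  contDiffOn : ContDiffOn ℝ ∞ ψ V
  deriv_ne_zero : ∀ s ∈ V, deriv ψ s ≠ 0
  isGeneratingFunction : IsGeneratingFunction (fun s => Λ (ψ s)) V k g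
  ricci_eq_zero : ∀ s ∈ V, g s s = 0

/-- `A` is the density, with respect to the given parameter `t ∈ I` of the curve `Λ`, of its
fundamental form. The fundamental form is the differential of degree four which in a projective
parameter `s` reads `(1/2) ∂²g/∂s₁² (s₀, s₁)|_{s₀ = s₁ = s} (ds)⁴`, with `g` the generating function
with respect to `s`; so `A(t) (dt)⁴` equals it after the substitution `t = ψ s`, `dt = ψ' ds`. -/
def IsFundamentalDensity (Λ : ℝ → Submodule ℝ W) (I : Set ℝ) (k : ℕ) (A : ℝ → ℝ) : Prop :=
  ∀ t ∈ I, ∃ (ψ : ℝ → ℝ) (V : Set ℝ) (g : ℝ → ℝ → ℝ) (s₀ : ℝ),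
    IsProjectiveParameter Λ I k ψ V g ∧ s₀ ∈ V ∧ ψ s₀ = t ∧
    A t * deriv ψ s₀ ^ 4 = 1 / 2 * iteratedDeriv 2 (fun s₁ => g s₀ s₁) s₀

/-- The subspace `L` is Lagrangian: it coincides with its skew-orthogonal complement. -/
def IsLagrangian (σ : LinearMap.BilinForm ℝ W) (L : Submodule ℝ W) : Prop :=
  L.orthogonalBilin σ = L

/-- The quadratic form `Q` on `Λ τ` is the velocity of the curve `Λ` of Lagrangian subspaces
at `τ`: `Q (l τ) = σ (l' τ) (l τ)` for every curve of vectors `l t ∈ Λ t`. -/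
def IsVelocityForm (σ : LinearMap.BilinForm ℝ W) (Λ : ℝ → Submodule ℝ W) (τ : ℝ)
    (Q : QuadraticForm ℝ (Λ τ)) : Prop :=
  ∀ (l : ℝ → W) (l' : W) (v : Λ τ), l τ = v → (∀ᶠ t in 𝓝 τ, l t ∈ Λ t) →
    HasDerivAt l l' τ → Q v = σ l' v

/-- The curve is nondecreasing of rank `1` at `τ`: its velocity is a nonnegative definite
quadratic form of rank `1`. -/
def IsNondecreasingRankOneAt (σ : LinearMap.BilinForm ℝ W) (Λ : ℝ → Submodule ℝ W)
    (τ : ℝ) : Prop :=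
  ∃ Q : QuadraticForm ℝ (Λ τ), IsVelocityForm σ Λ τ Q ∧
    Module.finrank ℝ (LinearMap.range (QuadraticMap.associated (R := ℝ) Q)) = 1 ∧
    ∀ v, 0 ≤ Q v

/-- `w` is the vector `w(t, τ) ∈ Λ τ`, unique up to sign, such that the velocity at `t` of
`t ↦ Λ t`, as a curve in the affine space of subspaces transversal to `Λ τ`, is
`v ↦ -⟨v, w⟩²`. The affine space is coordinatized by `⟨Δ, Λ t, Λ τ⟩` with `Δ` transversal to
`Λ τ`, and `v ∈ Δ` acts as an element of the dual of `Λ τ` by `x ↦ σ v x`. -/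
def IsVelocityVector (σ : LinearMap.BilinForm ℝ W) (Λ : ℝ → Submodule ℝ W) (t τ : ℝ)
    (w : W) : Prop :=
  w ∈ Λ τ ∧ IsCompl (Λ t) (Λ τ) ∧
    ∀ Δ : Submodule ℝ W, IsCompl Δ (Λ τ) → ∀ v : Δ,
      σ (v : W) ((deriv (fun s => graphMap Δ (Λ s) (Λ τ)) t v : Λ τ) : W) = -(σ (v : W) w) ^ 2

/-- `(e 0, …, e (m-1))` is the canonical basis of `Λ τ`: the basis formed by the coefficients of
the polar part at `t = τ`, of order `m`, of `t ↦ w(t, τ)`, that is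
`w(t, τ) = ∑ i, (t - τ) ^ (i - m) • e i + O(1)`, with `i` running from `0` to `m - 1`. -/
def IsCanonicalBasis {m : ℕ} (σ : LinearMap.BilinForm ℝ W) (Λ : ℝ → Submodule ℝ W) (τ : ℝ)
    (e : Fin m → W) : Prop :=
  LinearIndependent ℝ e ∧ Submodule.span ℝ (Set.range e) = Λ τ ∧
  ∃ w : ℝ → W, (∀ᶠ t in 𝓝[≠] τ, IsVelocityVector σ Λ t τ (w t)) ∧
    (fun t => w t - ∑ i : Fin m, (t - τ) ^ ((i : ℤ) - (m : ℤ)) • e i)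
      =O[𝓝[≠] τ] (fun _ => (1 : ℝ))

/-- `(e 0, …, e (m-1), f 0, …, f (m-1))` is a symplectic frame, normalized by
`σ (f i) (e j) = δ i j`. -/
def IsSymplecticFrame {m : ℕ} (σ : LinearMap.BilinForm ℝ W) (e f : Fin m → W) : Prop :=
  ∀ i j, σ (e i) (e j) = 0 ∧ σ (f i) (f j) = 0 ∧ σ (f i) (e j) = if i = j then 1 else 0

end Grassmannian

end

end GrassmannCurve

/-! Everything is expressed through the pairings σ(eᵢ(t), eⱼ(τ)), above all P(t,τ) = σ(e₁(t), e₁(τ))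
and the determinant D(t,τ) of the 2×2 matrix of all pairings (`pairDet`). Since the planes are
Lagrangian, Λ(t) and Λ(τ) are transversal exactly when D ≠ 0, and Cramer's rule gives the maps ⟨Δ,
Λ(t), Λ(τ)⟩. As the velocity has rank 1, both factors of the infinitesimal cross-ratio have rank 1,
and the trace becomes −16 (P/D)² (`crossTrace_eq`).

Normalization of the frame. Testing the definition of w(t,τ) on Δ = Λ(t) gives σ(a′(t), a(t)) =
σ(a(t), w(t,τ))² for a = e₁, e₂. The prescribed polar part of w turns this into conditions on Taylor
coefficients. They force e₁ into the kernel of the velocity, so that e₁′ = α e₁ + m e₂ and e₂′ = a₂₁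
e₁ + a₂₂ e₂ + b f₂, and then m = 3, b = 4 (`velocity_equations`, `m_ne_zero`) and α = 0
(`alpha_eq_zero`). Differentiating the symplectic relations supplies the rest of the matrix. Then D
has a zero of order 4 on the diagonal, and D is det(S_t − S_τ) up to nonvanishing factors, so k = 4
(`weight_eq`).

Expansion. Iterating the structural equation on e₁ up to order seven, the coefficients of P and D
that matter depend only on U = −(a₂₂′ + 6a₂₁ + a₂₂² + 4a₄₂) and on one fourth-order combination κ
(`coeff_pair_e₁`). The identity (4 + (s−t)² g) D² = 16 (s−t)² P² then yields the second-order jet of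
g(t,·) at the diagonal (`coeff_generatingFunction`): the value is ρ = (2/15)U and the second
coefficient is (U″ + κ)/35 + (11/2100)U². Smoothness of g itself follows from Hadamard's lemma.

Change of parameter. The chain rule multiplies the cross-ratio by ψ′(s₀)ψ′(s₁). Hence ρ transforms
with two thirds of the Schwarzian of ψ (`ricci_reparam`), projective parameters are solutions of a
third-order ODE, and the coefficient of the fundamental form in such a parameter is ψ′⁴ (g₂ −
(3/20)(ρ² + ρ″)), where g₂ is the second Taylor coefficient of g (`fundamentalForm_reparam`).
Substituting the expansion of g gives both formulas. -/

namespace GrassmannCurve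

noncomputable section

/-! ### Formal Taylor series and orders of vanishing. -/

section TaylorSeries

/-- The formal Taylor series of `f` at `τ`. -/
def taylorSeries (f : ℝ → ℝ) (τ : ℝ) : PowerSeries ℝ :=
  PowerSeries.mk fun n => iteratedDeriv n f τ / (n.factorial : ℝ)

theorem coeff_taylorSeries (f : ℝ → ℝ) (τ : ℝ) (n : ℕ) :
    PowerSeries.coeff n (taylorSeries f τ) = iteratedDeriv n f τ / (n.factorial : ℝ) :=
  PowerSeries.coeff_mk _ _

variable {f g : ℝ → ℝ} {τ : ℝ}

theorem taylorSeries_congr (h : f =ᶠ[𝓝 τ] g) : taylorSeries f τ = taylorSeries g τ := by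
  ext n
  rw [coeff_taylorSeries, coeff_taylorSeries, h.iteratedDeriv_eq]

theorem taylorSeries_mul (hf : ContDiffAt ℝ ∞ f τ) (hg : ContDiffAt ℝ ∞ g τ) :
    taylorSeries (fun t => f t * g t) τ = taylorSeries f τ * taylorSeries g τ := by
  ext n
  rw [coeff_taylorSeries, iteratedDeriv_fun_mul (hf.of_le (by exact_mod_cast le_top))
    (hg.of_le (by exact_mod_cast le_top)), PowerSeries.coeff_mul,
    Finset.Nat.sum_antidiagonal_eq_sum_range_succ_mk, Finset.sum_div]
  refine Finset.sum_congr rfl fun i hi => ?_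
  have hi' : i ≤ n := Nat.lt_succ_iff.1 (Finset.mem_range.1 hi)
  rw [coeff_taylorSeries, coeff_taylorSeries, Nat.cast_choose ℝ hi']
  have h1 : (n.factorial : ℝ) ≠ 0 := by positivity
  have h2 : (i.factorial : ℝ) ≠ 0 := by positivity
  have h3 : ((n - i).factorial : ℝ) ≠ 0 := by positivity
  field_simp

theorem taylorSeries_add (hf : ContDiffAt ℝ ∞ f τ) (hg : ContDiffAt ℝ ∞ g τ) :
    taylorSeries (fun t => f t + g t) τ = taylorSeries f τ + taylorSeries g τ := by
  ext n
  rw [map_add, coeff_taylorSeries, coeff_taylorSeries, coeff_taylorSeries,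
    iteratedDeriv_fun_add (hf.of_le (by exact_mod_cast le_top))
    (hg.of_le (by exact_mod_cast le_top)), add_div]

theorem taylorSeries_sub (hf : ContDiffAt ℝ ∞ f τ) (hg : ContDiffAt ℝ ∞ g τ) :
    taylorSeries (fun t => f t - g t) τ = taylorSeries f τ - taylorSeries g τ := by
  ext n
  rw [map_sub, coeff_taylorSeries, coeff_taylorSeries, coeff_taylorSeries,
    iteratedDeriv_fun_sub (hf.of_le (by exact_mod_cast le_top))
    (hg.of_le (by exact_mod_cast le_top)), sub_div]

theorem taylorSeries_const (c τ : ℝ) :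
    taylorSeries (fun _ => c) τ = PowerSeries.C c := by
  ext n
  rw [coeff_taylorSeries, iteratedDeriv_const, PowerSeries.coeff_C]
  split_ifs with h <;> simp [h]

theorem taylorSeries_pow (hf : ContDiffAt ℝ ∞ f τ) (n : ℕ) :
    taylorSeries (fun t => f t ^ n) τ = taylorSeries f τ ^ n := by
  induction n with
  | zero => simpa using taylorSeries_const 1 τ
  | succ n ih =>
    simp only [pow_succ]
    rw [taylorSeries_mul (hf.pow n) hf, ih]

theorem taylorSeries_const_mul (c : ℝ) (hf : ContDiffAt ℝ ∞ f τ) :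
    taylorSeries (fun t => c * f t) τ = PowerSeries.C c * taylorSeries f τ := by
  rw [taylorSeries_mul contDiffAt_const hf, taylorSeries_const]

theorem coeff_succ_taylorSeries (n : ℕ) :
    PowerSeries.coeff (n + 1) (taylorSeries f τ) =
      PowerSeries.coeff n (taylorSeries (deriv f) τ) / (n + 1) := by
  rw [coeff_taylorSeries, coeff_taylorSeries, iteratedDeriv_succ', Nat.factorial_succ]
  push_cast
  have h1 : (n.factorial : ℝ) ≠ 0 := by positivity
  field_simp

theorem coeff_taylorSeries_deriv (n : ℕ) :
    PowerSeries.coeff n (taylorSeries (deriv f) τ) =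
      (n + 1) * PowerSeries.coeff (n + 1) (taylorSeries f τ) := by
  rw [coeff_succ_taylorSeries]
  have : (n + 1 : ℝ) ≠ 0 := by positivity
  field_simp

theorem coeff_zero_taylorSeries : PowerSeries.coeff 0 (taylorSeries f τ) = f τ := by
  simp [coeff_taylorSeries]

theorem taylorSeries_sub_self : taylorSeries (fun t => t - τ) τ = PowerSeries.X := by
  have h : deriv (fun t : ℝ => t - τ) = fun _ => 1 := by
    funext t; simp
  ext n
  cases n with
  | zero => rw [coeff_zero_taylorSeries]; simp
  | succ n =>
    rw [coeff_succ_taylorSeries, h, taylorSeries_const, PowerSeries.coeff_C,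
      PowerSeries.coeff_X]
    rcases n with _ | n <;> simp

/-- Taylor's theorem for the truncations of the Taylor series. -/
theorem sub_sum_taylorSeries_isBigO (hf : ContDiffAt ℝ ∞ f τ) (n : ℕ) :
    (fun t => f t - ∑ j ∈ Finset.range n,
      PowerSeries.coeff j (taylorSeries f τ) * (t - τ) ^ j) =O[𝓝 τ] fun t => (t - τ) ^ n := by
  obtain ⟨u, hu, hfu⟩ := hf.contDiffOn (m := (n : ℕ∞)) (by exact_mod_cast le_top) (by simp)
  obtain ⟨ε, hε, hball⟩ := Metric.mem_nhds_iff.1 hu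
  have hτ : τ ∈ Metric.ball τ ε := Metric.mem_ball_self hε
  have h1 := taylor_isLittleO (convex_ball τ ε) hτ
    (hfu.mono hball : ContDiffOn ℝ (n : ℕ∞) f (Metric.ball τ ε))
  rw [nhdsWithin_eq_nhds.2 (Metric.ball_mem_nhds τ hε)] at h1
  have h2 : (fun t => PowerSeries.coeff n (taylorSeries f τ) * (t - τ) ^ n) =O[𝓝 τ]
      fun t => (t - τ) ^ n := isBigO_const_mul_self _ _ _
  refine (h1.isBigO.add h2).congr_left fun t => ?_
  rw [taylor_within_apply, Finset.sum_range_succ]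
  have h3 : ∀ k, iteratedDerivWithin k f (Metric.ball τ ε) τ = iteratedDeriv k f τ := fun k =>
    iteratedDerivWithin_of_isOpen Metric.isOpen_ball hτ
  simp only [h3, coeff_taylorSeries, smul_eq_mul]
  have h4 : ∀ k, ((k.factorial : ℝ)⁻¹ * (t - τ) ^ k) * iteratedDeriv k f τ =
      iteratedDeriv k f τ / (k.factorial : ℝ) * (t - τ) ^ k := fun k => by ring
  simp only [h4]
  ring

/-- A function with Taylor series divisible by `X ^ n` is `O((t - τ) ^ n)`. -/
theorem isBigO_of_coeff_taylorSeries (hf : ContDiffAt ℝ ∞ f τ) {n : ℕ}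
    (h : ∀ j < n, PowerSeries.coeff j (taylorSeries f τ) = 0) :
    f =O[𝓝 τ] fun t => (t - τ) ^ n := by
  refine (sub_sum_taylorSeries_isBigO hf n).congr_left fun t => ?_
  rw [Finset.sum_eq_zero, sub_zero]
  intro j hj
  rw [h j (Finset.mem_range.1 hj), zero_mul]

theorem pow_isBigO_pow_of_le (τ : ℝ) {m n : ℕ} (h : m ≤ n) :
    (fun t => (t - τ) ^ n) =O[𝓝[≠] τ] fun t => (t - τ) ^ m := by
  have h1 : Tendsto (fun t => ‖t - τ‖) (𝓝[≠] τ) (𝓝 0) := by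
    have : Continuous fun t : ℝ => ‖t - τ‖ := by fun_prop
    simpa using (this.tendsto τ).mono_left nhdsWithin_le_nhds
  refine IsBigO.of_bound 1 ((h1.eventually_lt_const one_pos).mono fun t ht => ?_)
  rw [norm_pow, norm_pow, one_mul]
  exact pow_le_pow_of_le_one (norm_nonneg _) ht.le h

/-- If all lower coefficients vanish, the next one, c, satisfies c (t − τ)^j = O((t − τ)^(j+1));
dividing, the constant c is O(t − τ), hence zero. This is how relations with merely bounded
remainders, known off τ only, become identities between Taylor coefficients. -/
theorem coeff_taylorSeries_of_isBigO (hf : ContDiffAt ℝ ∞ f τ) {n : ℕ}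
    (h : f =O[𝓝[≠] τ] fun t => (t - τ) ^ n) :
    ∀ j < n, PowerSeries.coeff j (taylorSeries f τ) = 0 := by
  intro j
  induction j using Nat.strong_induction_on with
  | _ j ih =>
    intro hj
    set c := PowerSeries.coeff j (taylorSeries f τ) with hc
    have h1 : (fun t => f t - c * (t - τ) ^ j) =O[𝓝[≠] τ] fun t => (t - τ) ^ (j + 1) := by
      refine ((sub_sum_taylorSeries_isBigO hf (j + 1)).mono nhdsWithin_le_nhds).congr_left
        fun t => ?_
      rw [Finset.sum_range_succ, Finset.sum_eq_zero, zero_add]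
      intro i hi
      have hi' := Finset.mem_range.1 hi
      rw [ih i hi' (hi'.trans hj), zero_mul]
    have h2 : (fun t => (t - τ) ^ n) =O[𝓝[≠] τ] fun t => (t - τ) ^ (j + 1) :=
      pow_isBigO_pow_of_le τ hj
    have h3 : (fun t => c * (t - τ) ^ j) =O[𝓝[≠] τ] fun t => (t - τ) ^ (j + 1) := by
      refine ((h.trans h2).sub h1).congr_left fun t => by ring
    have h4 : (fun _ : ℝ => c) =O[𝓝[≠] τ] fun t => t - τ := by
      have h5 := h3.mul (isBigO_refl (fun t => ((t - τ) ^ j)⁻¹) (𝓝[≠] τ))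
      refine h5.congr' ?_ ?_
      · filter_upwards [self_mem_nhdsWithin] with t ht
        have : (t - τ) ^ j ≠ 0 := pow_ne_zero _ (sub_ne_zero.2 ht)
        field_simp
      · filter_upwards [self_mem_nhdsWithin] with t ht
        have : (t - τ) ^ j ≠ 0 := pow_ne_zero _ (sub_ne_zero.2 ht)
        rw [pow_succ]
        field_simp
    have h6 : Tendsto (fun t => t - τ) (𝓝[≠] τ) (𝓝 0) := by
      have : Continuous fun t : ℝ => t - τ := by fun_prop
      simpa using (this.tendsto τ).mono_left nhdsWithin_le_nhds
    exact tendsto_const_nhds_iff.1 (h4.trans_tendsto h6)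

end TaylorSeries

/-! ### Hadamard's lemma: smooth division by powers of x − y. -/

section Hadamard

open MeasureTheory Set

theorem exists_bound_nhds_of_continuousOn {E F : Type} [NormedAddCommGroup E]
    [NormedSpace ℝ E] [FiniteDimensional ℝ E] [NormedAddCommGroup F]
    {f : E × ℝ → F} {O : Set (E × ℝ)} {S : Set E} (hS : IsOpen S)
    (h : ∀ x ∈ S, ∀ θ ∈ Icc (0 : ℝ) 1, (x, θ) ∈ O) (hf : ContinuousOn f O) {x₀ : E} (hx : x₀ ∈ S) :
    ∃ K ∈ 𝓝 x₀, K ⊆ S ∧ ∃ C : ℝ, ∀ x ∈ K, ∀ θ ∈ Icc (0 : ℝ) 1, ‖f (x, θ)‖ ≤ C := by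
  have : ProperSpace E := FiniteDimensional.proper ℝ E
  obtain ⟨ε, hε, hb⟩ := Metric.nhds_basis_closedBall.mem_iff.1 (hS.mem_nhds hx)
  have hK : IsCompact (Metric.closedBall x₀ ε ×ˢ Icc (0 : ℝ) 1) :=
    (isCompact_closedBall x₀ ε).prod isCompact_Icc
  obtain ⟨C, hC⟩ := hK.exists_bound_of_continuousOn
    (hf.mono fun p hp => h p.1 (hb hp.1) p.2 hp.2)
  exact ⟨_, Metric.closedBall_mem_nhds x₀ hε, hb, C, fun x hx θ hθ => hC (x, θ) ⟨hx, hθ⟩⟩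

theorem continuousOn_slice {E F : Type} [TopologicalSpace E] [TopologicalSpace F]
    {f : E × ℝ → F} {O : Set (E × ℝ)} {S : Set E}
    (h : ∀ x ∈ S, ∀ θ ∈ Icc (0 : ℝ) 1, (x, θ) ∈ O) (hf : ContinuousOn f O) {x : E} (hx : x ∈ S) :
    ContinuousOn (fun θ => f (x, θ)) (Icc 0 1) :=
  hf.comp (Continuous.continuousOn (by fun_prop)) fun θ hθ => h x hx θ hθ

/-- Smooth dependence on the parameter of an integral over `[0, 1]`. -/
theorem contDiffOn_parametric_integral {E : Type} [NormedAddCommGroup E] [NormedSpace ℝ E]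
    [FiniteDimensional ℝ E] (n : ℕ) : ∀ {F : Type} [NormedAddCommGroup F] [NormedSpace ℝ F]
    [CompleteSpace F] {f : E × ℝ → F} {O : Set (E × ℝ)} {S : Set E}, IsOpen O → IsOpen S →
    (∀ x ∈ S, ∀ θ ∈ Icc (0 : ℝ) 1, (x, θ) ∈ O) → ContDiffOn ℝ n f O →
    ContDiffOn ℝ n (fun x => ∫ θ in (0 : ℝ)..1, f (x, θ)) S := by
  have hI : uIoc (0 : ℝ) 1 ⊆ Icc 0 1 := by
    rw [uIoc_of_le zero_le_one]; exact Ioc_subset_Icc_self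
  -- The target space is quantified inside the induction, because the derivative is an integral of
  -- the same kind with values in `E →L[ℝ] F`.
  induction n with
  | zero =>
    intro F _ _ _ f O S hO hS h hf
    rw [Nat.cast_zero, contDiffOn_zero] at hf ⊢
    intro x₀ hx₀
    obtain ⟨K, hK, hKS, C, hC⟩ := exists_bound_nhds_of_continuousOn hS h hf hx₀
    refine (intervalIntegral.continuousAt_of_dominated_interval (bound := fun _ => C)
      ?_ ?_ (by simp) ?_).continuousWithinAt
    · filter_upwards [hK] with x hx
      exact ((continuousOn_slice h hf (hKS hx)).mono hI).aestronglyMeasurable measurableSet_uIoc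
    · filter_upwards [hK] with x hx
      exact Eventually.of_forall fun θ hθ => hC x hx θ (hI hθ)
    · refine Eventually.of_forall fun θ hθ => ?_
      have h1 : ContinuousAt f (x₀, θ) := hf.continuousAt (hO.mem_nhds (h x₀ hx₀ θ (hI hθ)))
      exact ContinuousAt.comp (f := fun x => (x, θ)) h1 (by fun_prop)
  | succ n ih =>
    intro F _ _ _ f O S hO hS h hf
    have hf' := hf
    push_cast at hf' ⊢
    rw [contDiffOn_succ_iff_fderiv_of_isOpen hO] at hf'
    rw [contDiffOn_succ_iff_fderiv_of_isOpen hS]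
    set f' : E × ℝ → E →L[ℝ] F := fun p => (fderiv ℝ f p).comp (ContinuousLinearMap.inl ℝ E ℝ)
      with hf'def
    have hcd : ContDiffOn ℝ n f' O := hf'.2.2.clm_comp contDiffOn_const
    have hder : ∀ x ∈ S, HasFDerivAt (fun x => ∫ θ in (0 : ℝ)..1, f (x, θ))
        (∫ θ in (0 : ℝ)..1, f' (x, θ)) x := by
      intro x₀ hx₀
      obtain ⟨K, hK, hKS, C, hC⟩ :=
        exists_bound_nhds_of_continuousOn hS h hcd.continuousOn hx₀
      refine intervalIntegral.hasFDerivAt_integral_of_dominated_of_fderiv_le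
        (F := fun x θ => f (x, θ)) (F' := fun x θ => f' (x, θ)) (bound := fun _ => C)
        hK ?_ ?_ ?_ ?_ (by simp) ?_
      · filter_upwards [hK] with x hx
        exact ((continuousOn_slice h hf.continuousOn (hKS hx)).mono hI).aestronglyMeasurable
          measurableSet_uIoc
      · refine ContinuousOn.intervalIntegrable ?_
        rw [uIcc_of_le zero_le_one]
        exact continuousOn_slice h hf.continuousOn hx₀
      · exact ((continuousOn_slice h hcd.continuousOn hx₀).mono hI).aestronglyMeasurable
          measurableSet_uIoc
      · exact Eventually.of_forall fun θ hθ x hx => hC x hx θ (hI hθ)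
      · refine Eventually.of_forall fun θ hθ x hx => ?_
        have hp := h x (hKS hx) θ (hI hθ)
        have h1 : HasFDerivAt f (fderiv ℝ f (x, θ)) (x, θ) :=
          ((hf'.1 _ hp).differentiableAt (hO.mem_nhds hp)).hasFDerivAt
        exact h1.comp x (hasFDerivAt_prodMk_left x θ)
    refine ⟨fun x hx => (hder x hx).differentiableAt.differentiableWithinAt, by simp, ?_⟩
    exact (ih hO hS h hcd).congr fun x hx => (hder x hx).fderiv

/-- Hadamard's lemma along the diagonal of `I × I`. -/
theorem exists_eq_sub_mul {I : Set ℝ} (hI : IsOpen I) (hc : I.OrdConnected) {f : ℝ × ℝ → ℝ}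
    (hf : ContDiffOn ℝ ∞ f (I ×ˢ I)) (h0 : ∀ t ∈ I, f (t, t) = 0) :
    ∃ k : ℝ × ℝ → ℝ, ContDiffOn ℝ ∞ k (I ×ˢ I) ∧
      ∀ x ∈ I, ∀ y ∈ I, f (x, y) = (x - y) * k (x, y) := by
  -- For fixed (x, y) this is the segment from (y, y), where f vanishes, to (x, y); the quotient is
  -- the integral of ∂₁f along it.
  set J : (ℝ × ℝ) × ℝ → ℝ × ℝ := fun p => (p.1.2 + p.2 * (p.1.1 - p.1.2), p.1.2) with hJ
  have hJs : ContDiff ℝ ∞ J := by rw [hJ]; fun_prop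
  have hII : IsOpen (I ×ˢ I) := hI.prod hI
  have hO : IsOpen (J ⁻¹' (I ×ˢ I)) := hII.preimage hJs.continuous
  have hmem : ∀ x ∈ I ×ˢ I, ∀ θ ∈ Icc (0 : ℝ) 1, (x, θ) ∈ J ⁻¹' (I ×ˢ I) := by
    rintro ⟨x, y⟩ ⟨hx, hy⟩ θ ⟨h0, h1⟩
    refine ⟨?_, hy⟩
    have := hc.convex hy hx (sub_nonneg.2 h1) h0 (by ring)
    simp only [smul_eq_mul] at this
    convert this using 1
    simp only [hJ]; ring
  set f' : (ℝ × ℝ) × ℝ → ℝ := fun p => fderiv ℝ f (J p) (1, 0) with hf'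
  have hfd : ContDiffOn ℝ ∞ (fderiv ℝ f) (I ×ˢ I) := by
    have := (contDiffOn_infty_iff_fderiv_of_isOpen hII).1 hf
    exact this.2
  have hcd : ContDiffOn ℝ ∞ f' (J ⁻¹' (I ×ˢ I)) :=
    (hfd.comp hJs.contDiffOn fun p hp => hp).clm_apply contDiffOn_const
  refine ⟨fun x => ∫ θ in (0 : ℝ)..1, f' (x, θ), ?_, ?_⟩
  · rw [contDiffOn_infty]
    intro n
    exact contDiffOn_parametric_integral n hO hII hmem (hcd.of_le (by exact_mod_cast le_top))
  · intro x hx y hy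
    have h1 : ∀ θ ∈ uIcc (0 : ℝ) 1, HasDerivAt (fun θ => f (J ((x, y), θ)))
        ((x - y) * f' ((x, y), θ)) θ := by
      intro θ hθ
      rw [uIcc_of_le zero_le_one] at hθ
      have hp := hmem (x, y) ⟨hx, hy⟩ θ hθ
      have h2 : HasFDerivAt f (fderiv ℝ f (J ((x, y), θ))) (J ((x, y), θ)) :=
        ((hf.differentiableOn (by simp) _ hp).differentiableAt (hII.mem_nhds hp)).hasFDerivAt
      have h3 : HasDerivAt (fun θ => J ((x, y), θ)) (x - y, 0) θ := by
        have h4 : HasDerivAt (fun θ : ℝ => y + θ * (x - y)) (x - y) θ := by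
          simpa using ((hasDerivAt_id θ).mul_const (x - y)).const_add y
        exact h4.prodMk (hasDerivAt_const θ y)
      have h5 := h2.comp_hasDerivAt θ h3
      have h6 : ((x - y, 0) : ℝ × ℝ) = (x - y) • (1, 0) := by simp
      rw [h6, map_smul, smul_eq_mul] at h5
      exact h5
    have h2 := intervalIntegral.integral_eq_sub_of_hasDerivAt h1 (by
      refine ContinuousOn.intervalIntegrable ?_
      rw [uIcc_of_le zero_le_one]
      exact continuousOn_const.mul (continuousOn_slice hmem hcd.continuousOn ⟨hx, hy⟩))
    rw [intervalIntegral.integral_const_mul] at h2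
    simp only [hJ] at h2
    rw [h2]
    simp [h0 y hy]

theorem contDiffAt_slice {I : Set ℝ} (hI : IsOpen I) {f : ℝ × ℝ → ℝ}
    (hf : ContDiffOn ℝ ∞ f (I ×ˢ I)) {x y : ℝ} (hx : x ∈ I) (hy : y ∈ I) :
    ContDiffAt ℝ ∞ (fun s => f (s, y)) x := by
  have h1 : ContDiffAt ℝ ∞ f (x, y) := hf.contDiffAt ((hI.prod hI).mem_nhds ⟨hx, hy⟩)
  exact ContDiffAt.comp (f := fun s : ℝ => (s, y)) x h1 (by fun_prop)

/-- Iterated Hadamard's lemma: a function vanishing to order `n` along the diagonal is divisible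
by the `n`-th power of `x - y`. -/
theorem exists_eq_sub_pow_mul {I : Set ℝ} (hI : IsOpen I) (hc : I.OrdConnected) (n : ℕ) :
    ∀ {f : ℝ × ℝ → ℝ}, ContDiffOn ℝ ∞ f (I ×ˢ I) →
    (∀ t ∈ I, ∀ j < n, PowerSeries.coeff j (taylorSeries (fun s => f (s, t)) t) = 0) →
    ∃ k : ℝ × ℝ → ℝ, ContDiffOn ℝ ∞ k (I ×ˢ I) ∧
      ∀ x ∈ I, ∀ y ∈ I, f (x, y) = (x - y) ^ n * k (x, y) := by
  induction n with
  | zero => exact fun {f} hf _ => ⟨f, hf, by simp⟩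
  | succ n ih =>
    intro f hf h
    obtain ⟨k, hk, hfk⟩ := exists_eq_sub_mul hI hc hf fun t ht => by
      simpa [coeff_zero_taylorSeries] using h t ht 0 n.succ_pos
    obtain ⟨k', hk', hkk'⟩ := ih hk fun t ht j hj => by
      have h1 : taylorSeries (fun s => f (s, t)) t =
          PowerSeries.X * taylorSeries (fun s => k (s, t)) t := by
        rw [← taylorSeries_sub_self, ← taylorSeries_mul (by fun_prop)
          (contDiffAt_slice hI hk ht ht)]
        refine taylorSeries_congr ?_
        filter_upwards [hI.mem_nhds ht] with s hs using hfk s hs t ht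
      have h2 := h t ht (j + 1) (Nat.succ_lt_succ hj)
      rwa [h1, PowerSeries.coeff_succ_X_mul] at h2
    exact ⟨k', hk', fun x hx y hy => by rw [hfk x hx y hy, hkk' x hx y hy, pow_succ']; ring⟩

end Hadamard

/-! ### Transversality, graph maps and the cross-ratio in a Lagrangian frame. -/

section Frames

set_option linter.unusedSectionVars false

variable {W : Type*} [NormedAddCommGroup W] [NormedSpace ℝ W] [FiniteDimensional ℝ W]

theorem differentiableAt_smul_sub {E : Type*} [NormedAddCommGroup E] [NormedSpace ℝ E]
    {a b c : ℝ → ℝ} {p q : ℝ → E} {t : ℝ} (ha : DifferentiableAt ℝ a t)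
    (hb : DifferentiableAt ℝ b t) (hc : DifferentiableAt ℝ c t) (hp : DifferentiableAt ℝ p t)
    (hq : DifferentiableAt ℝ q t) :
    DifferentiableAt ℝ (fun s => a s • (b s • p s - c s • q s)) t :=
  ha.smul ((hb.smul hp).sub (hc.smul hq))

theorem differentiableAt_add {E : Type*} [NormedAddCommGroup E] [NormedSpace ℝ E]
    {p q : ℝ → E} {t : ℝ} (hp : DifferentiableAt ℝ p t) (hq : DifferentiableAt ℝ q t) :
    DifferentiableAt ℝ (fun s => p s + q s) t :=
  hp.add hq

theorem hasDerivAt_bilin (σ : LinearMap.BilinForm ℝ W) {a b : ℝ → W} {a' b' : W} {t : ℝ}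
    (ha : HasDerivAt a a' t) (hb : HasDerivAt b b' t) :
    HasDerivAt (fun s => σ (a s) (b s)) (σ a' (b t) + σ (a t) b') t := by
  have := (σ.toContinuousBilinearMap.hasFDerivAt.comp_hasDerivAt t ha).clm_apply hb
  simpa using this

theorem contDiffOn_bilin (σ : LinearMap.BilinForm ℝ W) {E : Type*} [NormedAddCommGroup E]
    [NormedSpace ℝ E] {a b : E → W} {S : Set E} (ha : ContDiffOn ℝ ∞ a S)
    (hb : ContDiffOn ℝ ∞ b S) : ContDiffOn ℝ ∞ (fun s => σ (a s) (b s)) S :=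
  (σ.toContinuousBilinearMap.contDiff.comp_contDiffOn ha).clm_apply hb

/-- A smooth symplectic frame along the curve `Λ` of Lagrangian planes, whose first two vectors
span `Λ t`. -/
structure IsLagrangianFrame (σ : LinearMap.BilinForm ℝ W) (Λ : ℝ → Submodule ℝ W) (I : Set ℝ)
    (e₁ e₂ f₁ f₂ : ℝ → W) : Prop where
  alt : σ.IsAlt
  isOpen : IsOpen I
  ordConnected : I.OrdConnected
  smooth₁ : ContDiffOn ℝ ∞ e₁ I
  smooth₂ : ContDiffOn ℝ ∞ e₂ I
  smooth₃ : ContDiffOn ℝ ∞ f₁ I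
  smooth₄ : ContDiffOn ℝ ∞ f₂ I
  mem_iff : ∀ t ∈ I, ∀ x, x ∈ Λ t ↔ σ x (e₁ t) = 0 ∧ σ x (e₂ t) = 0
  eq_comb : ∀ t ∈ I, ∀ x ∈ Λ t, x = σ (f₁ t) x • e₁ t + σ (f₂ t) x • e₂ t
  e₁e₂ : ∀ t ∈ I, σ (e₁ t) (e₂ t) = 0
  f₁f₂ : ∀ t ∈ I, σ (f₁ t) (f₂ t) = 0
  f₁e₁ : ∀ t ∈ I, σ (f₁ t) (e₁ t) = 1
  f₁e₂ : ∀ t ∈ I, σ (f₁ t) (e₂ t) = 0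
  f₂e₁ : ∀ t ∈ I, σ (f₂ t) (e₁ t) = 0
  f₂e₂ : ∀ t ∈ I, σ (f₂ t) (e₂ t) = 1

/-- The determinant of the pairing of the pairs `(e₁ t, e₂ t)` and `(e₁ τ, e₂ τ)`. -/
def pairDet (σ : LinearMap.BilinForm ℝ W) (e₁ e₂ : ℝ → W) (t τ : ℝ) : ℝ :=
  σ (e₁ t) (e₁ τ) * σ (e₂ t) (e₂ τ) - σ (e₁ t) (e₂ τ) * σ (e₂ t) (e₁ τ)

variable {σ : LinearMap.BilinForm ℝ W} {Λ : ℝ → Submodule ℝ W} {I : Set ℝ}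
  {e₁ e₂ f₁ f₂ : ℝ → W}

theorem contDiffOn_pair {a b : ℝ → W} (ha : ContDiffOn ℝ ∞ a I) (hb : ContDiffOn ℝ ∞ b I) :
    ContDiffOn ℝ ∞ (fun p : ℝ × ℝ => σ (a p.1) (b p.2)) (I ×ˢ I) :=
  contDiffOn_bilin σ (ha.comp contDiffOn_fst fun _ hp => hp.1)
    (hb.comp contDiffOn_snd fun _ hp => hp.2)

theorem graphMap_self {t τ : ℝ} (h : IsCompl (Λ t) (Λ τ)) (v : Λ t) :
    graphMap (Λ t) (Λ t) (Λ τ) v = 0 := by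
  refine ((mem_iff_graphMap h v 0).1 ?_).symm
  simp

namespace IsLagrangianFrame

variable (F : IsLagrangianFrame σ Λ I e₁ e₂ f₁ f₂)
include F

theorem swap (x y : W) : σ x y = -σ y x := by
  rw [F.alt.neg_eq]

theorem e₂e₁ {t : ℝ} (ht : t ∈ I) : σ (e₂ t) (e₁ t) = 0 := by
  rw [F.swap, F.e₁e₂ t ht, neg_zero]

theorem mem₁ {t : ℝ} (ht : t ∈ I) : e₁ t ∈ Λ t :=
  (F.mem_iff t ht _).2 ⟨F.alt _, F.e₁e₂ t ht⟩

theorem mem₂ {t : ℝ} (ht : t ∈ I) : e₂ t ∈ Λ t :=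
  (F.mem_iff t ht _).2 ⟨F.e₂e₁ ht, F.alt _⟩

theorem pairDet_comm (t τ : ℝ) : pairDet σ e₁ e₂ t τ = pairDet σ e₁ e₂ τ t := by
  unfold pairDet
  rw [F.swap (e₁ t) (e₁ τ), F.swap (e₂ t) (e₂ τ), F.swap (e₁ t) (e₂ τ), F.swap (e₂ t) (e₁ τ)]
  ring

/-- Cramer's rule: when D ≠ 0 the pairing between Λ t and Λ τ is perfect, so a vector of Λ τ is
recovered from its two pairings with the frame of Λ t. -/
theorem eq_of_mem {t τ : ℝ} (hτ : τ ∈ I) (hD : pairDet σ e₁ e₂ t τ ≠ 0) {x : W}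
    (hx : x ∈ Λ τ) : x =
      ((σ (e₁ t) (e₂ τ) * σ x (e₂ t) - σ (e₂ t) (e₂ τ) * σ x (e₁ t)) / pairDet σ e₁ e₂ t τ) • e₁ τ
      + ((σ (e₂ t) (e₁ τ) * σ x (e₁ t) - σ (e₁ t) (e₁ τ) * σ x (e₂ t)) / pairDet σ e₁ e₂ t τ)
        • e₂ τ := by
  set a := σ (f₁ τ) x with ha
  set b := σ (f₂ τ) x with hb
  have hx' : x = a • e₁ τ + b • e₂ τ := F.eq_comb τ hτ x hx
  have h1 : σ x (e₁ t) = -(a * σ (e₁ t) (e₁ τ) + b * σ (e₁ t) (e₂ τ)) := by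
    rw [F.swap, hx']; simp
  have h2 : σ x (e₂ t) = -(a * σ (e₂ t) (e₁ τ) + b * σ (e₂ t) (e₂ τ)) := by
    rw [F.swap, hx']; simp
  rw [h1, h2]
  have hD' := hD
  unfold pairDet at hD' ⊢
  nth_rw 1 [hx']
  congr 2 <;> rw [eq_div_iff hD'] <;> ring

/-- Since Λ τ is its own skew-orthogonal complement, the kernel of the pairing on Λ t is Λ t ∩ Λ τ,
and D is the determinant of that pairing. -/
theorem isCompl_iff {t τ : ℝ} (ht : t ∈ I) (hτ : τ ∈ I) :
    IsCompl (Λ t) (Λ τ) ↔ pairDet σ e₁ e₂ t τ ≠ 0 := by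
  constructor
  · intro h hD
    have h0 : ∀ x, x ∈ Λ t → σ x (e₁ τ) = 0 → σ x (e₂ τ) = 0 → x = 0 := fun x hx h1 h2 =>
      Submodule.disjoint_def.1 h.disjoint x hx ((F.mem_iff τ hτ x).2 ⟨h1, h2⟩)
    unfold pairDet at hD
    -- If D = 0, the combinations with cofactor coefficients are orthogonal to Λ τ, hence zero.
    -- Their `e₂ t`-coordinates show that `e₁ t` is itself orthogonal to Λ τ, so it vanishes too,
    -- against σ(f₁, e₁) = 1.
    have h1 := h0 (σ (e₂ t) (e₂ τ) • e₁ t - σ (e₁ t) (e₂ τ) • e₂ t)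
      (sub_mem (Submodule.smul_mem _ _ (F.mem₁ ht)) (Submodule.smul_mem _ _ (F.mem₂ ht)))
      (by simp; linarith) (by simp; ring)
    have h2 := h0 (σ (e₂ t) (e₁ τ) • e₁ t - σ (e₁ t) (e₁ τ) • e₂ t)
      (sub_mem (Submodule.smul_mem _ _ (F.mem₁ ht)) (Submodule.smul_mem _ _ (F.mem₂ ht)))
      (by simp; ring) (by simp; linarith)
    have h3 := congrArg (σ (f₂ t)) h1
    have h4 := congrArg (σ (f₂ t)) h2
    simp [F.f₂e₁ t ht, F.f₂e₂ t ht] at h3 h4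
    have h5 := h0 (e₁ t) (F.mem₁ ht) h4 h3
    have h6 := F.f₁e₁ t ht
    rw [h5] at h6
    simp at h6
  · intro hD
    refine IsCompl.of_eq ?_ ?_
    · rw [Submodule.eq_bot_iff]
      rintro x ⟨hx, hx'⟩
      have h1 := (F.mem_iff t ht x).1 hx
      rw [F.eq_of_mem hτ hD hx', h1.1, h1.2]
      simp
    · rw [Submodule.eq_top_iff']
      intro x
      -- The vector of Λ τ that solves σ(x + u, eᵢ(t)) = 0 for i = 1, 2, again by Cramer's rule.
      set u := ((σ x (e₁ t) * σ (e₂ t) (e₂ τ) - σ (e₁ t) (e₂ τ) * σ x (e₂ t)) /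
        pairDet σ e₁ e₂ t τ) • e₁ τ + ((σ (e₁ t) (e₁ τ) * σ x (e₂ t) -
        σ (e₂ t) (e₁ τ) * σ x (e₁ t)) / pairDet σ e₁ e₂ t τ) • e₂ τ with hu
      have hDe : pairDet σ e₁ e₂ t τ = σ (e₁ t) (e₁ τ) * σ (e₂ t) (e₂ τ) -
        σ (e₁ t) (e₂ τ) * σ (e₂ t) (e₁ τ) := rfl
      have hmem : u ∈ Λ τ := add_mem (Submodule.smul_mem _ _ (F.mem₁ hτ))
        (Submodule.smul_mem _ _ (F.mem₂ hτ))
      clear_value u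
      have h1 : σ (x + u) (e₁ t) = 0 := by
        rw [hu, map_add, LinearMap.add_apply, map_add, LinearMap.add_apply]
        simp only [map_smul, LinearMap.smul_apply, smul_eq_mul]
        rw [F.swap (e₁ τ), F.swap (e₂ τ)]
        generalize pairDet σ e₁ e₂ t τ = D at hD hDe
        field_simp
        rw [hDe]
        ring
      have h2 : σ (x + u) (e₂ t) = 0 := by
        rw [hu, map_add, LinearMap.add_apply, map_add, LinearMap.add_apply]
        simp only [map_smul, LinearMap.smul_apply, smul_eq_mul]
        rw [F.swap (e₁ τ), F.swap (e₂ τ)]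
        generalize pairDet σ e₁ e₂ t τ = D at hD hDe
        field_simp
        rw [hDe]
        ring
      refine Submodule.mem_sup.2 ⟨x + u, (F.mem_iff t ht _).2 ⟨h1, h2⟩, -u, neg_mem hmem, by abel⟩

theorem graphMap_eq (Δ : Submodule ℝ W) {t τ : ℝ} (ht : t ∈ I) (hτ : τ ∈ I)
    (hD : pairDet σ e₁ e₂ t τ ≠ 0) (v : Δ) :
    (graphMap Δ (Λ t) (Λ τ) v : W) =
      ((σ (e₂ t) (e₂ τ) * σ v (e₁ t) - σ (e₁ t) (e₂ τ) * σ v (e₂ t)) / pairDet σ e₁ e₂ t τ) • e₁ τ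
      + ((σ (e₁ t) (e₁ τ) * σ v (e₂ t) - σ (e₂ t) (e₁ τ) * σ v (e₁ t)) / pairDet σ e₁ e₂ t τ)
        • e₂ τ := by
  have h := (mem_iff_graphMap ((F.isCompl_iff ht hτ).2 hD) v (graphMap Δ (Λ t) (Λ τ) v)).2 rfl
  obtain ⟨h1, h2⟩ := (F.mem_iff t ht _).1 h
  rw [map_add, LinearMap.add_apply, ← eq_neg_iff_add_eq_zero] at h1 h2
  rw [F.eq_of_mem hτ hD (graphMap Δ (Λ t) (Λ τ) v).2, h1, h2]
  congr 2 <;> ring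

theorem contDiffOn_pairDet :
    ContDiffOn ℝ ∞ (fun p : ℝ × ℝ => pairDet σ e₁ e₂ p.1 p.2) (I ×ˢ I) :=
  ((contDiffOn_pair F.smooth₁ F.smooth₁).mul (contDiffOn_pair F.smooth₂ F.smooth₂)).sub
    ((contDiffOn_pair F.smooth₁ F.smooth₂).mul (contDiffOn_pair F.smooth₂ F.smooth₁))

theorem contDiffAt_left {a : ℝ → W} (ha : ContDiffOn ℝ ∞ a I) {t : ℝ} (ht : t ∈ I) (w : W) :
    ContDiffAt ℝ ∞ (fun s => σ (a s) w) t :=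
  (contDiffOn_bilin σ ha contDiffOn_const).contDiffAt (F.isOpen.mem_nhds ht)

theorem contDiffAt_pairDet {t : ℝ} (ht : t ∈ I) (τ : ℝ) :
    ContDiffAt ℝ ∞ (fun s => pairDet σ e₁ e₂ s τ) t :=
  ((F.contDiffAt_left F.smooth₁ ht _).mul (F.contDiffAt_left F.smooth₂ ht _)).sub
    ((F.contDiffAt_left F.smooth₁ ht _).mul (F.contDiffAt_left F.smooth₂ ht _))

theorem hasDerivAt {a : ℝ → W} (ha : ContDiffOn ℝ ∞ a I) {t : ℝ} (ht : t ∈ I) :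
    HasDerivAt a (deriv a t) t :=
  ((ha.contDiffAt (F.isOpen.mem_nhds ht)).differentiableAt (by simp)).hasDerivAt

theorem eventually_pairDet_ne_zero {t τ : ℝ} (ht : t ∈ I) (hD : pairDet σ e₁ e₂ t τ ≠ 0) :
    ∀ᶠ s in 𝓝 t, s ∈ I ∧ pairDet σ e₁ e₂ s τ ≠ 0 :=
  (eventually_mem_set.2 (F.isOpen.mem_nhds ht)).and ((F.contDiffAt_pairDet ht τ).continuousAt.eventually_ne hD)

theorem differentiableAt_graphMap (Δ : Submodule ℝ W) {t τ : ℝ} (ht : t ∈ I) (hτ : τ ∈ I)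
    (hD : pairDet σ e₁ e₂ t τ ≠ 0) :
    DifferentiableAt ℝ (fun s => graphMap Δ (Λ s) (Λ τ)) t := by
  -- `T w` is the functional v ↦ σ(v, w) on Δ. With it the formula for the graph map becomes an
  -- identity between operators, with differentiable scalar coefficients.
  let T : W →ₗ[ℝ] (Δ →L[ℝ] ℝ) :=
    (LinearMap.toContinuousLinearMap : (Δ →ₗ[ℝ] ℝ) ≃ₗ[ℝ] (Δ →L[ℝ] ℝ)).toLinearMap ∘ₗ
      LinearMap.lcomp ℝ ℝ Δ.subtype ∘ₗ σ.flip
  have hT : ∀ {a : ℝ → W}, ContDiffOn ℝ ∞ a I → DifferentiableAt ℝ (fun s => T (a s)) t :=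
    fun {a} ha => by
      have h1 : DifferentiableAt ℝ (fun w : W => T w) (a t) :=
        (LinearMap.toContinuousLinearMap T).differentiableAt
      exact DifferentiableAt.comp (F := W) (G := Δ →L[ℝ] ℝ) t h1 (F.hasDerivAt ha ht).differentiableAt
  have hP : ∀ {a : ℝ → W}, ContDiffOn ℝ ∞ a I → ∀ w, DifferentiableAt ℝ (fun s => σ (a s) w) t :=
    fun ha w => (F.contDiffAt_left ha ht w).differentiableAt (by simp)
  have hDd : DifferentiableAt ℝ (fun s => (pairDet σ e₁ e₂ s τ)⁻¹) t :=
    ((F.contDiffAt_pairDet ht τ).differentiableAt (by simp)).inv hD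
  let n₁ : Λ τ := ⟨e₁ τ, F.mem₁ hτ⟩
  let n₂ : Λ τ := ⟨e₂ τ, F.mem₂ hτ⟩
  have hG : (fun s => graphMap Δ (Λ s) (Λ τ)) =ᶠ[𝓝 t] fun s =>
      (ContinuousLinearMap.toSpanSingleton ℝ n₁).comp ((pairDet σ e₁ e₂ s τ)⁻¹ •
        (σ (e₂ s) (e₂ τ) • T (e₁ s) - σ (e₁ s) (e₂ τ) • T (e₂ s))) +
      (ContinuousLinearMap.toSpanSingleton ℝ n₂).comp ((pairDet σ e₁ e₂ s τ)⁻¹ •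
        (σ (e₁ s) (e₁ τ) • T (e₂ s) - σ (e₂ s) (e₁ τ) • T (e₁ s))) := by
    filter_upwards [F.eventually_pairDet_ne_zero ht hD] with s hs
    ext v
    rw [F.graphMap_eq Δ hs.1 hτ hs.2]
    simp [T, n₁, n₂, div_eq_inv_mul, ContinuousLinearMap.toSpanSingleton_apply]
    module
  refine DifferentiableAt.congr_of_eventuallyEq ?_ hG
  have hS : ∀ {a b c : ℝ → ℝ} {p q : ℝ → Δ →L[ℝ] ℝ}, DifferentiableAt ℝ a t →
      DifferentiableAt ℝ b t → DifferentiableAt ℝ c t → DifferentiableAt ℝ p t →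
      DifferentiableAt ℝ q t → ∀ n : Λ τ, DifferentiableAt ℝ (fun s =>
        (ContinuousLinearMap.toSpanSingleton ℝ n).comp (a s • (b s • p s - c s • q s))) t := by
    intro a b c p q ha hb hc hp hq n
    exact DifferentiableAt.clm_comp (differentiableAt_const _)
      (@differentiableAt_smul_sub (Δ →L[ℝ] ℝ) _ _ a b c p q t ha hb hc hp hq)
  exact @differentiableAt_add (Δ →L[ℝ] Λ τ) _ _ _ _ t
    (hS hDd (hP F.smooth₂ _) (hP F.smooth₁ _) (hT F.smooth₁) (hT F.smooth₂) n₁)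
    (hS hDd (hP F.smooth₁ _) (hP F.smooth₂ _) (hT F.smooth₂) (hT F.smooth₁) n₂)

/-- The derivative of `⟨Δ, Λ s, Λ τ⟩` is determined by the derivative of the frame. -/
theorem deriv_graphMap_pair (Δ : Submodule ℝ W) {t τ : ℝ} (ht : t ∈ I) (hτ : τ ∈ I)
    (hD : pairDet σ e₁ e₂ t τ ≠ 0) {a : ℝ → W} (ha : ContDiffOn ℝ ∞ a I)
    (hmem : ∀ s ∈ I, ∀ x ∈ Λ s, σ x (a s) = 0) (v : Δ) :
    σ ((deriv (fun s => graphMap Δ (Λ s) (Λ τ)) t v : Λ τ) : W) (a t) =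
      -σ ((v : W) + (graphMap Δ (Λ t) (Λ τ) v : W)) (deriv a t) := by
  have h1 : HasDerivAt (fun s => graphMap Δ (Λ s) (Λ τ))
      (deriv (fun s => graphMap Δ (Λ s) (Λ τ)) t) t :=
    @DifferentiableAt.hasDerivAt ℝ _ (Δ →L[ℝ] Λ τ) _ _ _ t (F.differentiableAt_graphMap Δ ht hτ hD)
  have h2 : HasDerivAt (fun s => graphMap Δ (Λ s) (Λ τ) v)
      (deriv (fun s => graphMap Δ (Λ s) (Λ τ)) t v) t := by
    simpa using h1.clm_apply (hasDerivAt_const t v)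
  have h3 : HasDerivAt (fun s => (v : W) + (graphMap Δ (Λ s) (Λ τ) v : W))
      ((deriv (fun s => graphMap Δ (Λ s) (Λ τ)) t v : Λ τ) : W) t := by
    exact ((Λ τ).subtypeL.hasFDerivAt.comp_hasDerivAt t h2).const_add (v : W)
  have h4 := hasDerivAt_bilin σ h3 (F.hasDerivAt ha ht)
  -- The vector v + ⟨Δ, Λ s, Λ τ⟩v stays in Λ s, which `a s` annihilates; the claim is the
  -- derivative of this identity at t.
  have h5 : (fun s => σ ((v : W) + (graphMap Δ (Λ s) (Λ τ) v : W)) (a s)) =ᶠ[𝓝 t]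
      fun _ => 0 := by
    filter_upwards [F.eventually_pairDet_ne_zero ht hD] with s hs
    exact hmem s hs.1 _ ((mem_iff_graphMap ((F.isCompl_iff hs.1 hτ).2 hs.2) v _).2 rfl)
  have h6 := h4.unique ((hasDerivAt_const t (0 : ℝ)).congr_of_eventuallyEq h5)
  linarith

theorem pair_e₁ {t : ℝ} (ht : t ∈ I) {x : W} (hx : x ∈ Λ t) : σ x (e₁ t) = 0 :=
  ((F.mem_iff t ht x).1 hx).1

theorem pair_e₂ {t : ℝ} (ht : t ∈ I) {x : W} (hx : x ∈ Λ t) : σ x (e₂ t) = 0 :=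
  ((F.mem_iff t ht x).1 hx).2

/-- For Δ = Λ t the graph map vanishes at s = t, so the pairings of the derivative with the frame at
t are minus the pairings of v with e₁′ and e₂′. By hypothesis only the `f₂`-component of v is seen,
whence a rank-one operator with a fixed direction in Λ τ. -/
theorem deriv_graphMap_of_rank_one
    (h1 : ∀ t ∈ I, ∀ v ∈ Λ t, σ v (deriv e₁ t) = 0)
    (h2 : ∀ t ∈ I, ∀ v ∈ Λ t, σ v (deriv e₂ t) = -4 * σ (f₂ t) v)
    {t τ : ℝ} (ht : t ∈ I) (hτ : τ ∈ I) (hD : pairDet σ e₁ e₂ t τ ≠ 0) (v : Λ t) :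
    ((deriv (fun s => graphMap (Λ t) (Λ s) (Λ τ)) t v : Λ τ) : W) =
      (4 * σ (f₂ t) v) • ((σ (e₁ t) (e₂ τ) / pairDet σ e₁ e₂ t τ) • e₁ τ +
        (-σ (e₁ t) (e₁ τ) / pairDet σ e₁ e₂ t τ) • e₂ τ) := by
  have h3 := F.deriv_graphMap_pair (Λ t) ht hτ hD F.smooth₁ (fun s hs x hx => F.pair_e₁ hs hx) v
  have h4 := F.deriv_graphMap_pair (Λ t) ht hτ hD F.smooth₂ (fun s hs x hx => F.pair_e₂ hs hx) v
  rw [graphMap_self ((F.isCompl_iff ht hτ).2 hD) v, Submodule.coe_zero, add_zero] at h3 h4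
  rw [h1 t ht v v.2] at h3
  rw [h2 t ht v v.2] at h4
  rw [F.eq_of_mem hτ hD (deriv (fun s => graphMap (Λ t) (Λ s) (Λ τ)) t v).2, h3, h4, smul_add,
    smul_smul, smul_smul]
  congr 2 <;> ring

/-- The infinitesimal cross-ratio in terms of the pairings of the frame vectors. -/
theorem crossTrace_eq
    (h1 : ∀ t ∈ I, ∀ v ∈ Λ t, σ v (deriv e₁ t) = 0)
    (h2 : ∀ t ∈ I, ∀ v ∈ Λ t, σ v (deriv e₂ t) = -4 * σ (f₂ t) v)
    {t τ : ℝ} (ht : t ∈ I) (hτ : τ ∈ I) (hD : pairDet σ e₁ e₂ t τ ≠ 0) :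
    crossTrace Λ t τ = -16 * (σ (e₁ t) (e₁ τ) / pairDet σ e₁ e₂ t τ) ^ 2 := by
  have hD' : pairDet σ e₁ e₂ τ t ≠ 0 := by rwa [F.pairDet_comm]
  let ω' : Λ t := ⟨(σ (e₁ τ) (e₂ t) / pairDet σ e₁ e₂ τ t) • e₁ t +
        (-σ (e₁ τ) (e₁ t) / pairDet σ e₁ e₂ τ t) • e₂ t,
    add_mem (Submodule.smul_mem _ _ (F.mem₁ ht)) (Submodule.smul_mem _ _ (F.mem₂ ht))⟩
  let φ : Λ t →ₗ[ℝ] ℝ := (16 * (-σ (e₁ t) (e₁ τ) / pairDet σ e₁ e₂ t τ)) •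
    (σ (f₂ t) ∘ₗ (Λ t).subtype)
  -- The composition of two rank-one operators is φ ⊗ ω′, and its trace is φ(ω′).
  have h3 : (((deriv (fun s => graphMap (Λ τ) (Λ s) (Λ t)) τ).comp
      (deriv (fun s => graphMap (Λ t) (Λ s) (Λ τ)) t) : Λ t →L[ℝ] Λ t) :
        Λ t →ₗ[ℝ] Λ t) = φ.smulRight ω' := by
    refine LinearMap.ext fun v => Subtype.ext ?_
    simp only [ContinuousLinearMap.coe_coe, ContinuousLinearMap.comp_apply,
      LinearMap.smulRight_apply, Submodule.coe_smul]
    rw [F.deriv_graphMap_of_rank_one h1 h2 hτ ht hD',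
      F.deriv_graphMap_of_rank_one h1 h2 ht hτ hD]
    simp only [map_add, map_smul, F.f₂e₁ τ hτ, F.f₂e₂ τ hτ, φ, ω', LinearMap.smul_apply,
      LinearMap.comp_apply, Submodule.subtype_apply, smul_eq_mul]
    congr 1
    ring
  rw [crossTrace, h3, LinearMap.trace_smulRight]
  simp only [map_add, map_smul, F.f₂e₁ t ht, F.f₂e₂ t ht, φ, ω', LinearMap.smul_apply,
    LinearMap.comp_apply, Submodule.subtype_apply, smul_eq_mul]
  rw [F.pairDet_comm τ t, F.swap (e₁ τ) (e₁ t)]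
  ring

/-- Each of the two composed derivatives is taken at one endpoint only, so the chain rule
contributes one factor ψ′ from each. -/
theorem crossTrace_comp {ψ : ℝ → ℝ} {s₀ s₁ : ℝ} (h₀ : ψ s₀ ∈ I) (h₁ : ψ s₁ ∈ I)
    (hψ₀ : DifferentiableAt ℝ ψ s₀) (hψ₁ : DifferentiableAt ℝ ψ s₁)
    (hD : pairDet σ e₁ e₂ (ψ s₀) (ψ s₁) ≠ 0) :
    crossTrace (fun s => Λ (ψ s)) s₀ s₁ =
      deriv ψ s₀ * deriv ψ s₁ * crossTrace Λ (ψ s₀) (ψ s₁) := by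
  have hD' : pairDet σ e₁ e₂ (ψ s₁) (ψ s₀) ≠ 0 := by rwa [F.pairDet_comm]
  have h2 : deriv (fun s => graphMap (Λ (ψ s₀)) (Λ (ψ s)) (Λ (ψ s₁))) s₀ =
      deriv ψ s₀ • deriv (fun s => graphMap (Λ (ψ s₀)) (Λ s) (Λ (ψ s₁))) (ψ s₀) :=
    deriv.scomp (g₁ := fun s => graphMap (Λ (ψ s₀)) (Λ s) (Λ (ψ s₁))) s₀
      (F.differentiableAt_graphMap _ h₀ h₁ hD) hψ₀
  have h3 : deriv (fun s => graphMap (Λ (ψ s₁)) (Λ (ψ s)) (Λ (ψ s₀))) s₁ =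
      deriv ψ s₁ • deriv (fun s => graphMap (Λ (ψ s₁)) (Λ s) (Λ (ψ s₀))) (ψ s₁) :=
    deriv.scomp (g₁ := fun s => graphMap (Λ (ψ s₁)) (Λ s) (Λ (ψ s₀))) s₁
      (F.differentiableAt_graphMap _ h₁ h₀ hD') hψ₁
  unfold crossTrace
  rw [h2, h3]
  simp only [ContinuousLinearMap.comp_smul, ContinuousLinearMap.smul_comp]
  rw [smul_smul]
  simp

end IsLagrangianFrame

end Frames

/-! ### Low coefficients of products of power series. -/

section PowerSeriesCoefficients

open PowerSeries

variable (f g : PowerSeries ℝ)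

theorem coeff_zero_mul' : coeff 0 (f * g) = coeff 0 f * coeff 0 g := by
  simp [coeff_mul]

theorem coeff_one_mul' : coeff 1 (f * g) = coeff 0 f * coeff 1 g + coeff 1 f * coeff 0 g := by
  simp [coeff_mul, Finset.Nat.antidiagonal_succ]

theorem coeff_two_mul' : coeff 2 (f * g) =
    coeff 0 f * coeff 2 g + coeff 1 f * coeff 1 g + coeff 2 f * coeff 0 g := by
  simp [coeff_mul, Finset.Nat.antidiagonal_succ, add_assoc]

theorem coeff_three_mul' : coeff 3 (f * g) =
    coeff 0 f * coeff 3 g + coeff 1 f * coeff 2 g + coeff 2 f * coeff 1 g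
      + coeff 3 f * coeff 0 g := by
  simp [coeff_mul, Finset.Nat.antidiagonal_succ, add_assoc]

theorem coeff_four_mul' : coeff 4 (f * g) =
    coeff 0 f * coeff 4 g + coeff 1 f * coeff 3 g + coeff 2 f * coeff 2 g
      + coeff 3 f * coeff 1 g + coeff 4 f * coeff 0 g := by
  simp [coeff_mul, Finset.Nat.antidiagonal_succ, add_assoc]

variable {f}

theorem exists_eq_X_pow_mul {n : ℕ} (h : ∀ j < n, coeff j f = 0) :
    ∃ g : PowerSeries ℝ, f = X ^ n * g ∧ ∀ i, coeff i g = coeff (i + n) f := by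
  obtain ⟨g, rfl⟩ := X_pow_dvd_iff.2 h
  exact ⟨g, rfl, fun i => (coeff_X_pow_mul g n i).symm⟩

end PowerSeriesCoefficients

/-! ### What the polar part of w(t, τ) says about a frame. -/

section CanonicalFrames

set_option linter.unusedSectionVars false

variable {W : Type*} [NormedAddCommGroup W] [NormedSpace ℝ W] [FiniteDimensional ℝ W]
  {σ : LinearMap.BilinForm ℝ W} {Λ : ℝ → Submodule ℝ W} {I : Set ℝ} {e₁ e₂ f₁ f₂ : ℝ → W}

theorem isLagrangianFrame_of_isSymplecticFrame (hσ : σ.IsAlt) (hI : IsOpen I)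
    (hc : I.OrdConnected) (hLag : ∀ t ∈ I, IsLagrangian σ (Λ t))
    (he₁ : ContDiffOn ℝ ∞ e₁ I) (he₂ : ContDiffOn ℝ ∞ e₂ I)
    (hf₁ : ContDiffOn ℝ ∞ f₁ I) (hf₂ : ContDiffOn ℝ ∞ f₂ I)
    (hspan : ∀ t ∈ I, Submodule.span ℝ (Set.range ![e₁ t, e₂ t]) = Λ t)
    (hframe : ∀ t ∈ I, IsSymplecticFrame σ ![e₁ t, e₂ t] ![f₁ t, f₂ t]) :
    IsLagrangianFrame σ Λ I e₁ e₂ f₁ f₂ := by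
  have hpair : ∀ t ∈ I, ∀ x, x ∈ Λ t → ∃ a b : ℝ, x = a • e₁ t + b • e₂ t := by
    intro t ht x hx
    rw [← hspan t ht, Matrix.range_cons, Matrix.range_cons, Matrix.range_empty, Set.union_empty,
      Set.singleton_union, Submodule.mem_span_pair] at hx
    obtain ⟨a, b, h⟩ := hx
    exact ⟨a, b, h.symm⟩
  have hm₁ : ∀ t ∈ I, e₁ t ∈ Λ t := fun t ht => by
    rw [← hspan t ht]; exact Submodule.subset_span ⟨0, rfl⟩
  have hm₂ : ∀ t ∈ I, e₂ t ∈ Λ t := fun t ht => by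
    rw [← hspan t ht]; exact Submodule.subset_span ⟨1, rfl⟩
  have h11 : ∀ t ∈ I, σ (f₁ t) (e₁ t) = 1 := fun t ht => by simpa using (hframe t ht 0 0).2.2
  have h12 : ∀ t ∈ I, σ (f₁ t) (e₂ t) = 0 := fun t ht => by simpa using (hframe t ht 0 1).2.2
  have h21 : ∀ t ∈ I, σ (f₂ t) (e₁ t) = 0 := fun t ht => by simpa using (hframe t ht 1 0).2.2
  have h22 : ∀ t ∈ I, σ (f₂ t) (e₂ t) = 1 := fun t ht => by simpa using (hframe t ht 1 1).2.2
  refine ⟨hσ, hI, hc, he₁, he₂, hf₁, hf₂, ?_, ?_, ?_, ?_, h11, h12, h21, h22⟩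
  · intro t ht x
    have hL : (Λ t).orthogonalBilin σ = Λ t := hLag t ht
    rw [← hL, Submodule.mem_orthogonalBilin_iff]
    constructor
    · intro h
      rw [← hσ.neg_eq, ← hσ.neg_eq (e₂ t), h _ (hm₁ t ht), h _ (hm₂ t ht)]
      simp
    · rintro ⟨h1, h2⟩ n hn
      obtain ⟨a, b, rfl⟩ := hpair t ht n hn
      rw [← hσ.neg_eq, map_add, map_smul, map_smul, h1, h2]
      simp
  · intro t ht x hx
    obtain ⟨a, b, rfl⟩ := hpair t ht x hx
    simp [h11 t ht, h12 t ht, h21 t ht, h22 t ht]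
  · intro t ht
    simpa using (hframe t ht 0 1).1
  · intro t ht
    simpa using (hframe t ht 0 1).2.1

namespace IsLagrangianFrame

variable (F : IsLagrangianFrame σ Λ I e₁ e₂ f₁ f₂)
include F

/-- The identity defining w is tested on Δ = Λ t and v = a t, where the graph map itself vanishes:
the velocity form at t is the square of the pairing with w(t, τ). -/
theorem pair_sq_of_isVelocityVector {t τ : ℝ} (ht : t ∈ I) (hτ : τ ∈ I)
    {w : W} (hw : IsVelocityVector σ Λ t τ w) {a : ℝ → W} (ha : ContDiffOn ℝ ∞ a I)
    (hmem : ∀ s ∈ I, ∀ x ∈ Λ s, σ x (a s) = 0) (hat : a t ∈ Λ t) :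
    σ (deriv a t) (a t) = σ (a t) w ^ 2 := by
  obtain ⟨-, hc, h⟩ := hw
  have hD := (F.isCompl_iff ht hτ).1 hc
  have h1 := h (Λ t) hc ⟨a t, hat⟩
  have h2 := F.deriv_graphMap_pair (Λ t) ht hτ hD ha hmem ⟨a t, hat⟩
  rw [graphMap_self hc, Submodule.coe_zero, add_zero] at h2
  rw [F.swap] at h1
  simp only at h1 h2
  rw [F.swap (deriv a t)]
  linarith

/-- The expansion of the vectors `w(t, τ)` of a canonical frame in terms of the frame. -/
theorem exists_expansion_of_isCanonicalBasis {τ : ℝ} (hτ : τ ∈ I)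
    (hcan : IsCanonicalBasis σ Λ τ ![e₁ τ, e₂ τ]) :
    ∃ r₁ r₂ : ℝ → ℝ, (r₁ =O[𝓝[≠] τ] fun _ => (1 : ℝ)) ∧ (r₂ =O[𝓝[≠] τ] fun _ => (1 : ℝ)) ∧
      ∀ᶠ t in 𝓝[≠] τ, t ∈ I ∧ t ≠ τ ∧ pairDet σ e₁ e₂ t τ ≠ 0 ∧
        (t - τ) ^ 4 * σ (deriv e₁ t) (e₁ t) =
          (σ (e₁ t) (e₁ τ) * (1 + (t - τ) ^ 2 * r₁ t) +
            σ (e₁ t) (e₂ τ) * ((t - τ) + (t - τ) ^ 2 * r₂ t)) ^ 2 ∧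
        (t - τ) ^ 4 * σ (deriv e₂ t) (e₂ t) =
          (σ (e₂ t) (e₁ τ) * (1 + (t - τ) ^ 2 * r₁ t) +
            σ (e₂ t) (e₂ τ) * ((t - τ) + (t - τ) ^ 2 * r₂ t)) ^ 2 := by
  obtain ⟨-, -, w, hw, hO⟩ := hcan
  -- The bounded remainder of w. It lies in Λ τ, and r₁, r₂ are its coordinates there.
  set R : ℝ → W := fun t => w t - ∑ i : Fin 2, (t - τ) ^ ((i : ℤ) - ((2 : ℕ) : ℤ)) •
    (![e₁ τ, e₂ τ] : Fin 2 → W) i with hR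
  have hlin : ∀ f : W, (fun t => σ f (R t)) =O[𝓝[≠] τ] fun _ => (1 : ℝ) := fun f =>
    ((LinearMap.toContinuousLinearMap (σ f)).isBigO_comp R _).trans hO
  refine ⟨fun t => σ (f₁ τ) (R t), fun t => σ (f₂ τ) (R t), hlin _, hlin _, ?_⟩
  filter_upwards [hw, self_mem_nhdsWithin, nhdsWithin_le_nhds (F.isOpen.mem_nhds hτ)]
    with t hwt hne ht
  have hs : t - τ ≠ 0 := sub_ne_zero.2 hne
  have hD := (F.isCompl_iff ht hτ).1 hwt.2.1
  have hRt : R t = w t - ((t - τ) ^ (-2 : ℤ) • e₁ τ + (t - τ) ^ (-1 : ℤ) • e₂ τ) := by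
    simp [hR, Fin.sum_univ_two]
  have hRm : R t ∈ Λ τ := by
    rw [hRt]
    exact sub_mem hwt.1 (add_mem (Submodule.smul_mem _ _ (F.mem₁ hτ))
      (Submodule.smul_mem _ _ (F.mem₂ hτ)))
  have hexp : w t = ((t - τ) ^ (-2 : ℤ) + σ (f₁ τ) (R t)) • e₁ τ +
      ((t - τ) ^ (-1 : ℤ) + σ (f₂ τ) (R t)) • e₂ τ := by
    have h1 : w t = R t + ((t - τ) ^ (-2 : ℤ) • e₁ τ + (t - τ) ^ (-1 : ℤ) • e₂ τ) := by
      rw [hRt]; abel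
    rw [h1]
    nth_rw 1 [F.eq_comb τ hτ _ hRm]
    module
  have hz2 : (t - τ) ^ (-2 : ℤ) = ((t - τ) ^ 2)⁻¹ := by
    rw [zpow_neg]; norm_cast
  have hz1 : (t - τ) ^ (-1 : ℤ) = (t - τ)⁻¹ := zpow_neg_one _
  have key : ∀ v : W, (t - τ) ^ 2 * σ v (w t) =
      σ v (e₁ τ) * (1 + (t - τ) ^ 2 * σ (f₁ τ) (R t)) +
      σ v (e₂ τ) * ((t - τ) + (t - τ) ^ 2 * σ (f₂ τ) (R t)) := by
    intro v
    rw [hexp, hz2, hz1, map_add, map_smul, map_smul, smul_eq_mul, smul_eq_mul]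
    field_simp
  refine ⟨ht, hne, hD, ?_, ?_⟩
  · rw [F.pair_sq_of_isVelocityVector ht hτ hwt F.smooth₁ (fun s hs x hx => F.pair_e₁ hs hx)
      (F.mem₁ ht), ← key]
    ring
  · rw [F.pair_sq_of_isVelocityVector ht hτ hwt F.smooth₂ (fun s hs x hx => F.pair_e₂ hs hx)
      (F.mem₂ ht), ← key]
    ring

/-- Iterated along the structural equation, this reduces every Taylor coefficient of a pairing to a
coordinate, at τ, of a higher derivative of the frame. -/
theorem coeff_succ_pair {a a' : ℝ → W} (h : ∀ t ∈ I, HasDerivAt a (a' t) t) {τ : ℝ} (hτ : τ ∈ I)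
    (w : W) (n : ℕ) :
    PowerSeries.coeff (n + 1) (taylorSeries (fun t => σ (a t) w) τ) =
      PowerSeries.coeff n (taylorSeries (fun t => σ (a' t) w) τ) / (n + 1) := by
  rw [coeff_succ_taylorSeries]
  congr 2
  refine taylorSeries_congr ?_
  filter_upwards [F.isOpen.mem_nhds hτ] with t ht
  have := hasDerivAt_bilin σ (h t ht) (hasDerivAt_const t w)
  simpa using this.deriv

theorem pair_isBigO {a : ℝ → W} (ha : ContDiffOn ℝ ∞ a I) {τ : ℝ} (hτ : τ ∈ I) {w : W} (n : ℕ)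
    (h : ∀ j < n, PowerSeries.coeff j (taylorSeries (fun t => σ (a t) w) τ) = 0) :
    (fun t => σ (a t) w) =O[𝓝[≠] τ] fun t => (t - τ) ^ n :=
  (isBigO_of_coeff_taylorSeries (F.contDiffAt_left ha hτ w) h).mono nhdsWithin_le_nhds

theorem coeff_one_pair {a : ℝ → W} (ha : ContDiffOn ℝ ∞ a I) {τ : ℝ} (hτ : τ ∈ I) (w : W) :
    PowerSeries.coeff 1 (taylorSeries (fun t => σ (a t) w) τ) = σ (deriv a τ) w := by
  have h := F.coeff_succ_pair (fun t ht => F.hasDerivAt ha ht) hτ w 0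
  rw [coeff_zero_taylorSeries] at h
  simpa using h

omit F in
theorem isBigO_sq_mul_bounded {r p : ℝ → ℝ} {τ : ℝ} {n : ℕ}
    (hr : r =O[𝓝[≠] τ] fun _ => (1 : ℝ)) (hp : p =O[𝓝[≠] τ] fun t => (t - τ) ^ n) :
    (fun t => (t - τ) ^ 2 * (r t * p t)) =O[𝓝[≠] τ] fun t => (t - τ) ^ (n + 2) := by
  refine ((isBigO_refl (fun t => (t - τ) ^ 2) _).mul (hr.mul hp)).congr_right fun t => ?_
  ring

/-- If `b` is square root up to a bounded perturbation, then the leading coefficients match. -/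
theorem sq_expansion {a : ℝ → W} {b : ℝ → ℝ} (ha : ContDiffOn ℝ ∞ a I) {τ : ℝ} (hτ : τ ∈ I)
    {r₁ r₂ : ℝ → ℝ}
    (hr₁ : r₁ =O[𝓝[≠] τ] fun _ => (1 : ℝ)) (hr₂ : r₂ =O[𝓝[≠] τ] fun _ => (1 : ℝ)) (n : ℕ)
    (h₁ : ∀ j < n + 1, PowerSeries.coeff j (taylorSeries (fun t => σ (a t) (e₁ τ)) τ) = 0)
    (h₂ : ∀ j < n, PowerSeries.coeff j (taylorSeries (fun t => σ (a t) (e₂ τ)) τ) = 0)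
    (h : ∀ᶠ t in 𝓝[≠] τ, (t - τ) ^ 4 * b t =
          (σ (a t) (e₁ τ) * (1 + (t - τ) ^ 2 * r₁ t) +
            σ (a t) (e₂ τ) * ((t - τ) + (t - τ) ^ 2 * r₂ t)) ^ 2) :
    (fun t => (t - τ) ^ 4 * b t - (σ (a t) (e₁ τ) + (t - τ) * σ (a t) (e₂ τ)) ^ 2)
      =O[𝓝[≠] τ] fun t => (t - τ) ^ (2 * n + 3) := by
  have hp₁ := F.pair_isBigO ha hτ (n + 1) h₁
  have hp₂ := F.pair_isBigO ha hτ n h₂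
  have hp₁' := hp₁.trans (pow_isBigO_pow_of_le τ n.le_succ)
  -- The main part A is of order n + 1 and the part E coming from r₁, r₂ is of order n + 2, so (A +
  -- E)² − A² = E(E + 2A) is of order 2n + 3.
  have hA : (fun t => σ (a t) (e₁ τ) + (t - τ) * σ (a t) (e₂ τ)) =O[𝓝[≠] τ]
      fun t => (t - τ) ^ (n + 1) :=
    hp₁.add (((isBigO_refl (fun t => t - τ) _).mul hp₂).congr_right fun t => by ring)
  have hE := (isBigO_sq_mul_bounded hr₁ hp₁').add (isBigO_sq_mul_bounded hr₂ hp₂)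
  have hE' := hE.trans (pow_isBigO_pow_of_le τ (Nat.le_succ (n + 1)))
  refine ((hE.mul (hE'.add (hA.add hA))).congr' ?_ ?_)
  · filter_upwards [h] with t ht
    rw [ht]
    ring
  · exact Eventually.of_forall fun t => by ring

/-- The velocity of a curve with a canonical frame is degenerate on `e₁`. -/
theorem deriv_pair_eq_zero {τ : ℝ} (hτ : τ ∈ I)
    (hcan : IsCanonicalBasis σ Λ τ ![e₁ τ, e₂ τ]) :
    σ (deriv e₁ τ) (e₁ τ) = 0 ∧ σ (deriv e₂ τ) (e₁ τ) = 0 := by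
  obtain ⟨r₁, r₂, hr₁, hr₂, h⟩ := F.exists_expansion_of_isCanonicalBasis hτ hcan
  have main : ∀ a : ℝ → W, ContDiffOn ℝ ∞ a I → σ (a τ) (e₁ τ) = 0 → σ (a τ) (e₂ τ) = 0 →
      (∀ᶠ t in 𝓝[≠] τ, (t - τ) ^ 4 * σ (deriv a t) (a t) =
          (σ (a t) (e₁ τ) * (1 + (t - τ) ^ 2 * r₁ t) +
            σ (a t) (e₂ τ) * ((t - τ) + (t - τ) ^ 2 * r₂ t)) ^ 2) →
      σ (deriv a τ) (e₁ τ) = 0 := by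
    intro a ha h1 h2 h3
    have hO : (fun t => (t - τ) ^ 4 * σ (deriv a t) (a t) -
        (σ (a t) (e₁ τ) + (t - τ) * σ (a t) (e₂ τ)) ^ 2) =O[𝓝[≠] τ] fun t => (t - τ) ^ 3 :=
      F.sq_expansion ha hτ hr₁ hr₂ 0 (fun j hj => by
        obtain rfl : j = 0 := by omega
        rw [coeff_zero_taylorSeries, h1]) (by simp) h3
    have hs₁ := F.contDiffAt_left ha hτ (e₁ τ)
    have hs₂ := F.contDiffAt_left ha hτ (e₂ τ)
    have hX : ContDiffAt ℝ ∞ (fun t : ℝ => t - τ) τ := by fun_prop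
    have hda : ContDiffOn ℝ ∞ (deriv a) I := ha.deriv_of_isOpen F.isOpen (by simp)
    have hs₃ : ContDiffAt ℝ ∞ (fun t => σ (deriv a t) (a t)) τ :=
      (contDiffOn_bilin σ hda ha).contDiffAt (F.isOpen.mem_nhds hτ)
    -- In degree 2 the factor (t − τ)⁴ removes the velocity, and the square contributes the square
    -- of σ(a′(τ), e₁(τ)), because `a τ` pairs to zero with the frame at τ.
    have hc := coeff_taylorSeries_of_isBigO
      (((hX.pow 4).mul hs₃).sub ((hs₁.add (hX.mul hs₂)).pow 2)) hO 2 (by norm_num)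
    rw [taylorSeries_sub ((hX.pow 4).mul hs₃) ((hs₁.add (hX.mul hs₂)).pow 2),
      taylorSeries_pow (hs₁.add (hX.mul hs₂)), taylorSeries_add hs₁ (hX.mul hs₂),
      taylorSeries_mul hX hs₂, taylorSeries_mul (hX.pow 4) hs₃, taylorSeries_pow hX,
      taylorSeries_sub_self, map_sub, PowerSeries.coeff_X_pow_mul', pow_two, coeff_two_mul'] at hc
    have h4 := F.coeff_one_pair ha hτ (e₁ τ)
    have h5 : PowerSeries.coeff 1 (PowerSeries.X * taylorSeries (fun t => σ (a t) (e₂ τ)) τ) = 0 := by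
      rw [coeff_one_mul', coeff_zero_taylorSeries, h2]; simp
    simp only [map_add, h4, h5, coeff_zero_taylorSeries, h1] at hc
    simpa using hc
  refine ⟨main e₁ F.smooth₁ (F.alt _) (F.e₁e₂ τ hτ) (h.mono fun t ht => ht.2.2.2.1),
    main e₂ F.smooth₂ (F.e₂e₁ hτ) (F.alt _) (h.mono fun t ht => ht.2.2.2.2)⟩

end IsLagrangianFrame

end CanonicalFrames

/-! ### Structural equations with unknown α, m, b, and leading Taylor coefficients. -/

section StructureEquations

set_option linter.unusedSectionVars false

variable {W : Type*} [NormedAddCommGroup W] [NormedSpace ℝ W] [FiniteDimensional ℝ W]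
  {σ : LinearMap.BilinForm ℝ W} {Λ : ℝ → Submodule ℝ W} {I : Set ℝ} {e₁ e₂ f₁ f₂ : ℝ → W}
  {α m b a₂₁ a₂₂ a₃₁ a₄₁ a₄₂ : ℝ → ℝ}

/-- The structural equations of a frame along a curve of rank one for which `e₁ t` spans the kernel
of the velocity. -/
structure HasStructureEquations (I : Set ℝ) (e₁ e₂ f₁ f₂ : ℝ → W)
    (α m b a₂₁ a₂₂ a₃₁ a₄₁ a₄₂ : ℝ → ℝ) : Prop where
  smooth_α : ContDiffOn ℝ ∞ α I
  smooth_m : ContDiffOn ℝ ∞ m I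
  smooth_b : ContDiffOn ℝ ∞ b I
  smooth_a₂₁ : ContDiffOn ℝ ∞ a₂₁ I
  smooth_a₂₂ : ContDiffOn ℝ ∞ a₂₂ I
  smooth_a₃₁ : ContDiffOn ℝ ∞ a₃₁ I
  smooth_a₄₁ : ContDiffOn ℝ ∞ a₄₁ I
  smooth_a₄₂ : ContDiffOn ℝ ∞ a₄₂ I
  deriv_e₁ : ∀ t ∈ I, HasDerivAt e₁ (α t • e₁ t + m t • e₂ t) t
  deriv_e₂ : ∀ t ∈ I, HasDerivAt e₂ (a₂₁ t • e₁ t + a₂₂ t • e₂ t + b t • f₂ t) t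
  deriv_f₁ : ∀ t ∈ I, HasDerivAt f₁
    (a₃₁ t • e₁ t + a₄₁ t • e₂ t - α t • f₁ t - a₂₁ t • f₂ t) t
  deriv_f₂ : ∀ t ∈ I, HasDerivAt f₂
    (a₄₁ t • e₁ t + a₄₂ t • e₂ t - m t • f₁ t - a₂₂ t • f₂ t) t

/-- The curve of vectors with given coordinates in a moving frame. -/
def comb (e₁ e₂ f₁ f₂ : ℝ → W) (x y u v : ℝ → ℝ) (t : ℝ) : W :=
  x t • e₁ t + y t • e₂ t + u t • f₁ t + v t • f₂ t

omit [FiniteDimensional ℝ W] in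
-- Differentiation in the moving frame is a first-order operator on coordinates. The new coordinates
-- are free arguments tied down by equations, so that a simplified form can be supplied at each
-- differentiation.
theorem HasStructureEquations.hasDerivAt_comb
    (S : HasStructureEquations I e₁ e₂ f₁ f₂ α m b a₂₁ a₂₂ a₃₁ a₄₁ a₄₂)
    {x y u v x' y' u' v' X Y U V : ℝ → ℝ}
    (hx : ∀ t ∈ I, HasDerivAt x (x' t) t) (hy : ∀ t ∈ I, HasDerivAt y (y' t) t)
    (hu : ∀ t ∈ I, HasDerivAt u (u' t) t) (hv : ∀ t ∈ I, HasDerivAt v (v' t) t)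
    (hX : ∀ t ∈ I, X t = x' t + α t * x t + a₂₁ t * y t + a₃₁ t * u t + a₄₁ t * v t)
    (hY : ∀ t ∈ I, Y t = y' t + m t * x t + a₂₂ t * y t + a₄₁ t * u t + a₄₂ t * v t)
    (hU : ∀ t ∈ I, U t = u' t - α t * u t - m t * v t)
    (hV : ∀ t ∈ I, V t = v' t + b t * y t - a₂₁ t * u t - a₂₂ t * v t) :
    ∀ t ∈ I, HasDerivAt (comb e₁ e₂ f₁ f₂ x y u v) (comb e₁ e₂ f₁ f₂ X Y U V t) t := by
  intro t ht
  have h := ((((hx t ht).smul (S.deriv_e₁ t ht)).add ((hy t ht).smul (S.deriv_e₂ t ht))).add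
    ((hu t ht).smul (S.deriv_f₁ t ht))).add ((hv t ht).smul (S.deriv_f₂ t ht))
  refine (h.congr_deriv ?_)
  simp only [comb, hX t ht, hY t ht, hU t ht, hV t ht]
  module

theorem hasDerivAt_deriv_of_contDiffOn (hI : IsOpen I) {x : ℝ → ℝ} (hx : ContDiffOn ℝ ∞ x I) :
    ∀ t ∈ I, HasDerivAt x (deriv x t) t := fun _ ht =>
  ((hx.contDiffAt (hI.mem_nhds ht)).differentiableAt (by simp)).hasDerivAt

namespace IsLagrangianFrame

variable (F : IsLagrangianFrame σ Λ I e₁ e₂ f₁ f₂)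
include F

/-- As Λ τ is isotropic, the e-coordinates drop out on the diagonal; in the derivatives below they
matter only through their effect on later f-coordinates. -/
theorem comb_pair_e₁ {τ : ℝ} (hτ : τ ∈ I) (x y u v : ℝ → ℝ) :
    PowerSeries.coeff 0 (taylorSeries (fun t => σ (comb e₁ e₂ f₁ f₂ x y u v t) (e₁ τ)) τ) =
      u τ := by
  rw [coeff_zero_taylorSeries]
  simp [comb, F.f₁e₁ τ hτ, F.f₂e₁ τ hτ, F.e₂e₁ hτ, F.alt.self_eq_zero]

theorem comb_pair_e₂ {τ : ℝ} (hτ : τ ∈ I) (x y u v : ℝ → ℝ) :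
    PowerSeries.coeff 0 (taylorSeries (fun t => σ (comb e₁ e₂ f₁ f₂ x y u v t) (e₂ τ)) τ) =
      v τ := by
  rw [coeff_zero_taylorSeries]
  simp [comb, F.f₁e₂ τ hτ, F.f₂e₂ τ hτ, F.e₁e₂ τ hτ, F.alt.self_eq_zero]

omit F in
theorem comb_e₁ : comb e₁ e₂ f₁ f₂ (fun _ => 1) (fun _ => 0) (fun _ => 0) (fun _ => 0) = e₁ := by
  funext t; simp [comb]

omit F in
theorem comb_e₂ : comb e₁ e₂ f₁ f₂ (fun _ => 0) (fun _ => 1) (fun _ => 0) (fun _ => 0) = e₂ := by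
  funext t; simp [comb]

variable (S : HasStructureEquations I e₁ e₂ f₁ f₂ α m b a₂₁ a₂₂ a₃₁ a₄₁ a₄₂)
include S

/-- The leading Taylor coefficients of the pairings with `e₁ t`. -/
theorem coeff_pair_first {τ : ℝ} (hτ : τ ∈ I) :
    (∀ j < 3, PowerSeries.coeff j (taylorSeries (fun t => σ (e₁ t) (e₁ τ)) τ) = 0) ∧
    (∀ j < 2, PowerSeries.coeff j (taylorSeries (fun t => σ (e₁ t) (e₂ τ)) τ) = 0) ∧
    PowerSeries.coeff 3 (taylorSeries (fun t => σ (e₁ t) (e₁ τ)) τ) = -(m τ ^ 2 * b τ) / 6 ∧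
    PowerSeries.coeff 2 (taylorSeries (fun t => σ (e₁ t) (e₂ τ)) τ) = m τ * b τ / 2 ∧
    PowerSeries.coeff 4 (taylorSeries (fun t => σ (e₁ t) (e₁ τ)) τ) =
      -(4 * m τ * deriv m τ * b τ + 2 * m τ ^ 2 * deriv b τ) / 24 ∧
    PowerSeries.coeff 3 (taylorSeries (fun t => σ (e₁ t) (e₂ τ)) τ) =
      (2 * deriv m τ * b τ + m τ * deriv b τ + α τ * m τ * b τ) / 6 := by
  have hd := fun {x : ℝ → ℝ} (hx : ContDiffOn ℝ ∞ x I) =>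
    hasDerivAt_deriv_of_contDiffOn F.isOpen hx
  have hds : ∀ {x : ℝ → ℝ}, ContDiffOn ℝ ∞ x I → ContDiffOn ℝ ∞ (deriv x) I := fun hx =>
    hx.deriv_of_isOpen F.isOpen (by simp)
  have hc : ∀ c : ℝ, ∀ t ∈ I, HasDerivAt (fun _ => c) ((fun _ : ℝ => (0 : ℝ)) t) t :=
    fun c t _ => hasDerivAt_const t c
  have hα := S.smooth_α
  have hm := S.smooth_m
  have hb := S.smooth_b
  have ha₂₁ := S.smooth_a₂₁
  have ha₂₂ := S.smooth_a₂₂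
  have ha₃₁ := S.smooth_a₃₁
  have ha₄₁ := S.smooth_a₄₁
  have ha₄₂ := S.smooth_a₄₂
  -- The equations h1 to h4 give the first four derivatives of e₁ in the frame; in the last one only
  -- the f₁-coordinate is needed explicitly.
  have h1 := S.hasDerivAt_comb (hc 1) (hc 0) (hc 0) (hc 0) (X := α) (Y := m) (U := fun _ => 0)
    (V := fun _ => 0) (by intros; ring) (by intros; ring) (by intros; ring) (by intros; ring)
  set x₂ : ℝ → ℝ := fun t => deriv α t + α t * α t + a₂₁ t * m t with hx₂
  set y₂ : ℝ → ℝ := fun t => deriv m t + m t * α t + a₂₂ t * m t with hy₂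
  have hx₂s : ContDiffOn ℝ ∞ x₂ I := ((hds hα).add (hα.mul hα)).add (ha₂₁.mul hm)
  have hy₂s : ContDiffOn ℝ ∞ y₂ I := ((hds hm).add (hm.mul hα)).add (ha₂₂.mul hm)
  have h2 := S.hasDerivAt_comb (hd hα) (hd hm) (hc 0) (hc 0) (X := x₂) (Y := y₂)
    (U := fun _ => 0) (V := fun t => m t * b t)
    (by intros; simp only [hx₂]; ring) (by intros; simp only [hy₂]; ring) (by intros; ring)
    (by intros; ring)
  have h3 := S.hasDerivAt_comb (hd hx₂s) (hd hy₂s) (hc 0)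
    (fun t ht => (hd hm t ht).fun_mul (hd hb t ht))
    (X := fun t => deriv x₂ t + α t * x₂ t + a₂₁ t * y₂ t + a₄₁ t * (m t * b t))
    (Y := fun t => deriv y₂ t + m t * x₂ t + a₂₂ t * y₂ t + a₄₂ t * (m t * b t))
    (U := fun t => -(m t ^ 2 * b t))
    (V := fun t => 2 * deriv m t * b t + m t * deriv b t + α t * m t * b t)
    (by intros; ring) (by intros; ring) (by intros; ring)
    (by intros; simp only [hy₂]; ring)
  have hx₃s : ContDiffOn ℝ ∞
      (fun t => deriv x₂ t + α t * x₂ t + a₂₁ t * y₂ t + a₄₁ t * (m t * b t)) I :=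
    (((hds hx₂s).add (hα.mul hx₂s)).add (ha₂₁.mul hy₂s)).add (ha₄₁.mul (hm.mul hb))
  have hy₃s : ContDiffOn ℝ ∞
      (fun t => deriv y₂ t + m t * x₂ t + a₂₂ t * y₂ t + a₄₂ t * (m t * b t)) I :=
    (((hds hy₂s).add (hm.mul hx₂s)).add (ha₂₂.mul hy₂s)).add (ha₄₂.mul (hm.mul hb))
  have hv₃s : ContDiffOn ℝ ∞
      (fun t => 2 * deriv m t * b t + m t * deriv b t + α t * m t * b t) I :=
    (((contDiffOn_const.mul (hds hm)).mul hb).add (hm.mul (hds hb))).add ((hα.mul hm).mul hb)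
  have h4 := S.hasDerivAt_comb (hd hx₃s) (hd hy₃s)
    (fun t ht => (((hd hm t ht).fun_pow 2).fun_mul (hd hb t ht)).fun_neg) (hd hv₃s)
    (U := fun t => -(4 * m t * deriv m t * b t + 2 * m t ^ 2 * deriv b t))
    (fun t _ => rfl) (fun t _ => rfl) (by intros; simp; ring) (fun t _ => rfl)
  have e4 := F.coeff_succ_pair h1 hτ
  have e3 := F.coeff_succ_pair h2 hτ
  have e2 := F.coeff_succ_pair h3 hτ
  have e1 := F.coeff_succ_pair h4 hτ
  rw [comb_e₁] at e4
  refine ⟨?_, ?_, ?_, ?_, ?_, ?_⟩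
  · intro j hj
    interval_cases j
    · rw [coeff_zero_taylorSeries, F.alt.self_eq_zero]
    · rw [e4, F.comb_pair_e₁ hτ]; simp
    · rw [e4, e3, F.comb_pair_e₁ hτ]; simp
  · intro j hj
    interval_cases j
    · rw [coeff_zero_taylorSeries, F.e₁e₂ τ hτ]
    · rw [e4, F.comb_pair_e₂ hτ]; simp
  · rw [e4, e3, e2, F.comb_pair_e₁ hτ]; norm_num; ring
  · rw [e4, e3, F.comb_pair_e₂ hτ]; norm_num
  · rw [e4, e3, e2, e1, F.comb_pair_e₁ hτ]; norm_num; ring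
  · rw [e4, e3, e2, F.comb_pair_e₂ hτ]; norm_num; ring

/-- The leading Taylor coefficients of the pairings with `e₂ t`. -/
theorem coeff_pair_second {τ : ℝ} (hτ : τ ∈ I) :
    (∀ j < 2, PowerSeries.coeff j (taylorSeries (fun t => σ (e₂ t) (e₁ τ)) τ) = 0) ∧
    (∀ j < 1, PowerSeries.coeff j (taylorSeries (fun t => σ (e₂ t) (e₂ τ)) τ) = 0) ∧
    PowerSeries.coeff 2 (taylorSeries (fun t => σ (e₂ t) (e₁ τ)) τ) = -(m τ * b τ) / 2 ∧
    PowerSeries.coeff 1 (taylorSeries (fun t => σ (e₂ t) (e₂ τ)) τ) = b τ ∧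
    PowerSeries.coeff 3 (taylorSeries (fun t => σ (e₂ t) (e₁ τ)) τ) =
      (α τ * m τ * b τ - deriv m τ * b τ - 2 * m τ * deriv b τ) / 6 ∧
    PowerSeries.coeff 2 (taylorSeries (fun t => σ (e₂ t) (e₂ τ)) τ) = deriv b τ / 2 := by
  have hd := fun {x : ℝ → ℝ} (hx : ContDiffOn ℝ ∞ x I) =>
    hasDerivAt_deriv_of_contDiffOn F.isOpen hx
  have hds : ∀ {x : ℝ → ℝ}, ContDiffOn ℝ ∞ x I → ContDiffOn ℝ ∞ (deriv x) I := fun hx =>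
    hx.deriv_of_isOpen F.isOpen (by simp)
  have hc : ∀ c : ℝ, ∀ t ∈ I, HasDerivAt (fun _ => c) ((fun _ : ℝ => (0 : ℝ)) t) t :=
    fun c t _ => hasDerivAt_const t c
  have hα := S.smooth_α
  have hm := S.smooth_m
  have hb := S.smooth_b
  have ha₂₁ := S.smooth_a₂₁
  have ha₂₂ := S.smooth_a₂₂
  have ha₃₁ := S.smooth_a₃₁
  have ha₄₁ := S.smooth_a₄₁
  have ha₄₂ := S.smooth_a₄₂
  have h1 := S.hasDerivAt_comb (hc 0) (hc 1) (hc 0) (hc 0) (X := a₂₁) (Y := a₂₂)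
    (U := fun _ => 0) (V := b)
    (by intros; ring) (by intros; ring) (by intros; ring) (by intros; ring)
  have h2 := S.hasDerivAt_comb (hd ha₂₁) (hd ha₂₂) (hc 0) (hd hb)
    (X := fun t => deriv a₂₁ t + α t * a₂₁ t + a₂₁ t * a₂₂ t + a₄₁ t * b t)
    (Y := fun t => deriv a₂₂ t + m t * a₂₁ t + a₂₂ t * a₂₂ t + a₄₂ t * b t)
    (U := fun t => -(m t * b t)) (V := deriv b)
    (by intros; ring) (by intros; ring) (by intros; ring) (by intros; ring)
  have hx₂s : ContDiffOn ℝ ∞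
      (fun t => deriv a₂₁ t + α t * a₂₁ t + a₂₁ t * a₂₂ t + a₄₁ t * b t) I :=
    (((hds ha₂₁).add (hα.mul ha₂₁)).add (ha₂₁.mul ha₂₂)).add (ha₄₁.mul hb)
  have hy₂s : ContDiffOn ℝ ∞
      (fun t => deriv a₂₂ t + m t * a₂₁ t + a₂₂ t * a₂₂ t + a₄₂ t * b t) I :=
    (((hds ha₂₂).add (hm.mul ha₂₁)).add (ha₂₂.mul ha₂₂)).add (ha₄₂.mul hb)
  have h3 := S.hasDerivAt_comb (hd hx₂s) (hd hy₂s)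
    (fun t ht => ((hd hm t ht).fun_mul (hd hb t ht)).fun_neg) (hd (hds hb))
    (U := fun t => α t * m t * b t - deriv m t * b t - 2 * m t * deriv b t)
    (fun t _ => rfl) (fun t _ => rfl) (by intros; simp; ring) (fun t _ => rfl)
  have e4 := F.coeff_succ_pair h1 hτ
  have e3 := F.coeff_succ_pair h2 hτ
  have e2 := F.coeff_succ_pair h3 hτ
  rw [comb_e₂] at e4
  refine ⟨?_, ?_, ?_, ?_, ?_, ?_⟩
  · intro j hj
    interval_cases j
    · rw [coeff_zero_taylorSeries, F.e₂e₁ hτ]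
    · rw [e4, F.comb_pair_e₁ hτ]; simp
  · intro j hj
    obtain rfl : j = 0 := by omega
    rw [coeff_zero_taylorSeries, F.alt.self_eq_zero]
  · rw [e4, e3, F.comb_pair_e₁ hτ]; norm_num
  · rw [e4, F.comb_pair_e₂ hτ]; simp
  · rw [e4, e3, e2, F.comb_pair_e₁ hτ]; norm_num; ring
  · rw [e4, e3, F.comb_pair_e₂ hτ]; norm_num

end IsLagrangianFrame

end StructureEquations

/-! ### The canonical normalization forces m = 3, b = 4, α = 0. -/

section StructureConstants

set_option linter.unusedSectionVars false

variable {W : Type*} [NormedAddCommGroup W] [NormedSpace ℝ W] [FiniteDimensional ℝ W]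
  {σ : LinearMap.BilinForm ℝ W} {Λ : ℝ → Submodule ℝ W} {I : Set ℝ} {e₁ e₂ f₁ f₂ : ℝ → W}
  {α m b a₂₁ a₂₂ a₃₁ a₄₁ a₄₂ : ℝ → ℝ}

namespace IsLagrangianFrame

variable (F : IsLagrangianFrame σ Λ I e₁ e₂ f₁ f₂)
include F
variable (S : HasStructureEquations I e₁ e₂ f₁ f₂ α m b a₂₁ a₂₂ a₃₁ a₄₁ a₄₂)
include S

theorem pair_deriv_e₁ {t : ℝ} (ht : t ∈ I) {x : W} (hx : x ∈ Λ t) : σ x (deriv e₁ t) = 0 := by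
  rw [(S.deriv_e₁ t ht).deriv, map_add, map_smul, map_smul, F.pair_e₁ ht hx, F.pair_e₂ ht hx]
  simp

theorem pair_deriv_e₂ {t : ℝ} (ht : t ∈ I) {x : W} (hx : x ∈ Λ t) :
    σ x (deriv e₂ t) = -b t * σ (f₂ t) x := by
  rw [(S.deriv_e₂ t ht).deriv, map_add, map_add, map_smul, map_smul, map_smul, F.pair_e₁ ht hx,
    F.pair_e₂ ht hx, F.swap x (f₂ t)]
  simp

/-- The velocity form is b times the square of the e₂-coordinate; for b = 0 it would have rank 0. -/
theorem rank_ne_zero {t : ℝ} (ht : t ∈ I) (hr : IsNondecreasingRankOneAt σ Λ t) : b t ≠ 0 := by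
  intro hb
  obtain ⟨Q, hQ, hrank, -⟩ := hr
  have h0 : Q = 0 := by
    ext v
    set x := σ (f₁ t) v with hx
    set y := σ (f₂ t) v with hy
    have h1 := ((F.hasDerivAt F.smooth₁ ht).const_smul x).add
      ((F.hasDerivAt F.smooth₂ ht).const_smul y)
    have h2 := hQ (fun s => x • e₁ s + y • e₂ s) _ v (F.eq_comb t ht v v.2).symm (by
      filter_upwards [F.isOpen.mem_nhds ht] with s hs
      exact add_mem (Submodule.smul_mem _ _ (F.mem₁ hs)) (Submodule.smul_mem _ _ (F.mem₂ hs))) h1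
    rw [h2, F.swap, map_add, map_smul, map_smul, F.pair_deriv_e₁ S ht v.2,
      F.pair_deriv_e₂ S ht v.2, hb]
    simp
  rw [h0, map_zero, LinearMap.range_zero, finrank_bot] at hrank
  exact zero_ne_one hrank

/-- The velocity is 0 on e₁ and b on e₂. Comparing with the squares of the pairings with w(t, τ),
the leading coefficients give the two equations. -/
theorem velocity_equations {τ : ℝ} (hτ : τ ∈ I) (hcan : IsCanonicalBasis σ Λ τ ![e₁ τ, e₂ τ]) :
    m τ * b τ * (3 - m τ) = 0 ∧ b τ = (b τ - m τ * b τ / 2) ^ 2 := by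
  obtain ⟨r₁, r₂, hr₁, hr₂, h⟩ := F.exists_expansion_of_isCanonicalBasis hτ hcan
  obtain ⟨h11, h12, c11, c12, -, -⟩ := F.coeff_pair_first S hτ
  obtain ⟨h21, h22, c21, c22, -, -⟩ := F.coeff_pair_second S hτ
  have hX : ContDiffAt ℝ ∞ (fun t : ℝ => t - τ) τ := by fun_prop
  constructor
  · have hs₁ := F.contDiffAt_left F.smooth₁ hτ (e₁ τ)
    have hs₂ := F.contDiffAt_left F.smooth₁ hτ (e₂ τ)
    have hA := hs₁.add (hX.mul hs₂)
    have hO : (fun t => (σ (e₁ t) (e₁ τ) + (t - τ) * σ (e₁ t) (e₂ τ)) ^ 2) =O[𝓝[≠] τ]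
        fun t => (t - τ) ^ (2 * 2 + 3) := by
      refine (F.sq_expansion F.smooth₁ hτ hr₁ hr₂ 2 h11 h12 (b := fun _ => 0) ?_).neg_left.congr_left
        fun t => by ring
      filter_upwards [h] with t ht
      rw [← ht.2.2.2.1, F.swap, F.pair_deriv_e₁ S ht.1 (F.mem₁ ht.1)]
      simp
    -- The degree 6 coefficient of the square is (−m²b/6 + mb/2)², and it must vanish.
    have hc := coeff_taylorSeries_of_isBigO (hA.pow 2) hO 6 (by norm_num)
    obtain ⟨p, hp, hp'⟩ := exists_eq_X_pow_mul h11
    obtain ⟨q, hq, hq'⟩ := exists_eq_X_pow_mul h12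
    have hp0 := hp' 0
    have hq0 := hq' 0
    rw [taylorSeries_pow hA, taylorSeries_add hs₁ (hX.mul hs₂), taylorSeries_mul hX hs₂,
      taylorSeries_sub_self, hp, hq, show (PowerSeries.X ^ 3 * p + PowerSeries.X *
      (PowerSeries.X ^ 2 * q)) ^ 2 = PowerSeries.X ^ 6 * ((p + q) * (p + q)) by ring,
      PowerSeries.coeff_X_pow_mul', if_pos le_rfl, Nat.sub_self, coeff_zero_mul', map_add,
      hp0, hq0, zero_add, zero_add, c11, c12] at hc
    have := mul_self_eq_zero.1 hc
    linarith
  · have hs₁ := F.contDiffAt_left F.smooth₂ hτ (e₁ τ)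
    have hs₂ := F.contDiffAt_left F.smooth₂ hτ (e₂ τ)
    have hbs := S.smooth_b.contDiffAt (F.isOpen.mem_nhds hτ)
    have hA := hs₁.add (hX.mul hs₂)
    have hO : (fun t => (t - τ) ^ 4 * b t -
        (σ (e₂ t) (e₁ τ) + (t - τ) * σ (e₂ t) (e₂ τ)) ^ 2) =O[𝓝[≠] τ]
        fun t => (t - τ) ^ (2 * 1 + 3) := by
      refine F.sq_expansion F.smooth₂ hτ hr₁ hr₂ 1 h21 h22 (b := b) ?_
      filter_upwards [h] with t ht
      rw [← ht.2.2.2.2, F.swap, F.pair_deriv_e₂ S ht.1 (F.mem₂ ht.1), F.f₂e₂ t ht.1]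
      simp
    -- In degree 4 the difference has coefficient b − (b − mb/2)².
    have hc := coeff_taylorSeries_of_isBigO (((hX.pow 4).mul hbs).sub (hA.pow 2)) hO 4
      (by norm_num)
    obtain ⟨p, hp, hp'⟩ := exists_eq_X_pow_mul h21
    obtain ⟨q, hq, hq'⟩ := exists_eq_X_pow_mul h22
    have hp0 := hp' 0
    have hq0 := hq' 0
    rw [taylorSeries_sub ((hX.pow 4).mul hbs) (hA.pow 2), taylorSeries_mul (hX.pow 4) hbs,
      taylorSeries_pow hX, taylorSeries_pow hA, taylorSeries_add hs₁ (hX.mul hs₂),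
      taylorSeries_mul hX hs₂,
      taylorSeries_sub_self, hp, hq, show PowerSeries.X ^ 4 * taylorSeries b τ -
      (PowerSeries.X ^ 2 * p + PowerSeries.X * (PowerSeries.X ^ 1 * q)) ^ 2 =
      PowerSeries.X ^ 4 * (taylorSeries b τ - (p + q) * (p + q)) by ring,
      PowerSeries.coeff_X_pow_mul', if_pos le_rfl, Nat.sub_self, map_sub, coeff_zero_mul', map_add,
      hp0, hq0, zero_add, zero_add, c21, c22, coeff_zero_taylorSeries] at hc
    linarith

/-- By continuity m takes the value 0 on a whole neighbourhood once it does at τ. Then e₁′ = α e₁,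
the line of e₁ is constant there, and nearby planes all meet Λ τ, contrary to the transversality
contained in the definition of w. -/
theorem m_ne_zero {τ : ℝ} (hτ : τ ∈ I) (hcan : IsCanonicalBasis σ Λ τ ![e₁ τ, e₂ τ])
    (hm : ∀ t ∈ I, m t = 0 ∨ m t = 3) : m τ ≠ 0 := by
  intro h0
  obtain ⟨r₁, r₂, -, -, h⟩ := F.exists_expansion_of_isCanonicalBasis hτ hcan
  have hmc := (S.smooth_m.contDiffAt (F.isOpen.mem_nhds hτ)).continuousAt
  have hm0 : ∀ᶠ t in 𝓝 τ, m t = 0 := by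
    filter_upwards [hmc.eventually_lt_const (show m τ < 3 by rw [h0]; norm_num),
      F.isOpen.mem_nhds hτ] with t ht htI
    exact (hm t htI).resolve_right ht.ne
  have hαc := (S.smooth_α.contDiffAt (F.isOpen.mem_nhds hτ)).continuousAt.norm
  have hαb : ∀ᶠ t in 𝓝 τ, ‖α t‖ ≤ ‖α τ‖ + 1 :=
    (hαc.eventually_lt_const (lt_add_one _)).mono fun t ht => ht.le
  obtain ⟨ε, hε, hball⟩ := Metric.mem_nhds_iff.1
    ((hm0.and hαb).and (eventually_mem_set.2 (F.isOpen.mem_nhds hτ)))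
  have hmem : ∀ t ∈ Set.Icc τ (τ + ε / 2), (m t = 0 ∧ ‖α t‖ ≤ ‖α τ‖ + 1) ∧ t ∈ I := by
    intro t ht
    refine hball ?_
    rw [Metric.mem_ball, Real.dist_eq, abs_lt]
    constructor <;> linarith [ht.1, ht.2]
  -- The function σ(e₁(t), w) solves the linear equation y′ = α y with bounded α, so Grönwall's
  -- inequality keeps it at zero.
  have hzero : ∀ w, σ (e₁ τ) w = 0 → ∀ t ∈ Set.Icc τ (τ + ε / 2), σ (e₁ t) w = 0 := by
    intro w hw
    have hd : ∀ t ∈ Set.Icc τ (τ + ε / 2), HasDerivAt (fun t => σ (e₁ t) w)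
        (α t * σ (e₁ t) w) t := by
      intro t ht
      have h1 := hasDerivAt_bilin σ (S.deriv_e₁ t (hmem t ht).2) (hasDerivAt_const t w)
      simpa [(hmem t ht).1.1] using h1
    refine eq_zero_of_abs_deriv_le_mul_abs_self_of_eq_zero_right (K := ‖α τ‖ + 1)
      (fun t ht => (hd t ht).continuousAt.continuousWithinAt)
      (fun t ht => (hd t (Set.Ico_subset_Icc_self ht)).hasDerivWithinAt) hw ?_
    intro t ht
    rw [norm_mul]
    exact mul_le_mul_of_nonneg_right (hmem t (Set.Ico_subset_Icc_self ht)).1.2 (norm_nonneg _)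
  have h' : ∀ᶠ t in 𝓝[>] τ, pairDet σ e₁ e₂ t τ ≠ 0 :=
    (h.filter_mono (nhdsWithin_mono τ fun t ht => ne_of_gt ht)).mono fun t ht => ht.2.2.1
  obtain ⟨t, htD, ht⟩ := (h'.and (Ioc_mem_nhdsGT (show τ < τ + ε / 2 by linarith))).exists
  refine htD ?_
  have ht' := Set.Ioc_subset_Icc_self ht
  rw [pairDet, hzero _ (F.alt _) t ht', hzero _ (F.e₁e₂ τ hτ) t ht']
  ring

theorem m_eq_and_b_eq (hcan : ∀ t ∈ I, IsCanonicalBasis σ Λ t ![e₁ t, e₂ t])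
    (hr : ∀ t ∈ I, IsNondecreasingRankOneAt σ Λ t) : ∀ t ∈ I, m t = 3 ∧ b t = 4 := by
  have h1 : ∀ t ∈ I, m t = 0 ∨ m t = 3 := by
    intro t ht
    have h2 := (F.velocity_equations S ht (hcan t ht)).1
    rcases mul_eq_zero.1 h2 with h3 | h3
    · exact Or.inl ((mul_eq_zero.1 h3).resolve_right (F.rank_ne_zero S ht (hr t ht)))
    · right; linarith
  intro t ht
  have h3 := (h1 t ht).resolve_left (F.m_ne_zero S ht (hcan t ht) h1)
  have h2 := (F.velocity_equations S ht (hcan t ht)).2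
  rw [h3] at h2
  have h4 : b t * (b t - 4) = 0 := by linarith
  exact ⟨h3, by linarith [(mul_eq_zero.1 h4).resolve_left (F.rank_ne_zero S ht (hr t ht))]⟩

theorem taylorSeries_pairDet {τ : ℝ} (hτ : τ ∈ I) :
    taylorSeries (fun t => pairDet σ e₁ e₂ t τ) τ =
      taylorSeries (fun t => σ (e₁ t) (e₁ τ)) τ * taylorSeries (fun t => σ (e₂ t) (e₂ τ)) τ -
      taylorSeries (fun t => σ (e₁ t) (e₂ τ)) τ * taylorSeries (fun t => σ (e₂ t) (e₁ τ)) τ := by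
  have h11 := F.contDiffAt_left F.smooth₁ hτ (e₁ τ)
  have h12 := F.contDiffAt_left F.smooth₁ hτ (e₂ τ)
  have h21 := F.contDiffAt_left F.smooth₂ hτ (e₁ τ)
  have h22 := F.contDiffAt_left F.smooth₂ hτ (e₂ τ)
  rw [← taylorSeries_mul h11 h22, ← taylorSeries_mul h12 h21,
    ← taylorSeries_sub (h11.mul h22) (h12.mul h21)]
  rfl

/-- Leading terms do not see α, so the next order is needed. Eliminating r₂ between the two
equations for w leaves D²(1 + (t−τ)² r₁)² = 4(t−τ)⁴ σ(e₁(t), e₂(τ))², in which r₁ enters two orders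
above the leading one. The intermediate degree then reads 96 α = 0. -/
theorem alpha_eq_zero (hmb : ∀ t ∈ I, m t = 3 ∧ b t = 4) {τ : ℝ} (hτ : τ ∈ I)
    (hcan : IsCanonicalBasis σ Λ τ ![e₁ τ, e₂ τ]) : α τ = 0 := by
  obtain ⟨r₁, r₂, hr₁, hr₂, h⟩ := F.exists_expansion_of_isCanonicalBasis hτ hcan
  obtain ⟨h11, h12, c11, c12, c11', c12'⟩ := F.coeff_pair_first S hτ
  obtain ⟨h21, h22, c21, c22, c21', c22'⟩ := F.coeff_pair_second S hτ
  have hdm : deriv m τ = 0 := by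
    rw [EventuallyEq.deriv_eq (f := fun _ => 3)]
    · simp
    · filter_upwards [F.isOpen.mem_nhds hτ] with t ht using (hmb t ht).1
  have hdb : deriv b τ = 0 := by
    rw [EventuallyEq.deriv_eq (f := fun _ => 4)]
    · simp
    · filter_upwards [F.isOpen.mem_nhds hτ] with t ht using (hmb t ht).2
  simp only [(hmb τ hτ).1, (hmb τ hτ).2, hdm, hdb] at c11 c12 c11' c12' c21 c22 c21' c22'
  obtain ⟨p, hp, hp'⟩ := exists_eq_X_pow_mul h11
  obtain ⟨q, hq, hq'⟩ := exists_eq_X_pow_mul h12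
  obtain ⟨r, hr, hr'⟩ := exists_eq_X_pow_mul h21
  obtain ⟨s, hs, hs'⟩ := exists_eq_X_pow_mul h22
  have hTD : taylorSeries (fun t => pairDet σ e₁ e₂ t τ) τ =
      PowerSeries.X ^ 4 * (p * s - q * r) := by
    rw [F.taylorSeries_pairDet S hτ, hp, hq, hr, hs]; ring
  have hDs := F.contDiffAt_pairDet hτ τ
  have hDO : (fun t => pairDet σ e₁ e₂ t τ) =O[𝓝[≠] τ] fun t => (t - τ) ^ 4 :=
    (isBigO_of_coeff_taylorSeries hDs fun j hj => by
      rw [hTD, PowerSeries.coeff_X_pow_mul', if_neg (by omega)]).mono nhdsWithin_le_nhds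
  have hD2 : (fun t => pairDet σ e₁ e₂ t τ ^ 2) =O[𝓝[≠] τ] fun t => (t - τ) ^ 8 :=
    (hDO.pow 2).congr_right fun t => by ring
  have h1O := isBigO_sq_mul_bounded hr₁ hD2
  have h2O := isBigO_sq_mul_bounded hr₁ h1O
  -- Both terms start in degree 8, while the difference equals D²((1 + (t−τ)² r₁)² − 1), which is of
  -- order 10; degree 9 is therefore free of the unknown r₁.
  have hE : (fun t => 4 * (t - τ) ^ 4 * σ (e₁ t) (e₂ τ) ^ 2 - pairDet σ e₁ e₂ t τ ^ 2)
      =O[𝓝[≠] τ] fun t => (t - τ) ^ 10 := by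
    refine ((h1O.const_mul_left 2).add
      (h2O.trans (pow_isBigO_pow_of_le τ (show 10 ≤ 12 by norm_num)))).congr' ?_ EventuallyEq.rfl
    filter_upwards [h] with t ht
    obtain ⟨htI, hne, hD, g1, g2⟩ := ht
    rw [F.swap (deriv e₁ t), F.pair_deriv_e₁ S htI (F.mem₁ htI), neg_zero, mul_zero] at g1
    have g1' := pow_eq_zero_iff (two_ne_zero) |>.1 g1.symm
    rw [F.swap (deriv e₂ t), F.pair_deriv_e₂ S htI (F.mem₂ htI), F.f₂e₂ t htI,
      (hmb t htI).2] at g2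
    -- The equation for e₁ says that the coordinates of w are annihilated by the first row of the
    -- pairing matrix; multiplying by a cofactor eliminates the second coordinate.
    have g3 : pairDet σ e₁ e₂ t τ * (1 + (t - τ) ^ 2 * r₁ t) = -σ (e₁ t) (e₂ τ) *
        (σ (e₂ t) (e₁ τ) * (1 + (t - τ) ^ 2 * r₁ t) +
            σ (e₂ t) (e₂ τ) * ((t - τ) + (t - τ) ^ 2 * r₂ t)) := by
      unfold pairDet
      linear_combination (σ (e₂ t) (e₂ τ)) * g1'
    have g4 : pairDet σ e₁ e₂ t τ ^ 2 * (1 + (t - τ) ^ 2 * r₁ t) ^ 2 =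
        4 * (t - τ) ^ 4 * σ (e₁ t) (e₂ τ) ^ 2 := by
      rw [← mul_pow, g3, mul_pow, ← g2]
      ring
    rw [← g4]
    ring
  have hX : ContDiffAt ℝ ∞ (fun t : ℝ => t - τ) τ := by fun_prop
  have hs12 := F.contDiffAt_left F.smooth₁ hτ (e₂ τ)
  have hX4 : ContDiffAt ℝ ∞ (fun t : ℝ => 4 * (t - τ) ^ 4) τ := by fun_prop
  have hc := coeff_taylorSeries_of_isBigO ((hX4.mul (hs12.pow 2)).sub (hDs.pow 2)) hE 9
    (by norm_num)
  rw [taylorSeries_sub (hX4.mul (hs12.pow 2)) (hDs.pow 2), taylorSeries_mul hX4 (hs12.pow 2),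
    taylorSeries_const_mul 4 (hX.pow 4), taylorSeries_pow hX, taylorSeries_pow hs12,
    taylorSeries_pow hDs, taylorSeries_sub_self, hTD, hq,
    show PowerSeries.C (4 : ℝ) * PowerSeries.X ^ 4 * (PowerSeries.X ^ 2 * q) ^ 2 -
    (PowerSeries.X ^ 4 * (p * s - q * r)) ^ 2 = PowerSeries.X ^ 8 *
      (PowerSeries.C (4 : ℝ) * (q * q) - (p * s - q * r) * (p * s - q * r)) by ring,
    PowerSeries.coeff_X_pow_mul', if_pos (by norm_num), map_sub, PowerSeries.coeff_C_mul] at hc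
  simp only [Nat.reduceSub, coeff_one_mul', coeff_zero_mul', map_sub, hp', hq', hr', hs',
    Nat.reduceAdd, zero_add, c11, c12, c21, c22, c11', c12', c21', c22'] at hc
  linarith

end IsLagrangianFrame

end StructureConstants

/-! ### The full structural matrix. -/

section StructureMatrix

set_option linter.unusedSectionVars false

variable {W : Type*} [NormedAddCommGroup W] [NormedSpace ℝ W] [FiniteDimensional ℝ W]
  {σ : LinearMap.BilinForm ℝ W} {Λ : ℝ → Submodule ℝ W} {I : Set ℝ} {e₁ e₂ f₁ f₂ : ℝ → W}
  {a₂₁ a₂₂ a₃₁ a₄₁ a₄₂ : ℝ → ℝ}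

namespace IsLagrangianFrame

variable (F : IsLagrangianFrame σ Λ I e₁ e₂ f₁ f₂)
include F

theorem deriv_pair_add {a b : ℝ → W} (ha : ContDiffOn ℝ ∞ a I) (hb : ContDiffOn ℝ ∞ b I) {c : ℝ}
    (h : ∀ t ∈ I, σ (a t) (b t) = c) {t : ℝ} (ht : t ∈ I) :
    σ (deriv a t) (b t) + σ (a t) (deriv b t) = 0 := by
  refine (hasDerivAt_bilin σ (F.hasDerivAt ha ht) (F.hasDerivAt hb ht)).unique
    ((hasDerivAt_const t c).congr_of_eventuallyEq ?_)
  filter_upwards [F.isOpen.mem_nhds ht] with s hs using h s hs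

/-- The structural matrix of a canonical frame. -/
theorem structure_matrix (hcan : ∀ t ∈ I, IsCanonicalBasis σ Λ t ![e₁ t, e₂ t])
    (hr : ∀ t ∈ I, IsNondecreasingRankOneAt σ Λ t)
    {M : ℝ → Matrix (Fin 4) (Fin 4) ℝ}
    (hM : ∀ t ∈ I, ∀ i : Fin 4, HasDerivAt ((![e₁, e₂, f₁, f₂] : Fin 4 → ℝ → W) i)
      (∑ j : Fin 4, M t i j • (![e₁, e₂, f₁, f₂] : Fin 4 → ℝ → W) j t) t) :
    HasStructureEquations I e₁ e₂ f₁ f₂ (fun _ => 0) (fun _ => 3) (fun _ => 4)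
      (fun t => M t 1 0) (fun t => M t 1 1) (fun t => M t 2 0) (fun t => M t 2 1)
      (fun t => M t 3 1) ∧
    ∀ t ∈ I, M t =
        !![      0,       3,  0,          0;
           M t 1 0, M t 1 1,  0,          4;
           M t 2 0, M t 2 1,  0, -(M t 1 0);
           M t 2 1, M t 3 1, -3, -(M t 1 1)] := by
  have hd₁ : ∀ t ∈ I, HasDerivAt e₁
      (M t 0 0 • e₁ t + M t 0 1 • e₂ t + M t 0 2 • f₁ t + M t 0 3 • f₂ t) t := fun t ht => by
    simpa [Fin.sum_univ_four] using hM t ht 0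
  have hd₂ : ∀ t ∈ I, HasDerivAt e₂
      (M t 1 0 • e₁ t + M t 1 1 • e₂ t + M t 1 2 • f₁ t + M t 1 3 • f₂ t) t := fun t ht => by
    simpa [Fin.sum_univ_four] using hM t ht 1
  have hd₃ : ∀ t ∈ I, HasDerivAt f₁
      (M t 2 0 • e₁ t + M t 2 1 • e₂ t + M t 2 2 • f₁ t + M t 2 3 • f₂ t) t := fun t ht => by
    simpa [Fin.sum_univ_four] using hM t ht 2
  have hd₄ : ∀ t ∈ I, HasDerivAt f₂
      (M t 3 0 • e₁ t + M t 3 1 • e₂ t + M t 3 2 • f₁ t + M t 3 3 • f₂ t) t := fun t ht => by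
    simpa [Fin.sum_univ_four] using hM t ht 3
  have hf₁e₁ : ∀ t ∈ I, σ (e₁ t) (f₁ t) = -1 := fun t ht => by rw [F.swap, F.f₁e₁ t ht]
  have hf₁e₂ : ∀ t ∈ I, σ (e₂ t) (f₁ t) = 0 := fun t ht => by rw [F.swap, F.f₁e₂ t ht, neg_zero]
  have hf₂e₁ : ∀ t ∈ I, σ (e₁ t) (f₂ t) = 0 := fun t ht => by rw [F.swap, F.f₂e₁ t ht, neg_zero]
  have hf₂e₂ : ∀ t ∈ I, σ (e₂ t) (f₂ t) = -1 := fun t ht => by rw [F.swap, F.f₂e₂ t ht]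
  have hf₂f₁ : ∀ t ∈ I, σ (f₂ t) (f₁ t) = 0 := fun t ht => by rw [F.swap, F.f₁f₂ t ht, neg_zero]
  have hself : ∀ x, σ x x = 0 := F.alt
  have hsmooth : ∀ {a c : ℝ → W}, ContDiffOn ℝ ∞ a I → ContDiffOn ℝ ∞ c I →
      ContDiffOn ℝ ∞ (fun t => σ (c t) (deriv a t)) I := fun ha hc =>
    contDiffOn_bilin σ hc (ha.deriv_of_isOpen F.isOpen (by simp))
  -- These two entries vanish because e₁ spans the kernel of the velocity; the remaining relations
  -- come from differentiating the symplectic relations.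
  have r02 : ∀ t ∈ I, M t 0 2 = 0 := fun t ht => by
    have h := (F.deriv_pair_eq_zero ht (hcan t ht)).1
    rw [(hd₁ t ht).deriv] at h
    simpa [hself, F.e₂e₁ ht, F.f₁e₁ t ht, F.f₂e₁ t ht] using h
  have r12 : ∀ t ∈ I, M t 1 2 = 0 := fun t ht => by
    have h := (F.deriv_pair_eq_zero ht (hcan t ht)).2
    rw [(hd₂ t ht).deriv] at h
    simpa [hself, F.e₂e₁ ht, F.f₁e₁ t ht, F.f₂e₁ t ht] using h
  have r03 : ∀ t ∈ I, M t 0 3 = 0 := fun t ht => by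
    have h := F.deriv_pair_add F.smooth₁ F.smooth₂ F.e₁e₂ ht
    rw [(hd₁ t ht).deriv, (hd₂ t ht).deriv] at h
    simp [hself, F.e₁e₂ t ht, F.f₁e₂ t ht, F.f₂e₂ t ht, hf₁e₁ t ht, hf₂e₁ t ht] at h
    linarith [r12 t ht]
  have r22 : ∀ t ∈ I, M t 2 2 = -M t 0 0 := fun t ht => by
    have h := F.deriv_pair_add F.smooth₃ F.smooth₁ F.f₁e₁ ht
    rw [(hd₁ t ht).deriv, (hd₃ t ht).deriv] at h
    simp [hself, F.f₁f₂ t ht, F.f₁e₂ t ht, F.f₁e₁ t ht, F.f₂e₁ t ht, F.e₂e₁ ht] at h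
    linarith
  have r23 : ∀ t ∈ I, M t 2 3 = -M t 1 0 := fun t ht => by
    have h := F.deriv_pair_add F.smooth₃ F.smooth₂ F.f₁e₂ ht
    rw [(hd₂ t ht).deriv, (hd₃ t ht).deriv] at h
    simp [hself, F.f₁f₂ t ht, F.f₁e₂ t ht, F.f₁e₁ t ht, F.f₂e₂ t ht, F.e₁e₂ t ht] at h
    linarith
  have r32 : ∀ t ∈ I, M t 3 2 = -M t 0 1 := fun t ht => by
    have h := F.deriv_pair_add F.smooth₄ F.smooth₁ F.f₂e₁ ht
    rw [(hd₁ t ht).deriv, (hd₄ t ht).deriv] at h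
    simp [hself, hf₂f₁ t ht, F.f₂e₂ t ht, F.f₁e₁ t ht, F.f₂e₁ t ht, F.e₂e₁ ht] at h
    linarith
  have r33 : ∀ t ∈ I, M t 3 3 = -M t 1 1 := fun t ht => by
    have h := F.deriv_pair_add F.smooth₄ F.smooth₂ F.f₂e₂ ht
    rw [(hd₂ t ht).deriv, (hd₄ t ht).deriv] at h
    simp [hself, hf₂f₁ t ht, F.f₂e₂ t ht, F.f₁e₂ t ht, F.f₂e₁ t ht, F.e₁e₂ t ht] at h
    linarith
  have r30 : ∀ t ∈ I, M t 3 0 = M t 2 1 := fun t ht => by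
    have h := F.deriv_pair_add F.smooth₃ F.smooth₄ F.f₁f₂ ht
    rw [(hd₃ t ht).deriv, (hd₄ t ht).deriv] at h
    simp [hself, F.f₁f₂ t ht, F.f₁e₂ t ht, F.f₁e₁ t ht, hf₂e₁ t ht, hf₂e₂ t ht] at h
    linarith
  -- Smoothness of M is not assumed: each needed entry is, up to sign, a pairing of a frame vector
  -- with the derivative of another.
  have s00 : ContDiffOn ℝ ∞ (fun t => M t 0 0) I :=
    (hsmooth F.smooth₁ F.smooth₃).congr fun t ht => by
      rw [(hd₁ t ht).deriv]; simp [hself, F.f₁e₁ t ht, F.f₁e₂ t ht, F.f₁f₂ t ht]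
  have s01 : ContDiffOn ℝ ∞ (fun t => M t 0 1) I :=
    (hsmooth F.smooth₁ F.smooth₄).congr fun t ht => by
      rw [(hd₁ t ht).deriv]; simp [hself, F.f₂e₁ t ht, F.f₂e₂ t ht, hf₂f₁ t ht]
  have s10 : ContDiffOn ℝ ∞ (fun t => M t 1 0) I :=
    (hsmooth F.smooth₂ F.smooth₃).congr fun t ht => by
      rw [(hd₂ t ht).deriv]; simp [hself, F.f₁e₁ t ht, F.f₁e₂ t ht, F.f₁f₂ t ht]
  have s11 : ContDiffOn ℝ ∞ (fun t => M t 1 1) I :=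
    (hsmooth F.smooth₂ F.smooth₄).congr fun t ht => by
      rw [(hd₂ t ht).deriv]; simp [hself, F.f₂e₁ t ht, F.f₂e₂ t ht, hf₂f₁ t ht]
  have s13 : ContDiffOn ℝ ∞ (fun t => M t 1 3) I :=
    (hsmooth F.smooth₂ F.smooth₂).neg.congr fun t ht => by
      rw [(hd₂ t ht).deriv]; simp [hself, F.e₂e₁ ht, hf₁e₂ t ht, hf₂e₂ t ht]
  have s20 : ContDiffOn ℝ ∞ (fun t => M t 2 0) I :=
    (hsmooth F.smooth₃ F.smooth₃).congr fun t ht => by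
      rw [(hd₃ t ht).deriv]; simp [hself, F.f₁e₁ t ht, F.f₁e₂ t ht, F.f₁f₂ t ht]
  have s21 : ContDiffOn ℝ ∞ (fun t => M t 2 1) I :=
    (hsmooth F.smooth₃ F.smooth₄).congr fun t ht => by
      rw [(hd₃ t ht).deriv]; simp [hself, F.f₂e₁ t ht, F.f₂e₂ t ht, hf₂f₁ t ht]
  have s31 : ContDiffOn ℝ ∞ (fun t => M t 3 1) I :=
    (hsmooth F.smooth₄ F.smooth₄).congr fun t ht => by
      rw [(hd₄ t ht).deriv]; simp [hself, F.f₂e₁ t ht, F.f₂e₂ t ht, hf₂f₁ t ht]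
  -- Provisional structural equations, with α, m, b still read off from M, to which the
  -- normalization results apply.
  have S : HasStructureEquations I e₁ e₂ f₁ f₂ (fun t => M t 0 0) (fun t => M t 0 1)
      (fun t => M t 1 3) (fun t => M t 1 0) (fun t => M t 1 1) (fun t => M t 2 0)
      (fun t => M t 2 1) (fun t => M t 3 1) := by
    refine ⟨s00, s01, s13, s10, s11, s20, s21, s31, fun t ht => ?_, fun t ht => ?_,
      fun t ht => ?_, fun t ht => ?_⟩
    · refine (hd₁ t ht).congr_deriv ?_
      rw [r02 t ht, r03 t ht]; module
    · refine (hd₂ t ht).congr_deriv ?_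
      rw [r12 t ht]; module
    · refine (hd₃ t ht).congr_deriv ?_
      rw [r22 t ht, r23 t ht]; module
    · refine (hd₄ t ht).congr_deriv ?_
      rw [r30 t ht, r32 t ht, r33 t ht]; module
  have hmb := F.m_eq_and_b_eq S hcan hr
  have hα := fun t ht => F.alpha_eq_zero S hmb (τ := t) ht (hcan t ht)
  refine ⟨⟨contDiffOn_const, contDiffOn_const, contDiffOn_const, s10, s11, s20, s21, s31,
    fun t ht => ?_, fun t ht => ?_, fun t ht => ?_, fun t ht => ?_⟩, fun t ht => ?_⟩
  · have h := S.deriv_e₁ t ht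
    rwa [hα t ht, (hmb t ht).1] at h
  · have h := S.deriv_e₂ t ht
    rwa [(hmb t ht).2] at h
  · have h := S.deriv_f₁ t ht
    rwa [hα t ht] at h
  · have h := S.deriv_f₂ t ht
    rwa [(hmb t ht).1] at h
  · have h1 : M t 0 0 = 0 := hα t ht
    have h2 : M t 0 1 = 3 := (hmb t ht).1
    have h3 : M t 1 3 = 4 := (hmb t ht).2
    have hE : M t = !![M t 0 0, M t 0 1, M t 0 2, M t 0 3; M t 1 0, M t 1 1, M t 1 2, M t 1 3;
        M t 2 0, M t 2 1, M t 2 2, M t 2 3; M t 3 0, M t 3 1, M t 3 2, M t 3 3] := by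
      ext i j
      fin_cases i <;> fin_cases j <;> rfl
    refine hE.trans ?_
    simp only [r02 t ht, r12 t ht, r03 t ht, r22 t ht, r23 t ht, r32 t ht, r33 t ht, r30 t ht,
        h1, h2, h3, neg_zero]

/-- The leading coefficient is (−m²b/6)·b − (mb/2)(−mb/2). -/
theorem taylorSeries_pairDet_eq {m b α : ℝ → ℝ}
    (S : HasStructureEquations I e₁ e₂ f₁ f₂ α m b a₂₁ a₂₂ a₃₁ a₄₁ a₄₂)
    {τ : ℝ} (hτ : τ ∈ I) : ∃ d : PowerSeries ℝ,
      taylorSeries (fun t => pairDet σ e₁ e₂ t τ) τ = PowerSeries.X ^ 4 * d ∧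
      PowerSeries.coeff 0 d = m τ ^ 2 * b τ ^ 2 / 12 := by
  obtain ⟨h11, h12, c11, c12, -, -⟩ := F.coeff_pair_first S hτ
  obtain ⟨h21, h22, c21, c22, -, -⟩ := F.coeff_pair_second S hτ
  obtain ⟨p, hp, hp'⟩ := exists_eq_X_pow_mul h11
  obtain ⟨q, hq, hq'⟩ := exists_eq_X_pow_mul h12
  obtain ⟨r, hr, hr'⟩ := exists_eq_X_pow_mul h21
  obtain ⟨s, hs, hs'⟩ := exists_eq_X_pow_mul h22
  refine ⟨p * s - q * r, ?_, ?_⟩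
  · rw [F.taylorSeries_pairDet S hτ, hp, hq, hr, hs]; ring
  · simp only [coeff_zero_mul', map_sub, hp', hq', hr', hs', zero_add, c11, c12, c21, c22]
    ring

end IsLagrangianFrame

end StructureMatrix

/-! ### The weight of the curve is 4. -/

section Weight

set_option linter.unusedSectionVars false

variable {W : Type*} [NormedAddCommGroup W] [NormedSpace ℝ W] [FiniteDimensional ℝ W]
  {σ : LinearMap.BilinForm ℝ W} {Λ : ℝ → Submodule ℝ W} {I : Set ℝ} {e₁ e₂ f₁ f₂ : ℝ → W}
  {α m b a₂₁ a₂₂ a₃₁ a₄₁ a₄₂ : ℝ → ℝ}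

theorem eq_of_hasZeroOfOrder {φ : ℝ → ℝ} {d : PowerSeries ℝ} {τ : ℝ} {k n : ℕ}
    (h : HasZeroOfOrder φ τ k) (hφ : taylorSeries φ τ = PowerSeries.X ^ n * d)
    (hd : PowerSeries.coeff 0 d ≠ 0) : k = n := by
  have h1 : ∀ j, iteratedDeriv j φ τ = 0 ↔ PowerSeries.coeff j (taylorSeries φ τ) = 0 := by
    intro j
    rw [coeff_taylorSeries, div_eq_zero_iff]
    have : (j.factorial : ℝ) ≠ 0 := by positivity
    simp [this]
  rcases lt_trichotomy k n with hk | hk | hk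
  · refine absurd ((h1 k).2 ?_) h.2
    rw [hφ, PowerSeries.coeff_X_pow_mul', if_neg (by omega)]
  · exact hk
  · have h2 := (h1 n).1 (h.1 n hk)
    rw [hφ, PowerSeries.coeff_X_pow_mul', if_pos le_rfl, Nat.sub_self] at h2
    exact absurd h2 hd

namespace IsLagrangianFrame

variable (F : IsLagrangianFrame σ Λ I e₁ e₂ f₁ f₂)
include F

theorem finrank_eq {t : ℝ} (ht : t ∈ I) : Module.finrank ℝ (Λ t) = 2 := by
  have hs : Λ t = Submodule.span ℝ (Set.range ![e₁ t, e₂ t]) := by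
    rw [Matrix.range_cons, Matrix.range_cons, Matrix.range_empty, Set.union_empty,
      Set.singleton_union]
    refine le_antisymm (fun x hx => ?_) (Submodule.span_le.2 ?_)
    · rw [Submodule.mem_span_pair]
      exact ⟨_, _, (F.eq_comb t ht x hx).symm⟩
    · rintro x (rfl | rfl)
      · exact F.mem₁ ht
      · exact F.mem₂ ht
  have hl : LinearIndependent ℝ ![e₁ t, e₂ t] := by
    rw [LinearIndependent.pair_iff]
    intro x y h
    have h1 := congrArg (σ (f₁ t)) h
    have h2 := congrArg (σ (f₂ t)) h
    simp [F.f₁e₁ t ht, F.f₁e₂ t ht, F.f₂e₁ t ht, F.f₂e₂ t ht] at h1 h2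
    exact ⟨h1, h2⟩
  rw [hs, finrank_span_eq_card hl]
  simp

/-- Transversality to `Γ` in terms of the coordinates of the projections of the frame along `Γ`. -/
theorem isCompl_iff_det_ne_zero {Δ Γ : Submodule ℝ W} (bΔ : Module.Basis (Fin 2) ℝ Δ)
    (hc : IsCompl Δ Γ) {t : ℝ} (ht : t ∈ I) :
    IsCompl (Λ t) Γ ↔ (Matrix.of fun i j : Fin 2 =>
      bΔ.repr (Δ.projectionOnto Γ hc (![e₁ t, e₂ t] i)) j).det ≠ 0 := by
  set A : Matrix (Fin 2) (Fin 2) ℝ := Matrix.of fun i j : Fin 2 =>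
      bΔ.repr (Δ.projectionOnto Γ hc (![e₁ t, e₂ t] i)) j with hA
  have key : ∀ c : Fin 2 → ℝ, Matrix.vecMul c A = 0 ↔ c 0 • e₁ t + c 1 • e₂ t ∈ Γ := by
    intro c
    rw [← Submodule.projectionOnto_apply_eq_zero_iff hc, ← bΔ.repr.map_eq_zero_iff]
    rw [Finsupp.ext_iff, funext_iff]
    refine forall_congr' fun j => ?_
    simp [Matrix.vecMul, dotProduct, Fin.sum_univ_two, hA]
  constructor
  · intro h hdet
    obtain ⟨c, hc0, hcA⟩ := Matrix.exists_vecMul_eq_zero_iff.2 hdet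
    have h1 : c 0 • e₁ t + c 1 • e₂ t = 0 := Submodule.disjoint_def.1 h.disjoint _
      (add_mem (Submodule.smul_mem _ _ (F.mem₁ ht)) (Submodule.smul_mem _ _ (F.mem₂ ht)))
      ((key c).1 hcA)
    have h2 := congrArg (σ (f₁ t)) h1
    have h3 := congrArg (σ (f₂ t)) h1
    simp [F.f₁e₁ t ht, F.f₁e₂ t ht, F.f₂e₁ t ht, F.f₂e₂ t ht] at h2 h3
    refine hc0 (funext fun i => ?_)
    fin_cases i
    · exact h2
    · exact h3
  · intro hdet
    have hdis : Disjoint (Λ t) Γ := by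
      rw [Submodule.disjoint_def]
      intro x hx hxΓ
      by_contra hne
      refine hdet (Matrix.exists_vecMul_eq_zero_iff.1 ⟨![σ (f₁ t) x, σ (f₂ t) x], ?_, ?_⟩)
      · intro h0
        have h1 := congrFun h0 0
        have h2 := congrFun h0 1
        simp at h1 h2
        refine hne ?_
        rw [F.eq_comb t ht x hx, h1, h2]
        simp
      · rw [key]
        simpa using (F.eq_comb t ht x hx) ▸ hxΓ
    have hdim : Module.finrank ℝ (Λ t) + Module.finrank ℝ Γ = Module.finrank ℝ W := by
      rw [F.finrank_eq ht, ← Submodule.finrank_add_eq_of_isCompl hc,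
        Module.finrank_eq_card_basis bΔ]
      simp
    refine ⟨hdis, codisjoint_iff.2 ?_⟩
    apply Submodule.eq_top_of_finrank_eq
    rw [← hdim, ← Submodule.finrank_sup_add_finrank_inf_eq, hdis.eq_bot, finrank_bot, add_zero]

/-- In graph coordinates the determinant of the difference of two points of the curve is
proportional to the determinant of the pairing of the frames. -/
theorem pairDet_eq_det {Δ Γ : Submodule ℝ W} (bΔ : Module.Basis (Fin 2) ℝ Δ)
    (bΓ : Module.Basis (Fin 2) ℝ Γ) (hc : IsCompl Δ Γ) {t τ : ℝ} (ht : t ∈ I) (hτ : τ ∈ I)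
    (hΓ : IsCompl (Λ t) Γ) (hΓ' : IsCompl (Λ τ) Γ) :
    pairDet σ e₁ e₂ t τ = (Matrix.of fun i j : Fin 2 =>
        bΔ.repr (Δ.projectionOnto Γ hc (![e₁ t, e₂ t] i)) j).det *
      (LinearMap.toMatrix bΔ bΓ (graphMap Δ (Λ t) Γ : Δ →ₗ[ℝ] Γ) -
        LinearMap.toMatrix bΔ bΓ (graphMap Δ (Λ τ) Γ : Δ →ₗ[ℝ] Γ)).det *
      (Matrix.of fun i j : Fin 2 => σ (bΓ i) (![e₁ τ, e₂ τ] j)).det := by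
  set A : Matrix (Fin 2) (Fin 2) ℝ := Matrix.of fun i j : Fin 2 =>
      bΔ.repr (Δ.projectionOnto Γ hc (![e₁ t, e₂ t] i)) j with hA
  set K : Matrix (Fin 2) (Fin 2) ℝ :=
    Matrix.of fun i j : Fin 2 => σ (bΓ i) (![e₁ τ, e₂ τ] j) with hK
  set G : Δ →ₗ[ℝ] Γ := (graphMap Δ (Λ t) Γ : Δ →ₗ[ℝ] Γ) - (graphMap Δ (Λ τ) Γ : Δ →ₗ[ℝ] Γ)
    with hG
  have hmem : ∀ i, (![e₁ t, e₂ t] : Fin 2 → W) i ∈ Λ t := by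
    intro i; fin_cases i
    · exact F.mem₁ ht
    · exact F.mem₂ ht
  have hker : ∀ x ∈ Λ τ, ∀ j, σ x ((![e₁ τ, e₂ τ] : Fin 2 → W) j) = 0 := by
    intro x hx j; fin_cases j
    · exact F.pair_e₁ hτ hx
    · exact F.pair_e₂ hτ hx
  -- A vector of Λ t with Δ-component d differs from G d ∈ Γ by a vector of Λ τ, which is invisible
  -- to the frame at τ. So the pairing matrix factors through the difference of the two graph
  -- coordinates.
  have key : (Matrix.of fun i j : Fin 2 => σ (![e₁ t, e₂ t] i) (![e₁ τ, e₂ τ] j)) =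
      A * (LinearMap.toMatrix bΔ bΓ G).transpose * K := by
    ext i j
    set x := (![e₁ t, e₂ t] : Fin 2 → W) i with hx
    set d : Δ := Δ.projectionOnto Γ hc x with hd
    set g : Γ := Γ.projectionOnto Δ hc.symm x with hg
    have hsum : (d : W) + (g : W) = x :=
      Submodule.projection_add_projection_eq_self hc x
    have h1 : g = graphMap Δ (Λ t) Γ d := (mem_iff_graphMap hΓ d g).1 (by rw [hsum]; exact hmem i)
    have h2 : (d : W) + (graphMap Δ (Λ τ) Γ d : W) ∈ Λ τ := (mem_iff_graphMap hΓ' d _).2 rfl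
    have h3 : σ x (![e₁ τ, e₂ τ] j) = σ (G d : W) (![e₁ τ, e₂ τ] j) := by
      have h4 : x = ((d : W) + (graphMap Δ (Λ τ) Γ d : W)) + (G d : W) := by
        rw [← hsum, h1, hG]
        simp
      rw [h4, map_add, LinearMap.add_apply, hker _ h2, zero_add]
    have h5 : (G d : W) = ∑ l, (LinearMap.toMatrix bΔ bΓ G).mulVec (bΔ.repr d) l • (bΓ l : W) := by
      rw [LinearMap.toMatrix_mulVec_repr]
      refine (congrArg (fun y : Γ => (y : W)) (bΓ.sum_repr (G d)).symm).trans ?_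
      simp only [AddSubmonoidClass.coe_finsetSum, Submodule.coe_smul]
    rw [Matrix.of_apply, h3, h5, map_sum, LinearMap.sum_apply]
    simp only [Matrix.mul_apply, Matrix.mulVec, dotProduct, map_smul, LinearMap.smul_apply,
      smul_eq_mul, Matrix.transpose_apply, hA, hK, Matrix.of_apply]
    refine Finset.sum_congr rfl fun l _ => ?_
    congr 1
    exact Finset.sum_congr rfl fun n _ => mul_comm _ _
  have hdet := congrArg Matrix.det key
  rw [Matrix.det_mul, Matrix.det_mul, Matrix.det_transpose, hG, map_sub] at hdet
  rw [← hdet, Matrix.det_fin_two]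
  simp [pairDet]

/-- The determinants D(t, τ) and det(S_t − S_τ) differ by a factor A(t) K that is smooth and nonzero
near τ, so they vanish to the same order, and D vanishes to order exactly 4. -/
theorem weight_eq (S : HasStructureEquations I e₁ e₂ f₁ f₂ α m b a₂₁ a₂₂ a₃₁ a₄₁ a₄₂)
    {τ : ℝ} (hτ : τ ∈ I) (hm : m τ ≠ 0) (hb : b τ ≠ 0) {k : ℕ}
    (h : HasWeightAt 2 Λ τ k) : k = 4 := by
  obtain ⟨Δ, Γ, bΔ, bΓ, hc, hΓ, hz⟩ := h
  obtain ⟨d, hd, hd0⟩ := F.taylorSeries_pairDet_eq S hτ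
  have hd0' : PowerSeries.coeff 0 d ≠ 0 := by
    rw [hd0]; positivity
  set A : ℝ → ℝ := fun t => (Matrix.of fun i j : Fin 2 =>
      bΔ.repr (Δ.projectionOnto Γ hc (![e₁ t, e₂ t] i)) j).det with hA
  set K : ℝ := (Matrix.of fun i j : Fin 2 => σ (bΓ i) (![e₁ τ, e₂ τ] j)).det with hK
  have hAτ : A τ ≠ 0 := (F.isCompl_iff_det_ne_zero bΔ hc hτ).1 hΓ
  have hAs : ContDiffAt ℝ ∞ A τ := by
    have hlin : ∀ j, ∀ a : ℝ → W, ContDiffOn ℝ ∞ a I →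
        ContDiffAt ℝ ∞ (fun t => bΔ.repr (Δ.projectionOnto Γ hc (a t)) j) τ := by
      intro j a ha
      have h1 : ContDiff ℝ ∞ (LinearMap.toContinuousLinearMap
        (bΔ.coord j ∘ₗ Δ.projectionOnto Γ hc)) := ContinuousLinearMap.contDiff _
      exact h1.contDiffAt.comp τ (ha.contDiffAt (F.isOpen.mem_nhds hτ))
    have h2 : A = fun t => bΔ.repr (Δ.projectionOnto Γ hc (e₁ t)) 0 *
        bΔ.repr (Δ.projectionOnto Γ hc (e₂ t)) 1 - bΔ.repr (Δ.projectionOnto Γ hc (e₁ t)) 1 *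
        bΔ.repr (Δ.projectionOnto Γ hc (e₂ t)) 0 := by
      funext t
      simp [hA, Matrix.det_fin_two]
    rw [h2]
    exact ((hlin 0 _ F.smooth₁).mul (hlin 1 _ F.smooth₂)).sub
      ((hlin 1 _ F.smooth₁).mul (hlin 0 _ F.smooth₂))
  have hAn : ∀ᶠ t in 𝓝 τ, t ∈ I ∧ A t ≠ 0 :=
    (eventually_mem_set.2 (F.isOpen.mem_nhds hτ)).and (hAs.continuousAt.eventually_ne hAτ)
  have hD : ∀ᶠ t in 𝓝 τ, pairDet σ e₁ e₂ t τ = A t *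
      (LinearMap.toMatrix bΔ bΓ (graphMap Δ (Λ t) Γ : Δ →ₗ[ℝ] Γ) -
        LinearMap.toMatrix bΔ bΓ (graphMap Δ (Λ τ) Γ : Δ →ₗ[ℝ] Γ)).det * K := by
    filter_upwards [hAn] with t ht
    exact F.pairDet_eq_det bΔ bΓ hc ht.1 hτ
      ((F.isCompl_iff_det_ne_zero bΔ hc ht.1).2 ht.2) hΓ
  -- If K were 0, D would vanish near τ, against its nonzero coefficient of degree 4.
  have hKn : K ≠ 0 := by
    intro hK0
    have h1 : taylorSeries (fun t => pairDet σ e₁ e₂ t τ) τ = taylorSeries (fun _ => 0) τ :=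
      taylorSeries_congr (by filter_upwards [hD] with t ht; rw [ht, hK0, mul_zero])
    rw [hd, taylorSeries_const, map_zero] at h1
    rcases mul_eq_zero.1 h1 with h2 | h2
    · exact pow_ne_zero 4 PowerSeries.X_ne_zero h2
    · exact hd0' (by rw [h2, map_zero])
  have hu : ContDiffAt ℝ ∞ (fun t => (A t)⁻¹ * K⁻¹) τ := (hAs.inv hAτ).mul contDiffAt_const
  refine eq_of_hasZeroOfOrder (d := d * taylorSeries (fun t => (A t)⁻¹ * K⁻¹) τ) hz ?_ ?_
  · rw [← mul_assoc, ← hd, ← taylorSeries_mul (F.contDiffAt_pairDet hτ τ) hu]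
    refine taylorSeries_congr ?_
    filter_upwards [hD, hAn] with t ht ht'
    rw [ht]
    have := ht'.2
    field_simp
  · rw [coeff_zero_mul', coeff_zero_taylorSeries]
    exact mul_ne_zero hd0' (mul_ne_zero (inv_ne_zero hAτ) (inv_ne_zero hKn))

end IsLagrangianFrame

end Weight

/-! ### Taylor expansion of the pairings through the invariants U and κ. -/

section Expansions

set_option linter.unusedSectionVars false

variable {W : Type*} [NormedAddCommGroup W] [NormedSpace ℝ W] [FiniteDimensional ℝ W]
  {σ : LinearMap.BilinForm ℝ W} {Λ : ℝ → Submodule ℝ W} {I : Set ℝ} {e₁ e₂ f₁ f₂ : ℝ → W}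
  {a₂₁ a₂₂ a₃₁ a₄₁ a₄₂ : ℝ → ℝ}

/-- The coefficient of `e₁` in the third derivative of `e₁`. -/
def thirdDerivCoeff (a₂₁ a₂₂ a₄₁ : ℝ → ℝ) (t : ℝ) : ℝ :=
  3 * deriv a₂₁ t + 3 * (a₂₁ t * a₂₂ t) + 12 * a₄₁ t

/-- The second order invariant of the fourth order equation satisfied by `e₁`. -/
def secondInvariant (a₂₁ a₂₂ a₄₂ : ℝ → ℝ) (t : ℝ) : ℝ :=
  -(deriv a₂₂ t + 6 * a₂₁ t + a₂₂ t ^ 2 + 4 * a₄₂ t)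

/-- The fourth order invariant of the fourth order equation satisfied by `e₁`. -/
def fourthInvariant (a₂₁ a₂₂ a₃₁ a₄₁ : ℝ → ℝ) (t : ℝ) : ℝ :=
  deriv (thirdDerivCoeff a₂₁ a₂₂ a₄₁) t - 9 * a₂₁ t ^ 2 - 36 * a₃₁ t

theorem HasStructureEquations.smooth_secondInvariant
    (hI : IsOpen I) {α m b : ℝ → ℝ}
    (S : HasStructureEquations I e₁ e₂ f₁ f₂ α m b a₂₁ a₂₂ a₃₁ a₄₁ a₄₂) :
    ContDiffOn ℝ ∞ (secondInvariant a₂₁ a₂₂ a₄₂) I :=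
  ((((S.smooth_a₂₂.deriv_of_isOpen hI (by simp)).add
    (contDiffOn_const.mul S.smooth_a₂₁)).add (S.smooth_a₂₂.pow 2)).add
    (contDiffOn_const.mul S.smooth_a₄₂)).neg

theorem HasStructureEquations.smooth_thirdDerivCoeff
    (hI : IsOpen I) {α m b : ℝ → ℝ}
    (S : HasStructureEquations I e₁ e₂ f₁ f₂ α m b a₂₁ a₂₂ a₃₁ a₄₁ a₄₂) :
    ContDiffOn ℝ ∞ (thirdDerivCoeff a₂₁ a₂₂ a₄₁) I :=
  ((contDiffOn_const.mul (S.smooth_a₂₁.deriv_of_isOpen hI (by simp))).add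
    (contDiffOn_const.mul (S.smooth_a₂₁.mul S.smooth_a₂₂))).add
    (contDiffOn_const.mul S.smooth_a₄₁)

theorem HasStructureEquations.smooth_fourthInvariant
    (hI : IsOpen I) {α m b : ℝ → ℝ}
    (S : HasStructureEquations I e₁ e₂ f₁ f₂ α m b a₂₁ a₂₂ a₃₁ a₄₁ a₄₂) :
    ContDiffOn ℝ ∞ (fourthInvariant a₂₁ a₂₂ a₃₁ a₄₁) I :=
  (((S.smooth_thirdDerivCoeff hI).deriv_of_isOpen hI (by simp)).sub
    (contDiffOn_const.mul (S.smooth_a₂₁.pow 2))).sub (contDiffOn_const.mul S.smooth_a₃₁)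

namespace IsLagrangianFrame

variable (F : IsLagrangianFrame σ Λ I e₁ e₂ f₁ f₂)
include F

variable (S : HasStructureEquations I e₁ e₂ f₁ f₂ (fun _ => 0) (fun _ => 3) (fun _ => 4)
  a₂₁ a₂₂ a₃₁ a₄₁ a₄₂)
include S

/-- Since e₂ = e₁′/3, pairings of e₂ are derivatives of those of e₁, and only e₁ has to be expanded.
-/
theorem coeff_pair_second_eq {τ : ℝ} (hτ : τ ∈ I) (w : W) (n : ℕ) :
    PowerSeries.coeff n (taylorSeries (fun t => σ (e₂ t) w) τ) =
      (n + 1) / 3 * PowerSeries.coeff (n + 1) (taylorSeries (fun t => σ (e₁ t) w) τ) := by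
  have h := F.coeff_succ_pair (a' := fun t => (3 : ℝ) • e₂ t) (fun t ht => by
    simpa using S.deriv_e₁ t ht) hτ w n
  have h2 : (fun t => σ ((3 : ℝ) • e₂ t) w) = fun t => 3 * σ (e₂ t) w := by
    funext t; simp
  rw [h2, taylorSeries_const_mul 3 (F.contDiffAt_left F.smooth₂ hτ w),
    PowerSeries.coeff_C_mul] at h
  rw [h]
  have : (n + 1 : ℝ) ≠ 0 := by positivity
  field_simp

/-- The Taylor coefficients of the pairings of the vectors of the frame in terms of the invariants
of the curve. -/
theorem coeff_pair_e₁ {τ : ℝ} (hτ : τ ∈ I) {U κ : ℝ → ℝ} (hU : U = secondInvariant a₂₁ a₂₂ a₄₂)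
    (hκ : κ = fourthInvariant a₂₁ a₂₂ a₃₁ a₄₁) :
    PowerSeries.coeff 3 (taylorSeries (fun t => σ (e₁ t) (e₁ τ)) τ) = -6 ∧
    PowerSeries.coeff 4 (taylorSeries (fun t => σ (e₁ t) (e₁ τ)) τ) = 0 ∧
    PowerSeries.coeff 5 (taylorSeries (fun t => σ (e₁ t) (e₁ τ)) τ) = 3 / 10 * U τ ∧
    PowerSeries.coeff 6 (taylorSeries (fun t => σ (e₁ t) (e₁ τ)) τ) = 3 / 20 * deriv U τ ∧
    PowerSeries.coeff 7 (taylorSeries (fun t => σ (e₁ t) (e₁ τ)) τ) =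
      (6 * deriv (deriv U) τ - U τ ^ 2 - κ τ) / 140 ∧
    PowerSeries.coeff 2 (taylorSeries (fun t => σ (e₁ t) (e₂ τ)) τ) = 6 ∧
    PowerSeries.coeff 3 (taylorSeries (fun t => σ (e₁ t) (e₂ τ)) τ) = 0 ∧
    PowerSeries.coeff 4 (taylorSeries (fun t => σ (e₁ t) (e₂ τ)) τ) = -(1 / 2) * U τ ∧
    PowerSeries.coeff 5 (taylorSeries (fun t => σ (e₁ t) (e₂ τ)) τ) = -(1 / 5) * deriv U τ ∧
    PowerSeries.coeff 6 (taylorSeries (fun t => σ (e₁ t) (e₂ τ)) τ) =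
      (-3 * deriv (deriv U) τ + U τ ^ 2 + κ τ) / 60 := by
  have hd := fun {x : ℝ → ℝ} (hx : ContDiffOn ℝ ∞ x I) =>
    hasDerivAt_deriv_of_contDiffOn F.isOpen hx
  have hds : ∀ {x : ℝ → ℝ}, ContDiffOn ℝ ∞ x I → ContDiffOn ℝ ∞ (deriv x) I := fun hx =>
    hx.deriv_of_isOpen F.isOpen (by simp)
  have hc : ∀ c : ℝ, ∀ t ∈ I, HasDerivAt (fun _ => c) ((fun _ : ℝ => (0 : ℝ)) t) t :=
    fun c t _ => hasDerivAt_const t c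
  have ha₂₁ := S.smooth_a₂₁
  have ha₂₂ := S.smooth_a₂₂
  have ha₃₁ := S.smooth_a₃₁
  have ha₄₁ := S.smooth_a₄₁
  have ha₄₂ := S.smooth_a₄₂
  have hUs : ContDiffOn ℝ ∞ U I := by rw [hU]; exact S.smooth_secondInvariant F.isOpen
  have hκs : ContDiffOn ℝ ∞ κ I := by rw [hκ]; exact S.smooth_fourthInvariant F.isOpen
  set x₃ := thirdDerivCoeff a₂₁ a₂₂ a₄₁ with hx₃
  have hx₃s : ContDiffOn ℝ ∞ x₃ I := S.smooth_thirdDerivCoeff F.isOpen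
  -- Trading a₂₂′ for U and x₃′ for κ makes the f-coordinates of the derivatives of e₁ up to order
  -- seven depend on U and κ alone; the other structural functions survive only in the
  -- e-coordinates.
  have hUt : ∀ t, deriv a₂₂ t = -U t - 6 * a₂₁ t - a₂₂ t ^ 2 - 4 * a₄₂ t := fun t => by
    rw [hU, secondInvariant]; ring
  have hκt : ∀ t, deriv x₃ t = κ t + 9 * a₂₁ t ^ 2 + 36 * a₃₁ t := fun t => by
    rw [hκ, fourthInvariant]; ring
  have hx₃t : ∀ t, x₃ t = 3 * deriv a₂₁ t + 3 * (a₂₁ t * a₂₂ t) + 12 * a₄₁ t := fun t => rfl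
  have h1 := S.hasDerivAt_comb (hc 1) (hc 0) (hc 0) (hc 0) (X := fun _ => 0) (Y := fun _ => 3)
    (U := fun _ => 0) (V := fun _ => 0)
    (by intros; ring) (by intros; ring) (by intros; ring) (by intros; ring)
  have h2 := S.hasDerivAt_comb (hc 0) (hc 3) (hc 0) (hc 0) (X := fun t => 3 * a₂₁ t)
    (Y := fun t => 3 * a₂₂ t) (U := fun _ => 0) (V := fun _ => 12)
    (by intros; ring) (by intros; ring) (by intros; ring) (by intros; ring)
  have h3 := S.hasDerivAt_comb (fun t ht => (hd ha₂₁ t ht).const_mul 3)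
    (fun t ht => (hd ha₂₂ t ht).const_mul 3) (hc 0) (hc 12) (X := x₃)
    (Y := fun t => -3 * U t - 9 * a₂₁ t) (U := fun _ => -36) (V := fun _ => 0)
    (by intros; rw [hx₃t]; ring) (by intro t _; rw [hUt t]; ring) (by intros; ring)
    (by intros; ring)
  have hx₄s : ContDiffOn ℝ ∞ (fun t => κ t - 3 * U t * a₂₁ t) I :=
    hκs.sub ((contDiffOn_const.mul hUs).mul ha₂₁)
  have h4 := S.hasDerivAt_comb (hd hx₃s)
    (fun t ht => ((hd hUs t ht).const_mul (-3)).fun_sub ((hd ha₂₁ t ht).const_mul 9))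
    (hc (-36)) (hc 0) (X := fun t => κ t - 3 * U t * a₂₁ t)
    (Y := fun t => -3 * deriv U t - 3 * U t * a₂₂ t)
    (U := fun _ => 0) (V := fun t => -12 * U t)
    (by intro t _; rw [hκt]; ring) (by intros; rw [hx₃t]; ring) (by intros; ring)
    (by intros; ring)
  have hy₄s : ContDiffOn ℝ ∞ (fun t => -3 * deriv U t - 3 * U t * a₂₂ t) I :=
    (contDiffOn_const.mul (hds hUs)).sub ((contDiffOn_const.mul hUs).mul ha₂₂)
  have hy₄d : ∀ t ∈ I, HasDerivAt (fun t => -3 * deriv U t - 3 * U t * a₂₂ t)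
      (-3 * deriv (deriv U) t - (3 * deriv U t * a₂₂ t + 3 * U t * deriv a₂₂ t)) t :=
    fun t ht => ((hd (hds hUs) t ht).const_mul (-3)).fun_sub
      (((hd hUs t ht).const_mul 3).fun_mul (hd ha₂₂ t ht))
  have h5 := S.hasDerivAt_comb (hd hx₄s) hy₄d (hc 0)
    (fun t ht => (hd hUs t ht).const_mul (-12))
    (X := fun t => deriv (fun t => κ t - 3 * U t * a₂₁ t) t +
      a₂₁ t * (-3 * deriv U t - 3 * U t * a₂₂ t) - 12 * a₄₁ t * U t)
    (Y := fun t => -3 * deriv (deriv U) t - 6 * deriv U t * a₂₂ t + 3 * U t ^ 2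
      + 9 * U t * a₂₁ t + 3 * κ t)
    (U := fun t => 36 * U t) (V := fun t => -24 * deriv U t)
    (by intros; ring) (by intro t _; rw [hUt t]; ring) (by intros; ring) (by intros; ring)
  have hx₅s : ContDiffOn ℝ ∞ (fun t => deriv (fun t => κ t - 3 * U t * a₂₁ t) t +
      a₂₁ t * (-3 * deriv U t - 3 * U t * a₂₂ t) - 12 * a₄₁ t * U t) I :=
    ((hds hx₄s).add (ha₂₁.mul hy₄s)).sub ((contDiffOn_const.mul ha₄₁).mul hUs)
  have hy₅s : ContDiffOn ℝ ∞ (fun t => -3 * deriv (deriv U) t - 6 * deriv U t * a₂₂ t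
      + 3 * U t ^ 2 + 9 * U t * a₂₁ t + 3 * κ t) I :=
    ((((contDiffOn_const.mul (hds (hds hUs))).sub
      ((contDiffOn_const.mul (hds hUs)).mul ha₂₂)).add (contDiffOn_const.mul (hUs.pow 2))).add
      ((contDiffOn_const.mul hUs).mul ha₂₁)).add (contDiffOn_const.mul hκs)
  set x₅ : ℝ → ℝ := fun t => deriv (fun t => κ t - 3 * U t * a₂₁ t) t +
      a₂₁ t * (-3 * deriv U t - 3 * U t * a₂₂ t) - 12 * a₄₁ t * U t with hx₅
  set y₅ : ℝ → ℝ := fun t => -3 * deriv (deriv U) t - 6 * deriv U t * a₂₂ t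
      + 3 * U t ^ 2 + 9 * U t * a₂₁ t + 3 * κ t with hy₅
  have h6 := S.hasDerivAt_comb (hd hx₅s) (hd hy₅s) (fun t ht => (hd hUs t ht).const_mul 36)
    (fun t ht => (hd (hds hUs) t ht).const_mul (-24))
    (X := fun t => deriv x₅ t + a₂₁ t * y₅ t + 36 * (a₃₁ t * U t) - 24 * (a₄₁ t * deriv U t))
    (Y := fun t => deriv y₅ t + 3 * x₅ t + a₂₂ t * y₅ t + 36 * (a₄₁ t * U t)
      - 24 * (a₄₂ t * deriv U t))
    (U := fun t => 108 * deriv U t)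
    (V := fun t => -36 * deriv (deriv U) t + 12 * U t ^ 2 + 12 * κ t)
    (by intros; ring) (by intros; ring) (by intros; ring)
    (by intros; simp only [hy₅]; ring)
  have hx₆s : ContDiffOn ℝ ∞ (fun t => deriv x₅ t + a₂₁ t * y₅ t + 36 * (a₃₁ t * U t)
      - 24 * (a₄₁ t * deriv U t)) I :=
    (((hds hx₅s).add (ha₂₁.mul hy₅s)).add (contDiffOn_const.mul (ha₃₁.mul hUs))).sub
      (contDiffOn_const.mul (ha₄₁.mul (hds hUs)))
  have hy₆s : ContDiffOn ℝ ∞ (fun t => deriv y₅ t + 3 * x₅ t + a₂₂ t * y₅ t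
      + 36 * (a₄₁ t * U t) - 24 * (a₄₂ t * deriv U t)) I :=
    ((((hds hy₅s).add (contDiffOn_const.mul hx₅s)).add (ha₂₂.mul hy₅s)).add
      (contDiffOn_const.mul (ha₄₁.mul hUs))).sub (contDiffOn_const.mul (ha₄₂.mul (hds hUs)))
  have hv₆s : ContDiffOn ℝ ∞ (fun t => -36 * deriv (deriv U) t + 12 * U t ^ 2 + 12 * κ t) I :=
    ((contDiffOn_const.mul (hds (hds hUs))).add (contDiffOn_const.mul (hUs.pow 2))).add
      (contDiffOn_const.mul hκs)
  have h7 := S.hasDerivAt_comb (hd hx₆s) (hd hy₆s)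
    (fun t ht => (hd (hds hUs) t ht).const_mul 108) (hd hv₆s)
    (U := fun t => 216 * deriv (deriv U) t - 36 * U t ^ 2 - 36 * κ t)
    (fun t _ => rfl) (fun t _ => rfl) (by intros; ring) (fun t _ => rfl)
  have e1 := F.coeff_succ_pair h1 hτ
  have e2 := F.coeff_succ_pair h2 hτ
  have e3 := F.coeff_succ_pair h3 hτ
  have e4 := F.coeff_succ_pair h4 hτ
  have e5 := F.coeff_succ_pair h5 hτ
  have e6 := F.coeff_succ_pair h6 hτ
  have e7 := F.coeff_succ_pair h7 hτ
  rw [comb_e₁] at e1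
  refine ⟨?_, ?_, ?_, ?_, ?_, ?_, ?_, ?_, ?_, ?_⟩
  · rw [e1, e2, e3, F.comb_pair_e₁ hτ]; norm_num
  · rw [e1, e2, e3, e4, F.comb_pair_e₁ hτ]; norm_num
  · rw [e1, e2, e3, e4, e5, F.comb_pair_e₁ hτ]; norm_num; ring
  · rw [e1, e2, e3, e4, e5, e6, F.comb_pair_e₁ hτ]; norm_num; ring
  · rw [e1, e2, e3, e4, e5, e6, e7, F.comb_pair_e₁ hτ]; norm_num; ring
  · rw [e1, e2, F.comb_pair_e₂ hτ]; norm_num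
  · rw [e1, e2, e3, F.comb_pair_e₂ hτ]; norm_num
  · rw [e1, e2, e3, e4, F.comb_pair_e₂ hτ]; norm_num; ring
  · rw [e1, e2, e3, e4, e5, F.comb_pair_e₂ hτ]; norm_num; ring
  · rw [e1, e2, e3, e4, e5, e6, F.comb_pair_e₂ hτ]; norm_num; ring

end IsLagrangianFrame

end Expansions

/-! ### Existence and second-order jet of the generating function. -/

section GeneratingFunction

set_option linter.unusedSectionVars false

theorem X_pow_mul_cancel {n : ℕ} {f g : PowerSeries ℝ}
    (h : PowerSeries.X ^ n * f = PowerSeries.X ^ n * g) : f = g :=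
  mul_left_cancel₀ (pow_ne_zero n PowerSeries.X_ne_zero) h

/-- The Taylor coefficients of the quotient by a power of the parameter. -/
theorem coeff_taylorSeries_quotient {I : Set ℝ} (hI : IsOpen I) {f k : ℝ × ℝ → ℝ} {n : ℕ}
    (hk : ContDiffOn ℝ ∞ k (I ×ˢ I))
    (h : ∀ x ∈ I, ∀ y ∈ I, f (x, y) = (x - y) ^ n * k (x, y)) {t : ℝ} (ht : t ∈ I) (j : ℕ) :
    PowerSeries.coeff j (taylorSeries (fun s => k (s, t)) t) =
      PowerSeries.coeff (j + n) (taylorSeries (fun s => f (s, t)) t) := by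
  have h1 : taylorSeries (fun s => f (s, t)) t =
      PowerSeries.X ^ n * taylorSeries (fun s => k (s, t)) t := by
    rw [← taylorSeries_sub_self (τ := t), ← taylorSeries_pow (by fun_prop),
      ← taylorSeries_mul (by fun_prop) (contDiffAt_slice hI hk ht ht)]
    refine taylorSeries_congr ?_
    filter_upwards [hI.mem_nhds ht] with s hs using h s hs t ht
  rw [h1, PowerSeries.coeff_X_pow_mul]

theorem IsGeneratingFunction.contDiffAt_right {W : Type*} [NormedAddCommGroup W]
    [NormedSpace ℝ W] [FiniteDimensional ℝ W] {Λ : ℝ → Submodule ℝ W} {J : Set ℝ} {k : ℕ}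
    {g : ℝ → ℝ → ℝ} (h : IsGeneratingFunction Λ J k g) {t : ℝ} (ht : t ∈ J) :
    ContDiffAt ℝ ∞ (Function.uncurry g) (t, t) := by
  obtain ⟨U, hU, hd, hs, -⟩ := h
  exact hs.contDiffAt (hU.mem_nhds (hd t ht))

theorem contDiffAt_uncurry_right {g : ℝ → ℝ → ℝ} {t : ℝ}
    (h : ContDiffAt ℝ ∞ (Function.uncurry g) (t, t)) : ContDiffAt ℝ ∞ (g t) t :=
  ContDiffAt.comp (f := fun s : ℝ => (t, s)) t h (by fun_prop)

variable {W : Type*} [NormedAddCommGroup W] [NormedSpace ℝ W] [FiniteDimensional ℝ W]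
  {σ : LinearMap.BilinForm ℝ W} {Λ : ℝ → Submodule ℝ W} {I : Set ℝ} {e₁ e₂ f₁ f₂ : ℝ → W}
  {a₂₁ a₂₂ a₃₁ a₄₁ a₄₂ : ℝ → ℝ}

namespace IsLagrangianFrame

variable (F : IsLagrangianFrame σ Λ I e₁ e₂ f₁ f₂)
  (S : HasStructureEquations I e₁ e₂ f₁ f₂ (fun _ => 0) (fun _ => 3) (fun _ => 4)
  a₂₁ a₂₂ a₃₁ a₄₁ a₄₂)
include F S

theorem crossTrace_eq_of_structure {t τ : ℝ} (ht : t ∈ I) (hτ : τ ∈ I)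
    (hD : pairDet σ e₁ e₂ t τ ≠ 0) :
    crossTrace Λ t τ = -16 * (σ (e₁ t) (e₁ τ) / pairDet σ e₁ e₂ t τ) ^ 2 :=
  F.crossTrace_eq (fun _ ht _ hv => F.pair_deriv_e₁ S ht hv)
    (fun _ ht _ hv => F.pair_deriv_e₂ S ht hv) ht hτ hD

/-- The Taylor series of the pairings of the frame vectors, divided by the powers of the parameter
to which they vanish. -/
theorem exists_coeff_pairDet {τ : ℝ} (hτ : τ ∈ I) {U κ : ℝ → ℝ}
    (hU : U = secondInvariant a₂₁ a₂₂ a₄₂) (hκ : κ = fourthInvariant a₂₁ a₂₂ a₃₁ a₄₁) :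
    ∃ p d : PowerSeries ℝ,
      taylorSeries (fun t => σ (e₁ t) (e₁ τ)) τ = PowerSeries.X ^ 3 * p ∧
      taylorSeries (fun t => pairDet σ e₁ e₂ t τ) τ = PowerSeries.X ^ 4 * d ∧
      PowerSeries.coeff 0 p = -6 ∧ PowerSeries.coeff 1 p = 0 ∧
      PowerSeries.coeff 2 p = 3 / 10 * U τ ∧ PowerSeries.coeff 3 p = 3 / 20 * deriv U τ ∧
      PowerSeries.coeff 4 p = (6 * deriv (deriv U) τ - U τ ^ 2 - κ τ) / 140 ∧
      PowerSeries.coeff 0 d = 12 ∧ PowerSeries.coeff 1 d = 0 ∧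
      PowerSeries.coeff 2 d = -(4 / 5) * U τ ∧ PowerSeries.coeff 3 d = -(2 / 5) * deriv U τ ∧
      PowerSeries.coeff 4 d = -(9 / 70) * deriv (deriv U) τ + 3 / 140 * U τ ^ 2 - κ τ / 35 := by
  obtain ⟨h11, h12, -, -, -, -⟩ := F.coeff_pair_first S hτ
  obtain ⟨h21, h22, -, -, -, -⟩ := F.coeff_pair_second S hτ
  obtain ⟨p, hp, hp'⟩ := exists_eq_X_pow_mul h11
  obtain ⟨q, hq, hq'⟩ := exists_eq_X_pow_mul h12
  obtain ⟨r, hr, hr'⟩ := exists_eq_X_pow_mul h21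
  obtain ⟨s, hs, hs'⟩ := exists_eq_X_pow_mul h22
  obtain ⟨c3, c4, c5, c6, c7, c2', c3', c4', c5', c6'⟩ := F.coeff_pair_e₁ S hτ hU hκ
  refine ⟨p, p * s - q * r, hp, ?_, ?_⟩
  · rw [F.taylorSeries_pairDet S hτ, hp, hq, hr, hs]; ring
  · simp only [coeff_zero_mul', coeff_one_mul', coeff_two_mul', coeff_three_mul',
      coeff_four_mul', map_sub, hp', hq', hr', hs', F.coeff_pair_second_eq S hτ, Nat.reduceAdd,
      c3, c4, c5, c6, c7, c2', c3', c4', c5', c6', true_and]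
    norm_num
    refine ⟨?_, ?_, ?_⟩ <;> ring

/-- The defining relation of g with denominators cleared. In this form it also holds at s = t, so
both sides can be expanded in Taylor series there. -/
theorem generating_relation {g : ℝ → ℝ → ℝ} {t s : ℝ} (ht : t ∈ I) (hs : s ∈ I)
    (h : t ≠ s → IsCompl (Λ t) (Λ s) ∧ crossTrace Λ t s = -((4 : ℕ) : ℝ) / (t - s) ^ 2 - g t s) :
    (4 + (s - t) ^ 2 * g t s) * pairDet σ e₁ e₂ s t ^ 2 =
      16 * ((s - t) ^ 2 * σ (e₁ s) (e₁ t) ^ 2) := by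
  rcases eq_or_ne t s with rfl | hne
  · simp [pairDet, F.alt.self_eq_zero, F.e₁e₂ t ht]
  · obtain ⟨h1, h2⟩ := h hne
    have hD := (F.isCompl_iff ht hs).1 h1
    rw [F.crossTrace_eq_of_structure S ht hs hD, F.pairDet_comm, F.swap] at h2
    rw [F.pairDet_comm] at hD
    have hne' : t - s ≠ 0 := sub_ne_zero.2 hne
    have hg : g t s = -4 / (t - s) ^ 2 + 16 * (-σ (e₁ s) (e₁ t) / pairDet σ e₁ e₂ s t) ^ 2 := by
      push_cast at h2; linarith
    have hst : (s - t) ^ 2 = (t - s) ^ 2 := by ring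
    rw [hg, hst]
    field_simp
    ring

/-- After a factor X⁸ is cancelled, `generating_relation` becomes (4 + X²G) d² = 16 p². As d has
constant term 12, it determines G degree by degree; degrees 2 to 4 suffice. -/
theorem coeff_generatingFunction {J : Set ℝ} {g : ℝ → ℝ → ℝ}
    (hg : IsGeneratingFunction Λ J 4 g) {τ : ℝ} (hτ : τ ∈ I) (hτJ : τ ∈ J) {U κ : ℝ → ℝ}
    (hU : U = secondInvariant a₂₁ a₂₂ a₄₂) (hκ : κ = fourthInvariant a₂₁ a₂₂ a₃₁ a₄₁) :
    PowerSeries.coeff 0 (taylorSeries (g τ) τ) = 2 / 15 * U τ ∧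
    PowerSeries.coeff 1 (taylorSeries (g τ) τ) = 1 / 15 * deriv U τ ∧
    PowerSeries.coeff 2 (taylorSeries (g τ) τ) =
      (deriv (deriv U) τ + κ τ) / 35 + 11 / 2100 * U τ ^ 2 := by
  obtain ⟨p, d, hp, hd, p0, p1, p2, p3, p4, d0, d1, d2, d3, d4⟩ :=
    F.exists_coeff_pairDet S hτ hU hκ
  have hgs := contDiffAt_uncurry_right (hg.contDiffAt_right hτJ)
  have hPs := F.contDiffAt_left F.smooth₁ hτ (e₁ τ)
  have hDs := F.contDiffAt_pairDet hτ τ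
  have hsub : ContDiffAt ℝ ∞ (fun s : ℝ => s - τ) τ := by fun_prop
  obtain ⟨O, hO, hdiag, -, hO'⟩ := hg
  have hev : ∀ᶠ s in 𝓝 τ, (τ, s) ∈ O :=
    ContinuousAt.preimage_mem_nhds (f := fun s : ℝ => (τ, s)) (by fun_prop)
      (hO.mem_nhds (hdiag τ hτJ))
  have key : taylorSeries (fun s => (4 + (s - τ) ^ 2 * g τ s) * pairDet σ e₁ e₂ s τ ^ 2) τ =
      taylorSeries (fun s => 16 * ((s - τ) ^ 2 * σ (e₁ s) (e₁ τ) ^ 2)) τ := by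
    refine taylorSeries_congr ?_
    filter_upwards [hev, F.isOpen.mem_nhds hτ] with s hs hsI
    exact F.generating_relation S hτ hsI fun hne => hO' τ s hs hne
  rw [taylorSeries_mul (contDiffAt_const.add ((hsub.pow 2).mul hgs)) (hDs.pow 2),
    taylorSeries_add contDiffAt_const ((hsub.pow 2).mul hgs), taylorSeries_mul (hsub.pow 2) hgs,
    taylorSeries_const_mul 16 ((hsub.pow 2).mul (hPs.pow 2)),
    taylorSeries_mul (hsub.pow 2) (hPs.pow 2),
    taylorSeries_pow hsub, taylorSeries_pow hDs, taylorSeries_pow hPs, taylorSeries_const,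
    taylorSeries_sub_self, hp, hd] at key
  set G := taylorSeries (g τ) τ
  have key2 : PowerSeries.C 4 * (d * d) + PowerSeries.X ^ 2 * (G * (d * d)) =
      PowerSeries.C 16 * (p * p) := by
    refine X_pow_mul_cancel (n := 8) ?_
    linear_combination key
  have c : ∀ n, 4 * PowerSeries.coeff (n + 2) (d * d) + PowerSeries.coeff n (G * (d * d)) =
      16 * PowerSeries.coeff (n + 2) (p * p) := fun n => by
    have := congrArg (PowerSeries.coeff (n + 2)) key2
    rwa [map_add, PowerSeries.coeff_C_mul, PowerSeries.coeff_C_mul,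
      PowerSeries.coeff_X_pow_mul] at this
  have c0 := c 0
  have c1 := c 1
  have c2 := c 2
  simp only [zero_add, Nat.reduceAdd, coeff_zero_mul', coeff_one_mul', coeff_two_mul',
    coeff_three_mul', coeff_four_mul', p0, p1, p2, p3, p4, d0, d1, d2, d3, d4] at c0 c1 c2
  have g0 : PowerSeries.coeff 0 G = 2 / 15 * U τ := by linarith
  have g1 : PowerSeries.coeff 1 G = 1 / 15 * deriv U τ := by rw [g0] at c1; linarith
  refine ⟨g0, g1, ?_⟩
  rw [g0, g1] at c2
  linarith

/-- Write P = (x−y)³ p and D = (x−y)⁴ d with smooth p, d. Then g must be (16p² − 4d²)/((x−y)² d²).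
The numerator vanishes to second order on the diagonal, since there p = −6, d = 12 and the first
coefficients are zero, so it is divisible by (x−y)². -/
theorem exists_generatingFunction : ∃ g, IsGeneratingFunction Λ I 4 g := by
  have hPs := contDiffOn_pair (σ := σ) F.smooth₁ F.smooth₁
  obtain ⟨p, hp, hpe⟩ := exists_eq_sub_pow_mul F.isOpen F.ordConnected 3 hPs
    fun t ht j hj => (F.coeff_pair_first S ht).1 j hj
  obtain ⟨d, hd, hde⟩ := exists_eq_sub_pow_mul F.isOpen F.ordConnected 4 F.contDiffOn_pairDet
    fun t ht j hj => by
      obtain ⟨d, hd, -⟩ := F.taylorSeries_pairDet_eq S ht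
      simp only [hd]
      rw [PowerSeries.coeff_X_pow_mul', if_neg (by omega)]
  have hcoef : ∀ t ∈ I, PowerSeries.coeff 0 (taylorSeries (fun s => p (s, t)) t) = -6 ∧
      PowerSeries.coeff 1 (taylorSeries (fun s => p (s, t)) t) = 0 ∧
      PowerSeries.coeff 0 (taylorSeries (fun s => d (s, t)) t) = 12 ∧
      PowerSeries.coeff 1 (taylorSeries (fun s => d (s, t)) t) = 0 := by
    intro t ht
    obtain ⟨p', d', hp', hd', p0, p1, -, -, -, d0, d1, -⟩ := F.exists_coeff_pairDet S ht rfl rfl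
    have hpc := coeff_taylorSeries_quotient F.isOpen (f := fun x => σ (e₁ x.1) (e₁ x.2)) hp hpe ht
    have hdc := coeff_taylorSeries_quotient F.isOpen (f := fun x => pairDet σ e₁ e₂ x.1 x.2)
      hd hde ht
    rw [hpc, hpc, hdc, hdc]
    simp only [hp', hd', PowerSeries.coeff_X_pow_mul]
    exact ⟨p0, p1, d0, d1⟩
  obtain ⟨n, hn, hne⟩ := exists_eq_sub_pow_mul F.isOpen F.ordConnected 2
    (f := fun x => 16 * (p x * p x) - 4 * (d x * d x))
    ((contDiffOn_const.mul (hp.mul hp)).sub (contDiffOn_const.mul (hd.mul hd)))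
    fun t ht j hj => by
      obtain ⟨p0, p1, d0, d1⟩ := hcoef t ht
      have hps := contDiffAt_slice F.isOpen hp ht ht
      have hds := contDiffAt_slice F.isOpen hd ht ht
      rw [taylorSeries_sub (contDiffAt_const.mul (hps.mul hps))
        (contDiffAt_const.mul (hds.mul hds)), taylorSeries_const_mul _ (hps.mul hps),
        taylorSeries_const_mul _ (hds.mul hds), taylorSeries_mul hps hps,
        taylorSeries_mul hds hds, map_sub, PowerSeries.coeff_C_mul, PowerSeries.coeff_C_mul]
      interval_cases j
      · rw [coeff_zero_mul', coeff_zero_mul', p0, d0]; norm_num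
      · rw [coeff_one_mul', coeff_one_mul', p0, d0, p1, d1]; norm_num
  have hII := F.isOpen.prod F.isOpen
  -- The domain of g omits the zeros of d; it contains the diagonal, where d = 12.
  have hopen : IsOpen ((I ×ˢ I) ∩ d ⁻¹' {0}ᶜ) :=
    hd.continuousOn.isOpen_inter_preimage hII isOpen_compl_singleton
  refine ⟨fun x y => n (x, y) / d (x, y) ^ 2, _, hopen, fun t ht => ⟨⟨ht, ht⟩, ?_⟩, ?_, ?_⟩
  · have h0 := (hcoef t ht).2.2.1
    rw [coeff_zero_taylorSeries] at h0
    simp [h0]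
  · exact (hn.mono Set.inter_subset_left).div ((hd.mono Set.inter_subset_left).pow 2)
      fun x hx => pow_ne_zero 2 hx.2
  · rintro x y ⟨⟨hx, hy⟩, hxy⟩ hne'
    have hxy' : x - y ≠ 0 := sub_ne_zero.2 hne'
    have hdne : d (x, y) ≠ 0 := hxy
    have hDe : pairDet σ e₁ e₂ x y = (x - y) ^ 4 * d (x, y) := hde x hx y hy
    have hD : pairDet σ e₁ e₂ x y ≠ 0 := by
      rw [hDe]; exact mul_ne_zero (pow_ne_zero 4 hxy') hdne
    refine ⟨(F.isCompl_iff hx hy).2 hD, ?_⟩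
    have hPe : σ (e₁ x) (e₁ y) = (x - y) ^ 3 * p (x, y) := hpe x hx y hy
    have hNe := hne x hx y hy
    rw [F.crossTrace_eq_of_structure S hx hy hD, hDe, hPe]
    push_cast
    field_simp
    linear_combination -hNe

end IsLagrangianFrame

end GeneratingFunction

/-! ### Taylor coefficients of compositions. -/

section Composition

variable {h ψ : ℝ → ℝ} {t : ℝ}

theorem coeff_one_taylorSeries_comp (hh : ContDiffAt ℝ ∞ h (ψ t)) (hψ : ContDiffAt ℝ ∞ ψ t) :
    PowerSeries.coeff 1 (taylorSeries (fun s => h (ψ s)) t) =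
      PowerSeries.coeff 1 (taylorSeries h (ψ t)) * PowerSeries.coeff 1 (taylorSeries ψ t) := by
  have h1 : deriv (fun s => h (ψ s)) t = deriv h (ψ t) * deriv ψ t :=
    ((hh.differentiableAt (by simp)).hasDerivAt.comp t
      (hψ.differentiableAt (by simp)).hasDerivAt).deriv
  rw [← zero_add 1, coeff_succ_taylorSeries, coeff_succ_taylorSeries, coeff_succ_taylorSeries,
    coeff_zero_taylorSeries, coeff_zero_taylorSeries, coeff_zero_taylorSeries, h1]
  simp

theorem coeff_two_taylorSeries_comp (hh : ContDiffAt ℝ ∞ h (ψ t)) (hψ : ContDiffAt ℝ ∞ ψ t) :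
    PowerSeries.coeff 2 (taylorSeries (fun s => h (ψ s)) t) =
      PowerSeries.coeff 2 (taylorSeries h (ψ t)) * PowerSeries.coeff 1 (taylorSeries ψ t) ^ 2 +
      PowerSeries.coeff 1 (taylorSeries h (ψ t)) * PowerSeries.coeff 2 (taylorSeries ψ t) := by
  have hh' : ContDiffAt ℝ ∞ (deriv h) (ψ t) := hh.derivWithin (by simp)
  have hψ' : ContDiffAt ℝ ∞ (deriv ψ) t := hψ.derivWithin (by simp)
  have h1 : deriv (fun s => h (ψ s)) =ᶠ[𝓝 t] fun s => deriv h (ψ s) * deriv ψ s := by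
    have h3 := (hh.of_le (m := 1) (by simp)).eventually (by simp)
    have h4 := (hψ.of_le (m := 1) (by simp)).eventually (by simp)
    filter_upwards [hψ.continuousAt.eventually h3, h4] with s h1 h2
    exact ((h1.differentiableAt (by simp)).hasDerivAt.comp s
      (h2.differentiableAt (by simp)).hasDerivAt).deriv
  have h2 := coeff_succ_taylorSeries (f := fun s => h (ψ s)) (τ := t) 1
  have h3 := coeff_succ_taylorSeries (f := h) (τ := ψ t) 0
  have h4 := coeff_succ_taylorSeries (f := h) (τ := ψ t) 1
  have h5 := coeff_succ_taylorSeries (f := ψ) (τ := t) 0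
  have h6 := coeff_succ_taylorSeries (f := ψ) (τ := t) 1
  rw [taylorSeries_congr h1, taylorSeries_mul (f := fun s => deriv h (ψ s)) (hh'.comp t hψ) hψ', coeff_one_mul',
    coeff_one_taylorSeries_comp hh' hψ, coeff_zero_taylorSeries] at h2
  rw [coeff_zero_taylorSeries] at h2 h3 h5
  simp only [Nat.cast_zero, Nat.cast_one, zero_add, div_one, one_add_one_eq_two] at h2 h3 h4 h5 h6
  rw [h2, h3, h4, h5, h6]
  ring

theorem taylorSeries_sub_const (hψ : ContDiffAt ℝ ∞ ψ t) :
    ∃ p : PowerSeries ℝ, taylorSeries (fun s => ψ s - ψ t) t = PowerSeries.X * p ∧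
      ∀ n, PowerSeries.coeff n p = PowerSeries.coeff (n + 1) (taylorSeries ψ t) := by
  refine ⟨PowerSeries.mk fun n => PowerSeries.coeff (n + 1) (taylorSeries ψ t), ?_, fun n => by
    rw [PowerSeries.coeff_mk]⟩
  rw [taylorSeries_sub hψ contDiffAt_const, taylorSeries_const]
  ext n
  cases n with
  | zero => rw [map_sub, coeff_zero_taylorSeries]; simp
  | succ n => simp

end Composition

/-! ### Power series algebra of a change of parameter. -/

section SeriesRelations

open PowerSeries

/-- The second coefficient of the generating function determines its zeroth one under a change
of parameter. -/
theorem coeff_zero_of_reparam {p G Γ q : PowerSeries ℝ} (hq : ∀ n, coeff n q = (n + 1) * coeff n p)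
    (h : (C 4 + X ^ 2 * G) * (p * p) = C (coeff 0 p) * (q * (C 4 + X ^ 2 * (p * p * Γ)))) :
    coeff 0 G * coeff 0 p ^ 2 = 4 * coeff 0 p * coeff 2 p - 4 * coeff 1 p ^ 2
      + coeff 0 p ^ 4 * coeff 0 Γ := by
  have h' : C 4 * (p * p) + X ^ 2 * (G * (p * p)) =
      C (coeff 0 p) * (C 4 * q + X ^ 2 * (q * (p * p * Γ))) := by linear_combination h
  have h2 := congrArg (coeff 2) h'
  have e : ∀ f : PowerSeries ℝ, coeff 2 (X ^ 2 * f) = coeff 0 f := fun f => by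
    simpa using coeff_X_pow_mul f 2 0
  simp only [map_add, coeff_C_mul, e, coeff_zero_mul', coeff_two_mul', hq] at h2
  generalize coeff 0 p = p₀ at *
  generalize coeff 0 G = G₀ at *
  generalize coeff 0 Γ = Γ₀ at *
  norm_num at h2
  linarith

/-- The transformation of the second Taylor coefficient of the generating function under a change
to a projective parameter. -/
theorem coeff_two_of_reparam {p G Γ q w z R : PowerSeries ℝ} {g₀ g₁ g₂ : ℝ}
    (hp : coeff 0 p ≠ 0) (hq : ∀ n, coeff n q = (n + 1) * coeff n p)
    (h : (C 4 + X ^ 2 * G) * (p * p) = C (coeff 0 p) * (q * (C 4 + X ^ 2 * (p * p * Γ))))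
    (hG : coeff 0 G = 0)
    (h0 : coeff 0 Γ = g₀) (h1 : coeff 1 Γ = g₁ * coeff 0 p)
    (h2 : coeff 2 Γ = g₂ * coeff 0 p ^ 2 + g₁ * coeff 1 p)
    (hw : ∀ n, coeff n w = (n + 1) * coeff (n + 1) q)
    (hz : ∀ n, coeff n z = (n + 1) * coeff (n + 1) w)
    (hR : C 3 * (w * w) - C 2 * (q * z) = C 3 * (q * q * (q * q) * R)) {r₂ : ℝ}
    (hR0 : coeff 0 R = g₀) (hR1 : coeff 1 R = 2 * g₁ * coeff 0 p)
    (hR2 : coeff 2 R = r₂ * coeff 0 p ^ 2 + 2 * g₁ * coeff 1 p) :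
    coeff 2 G = coeff 0 p ^ 4 * (g₂ - 3 / 20 * (g₀ ^ 2 + 2 * r₂)) := by
  -- In the application p is the series of (ψ(s) − ψ(t))/(s − t), the series q, w, z are those of
  -- ψ′, ψ″, ψ‴, while G, Γ, R stand for the new generating function, the old one along ψ, and ρ ∘
  -- ψ. The equation `hR` is the projectivity equation, and the factor 2 in `hR1` reflects that g₁
  -- is half of ρ′.
  have h' : C 4 * (p * p) + X ^ 2 * (G * (p * p)) =
      C (coeff 0 p) * (C 4 * q + X ^ 2 * (q * (p * p * Γ))) := by linear_combination h
  have e : ∀ (f : PowerSeries ℝ) n, coeff (n + 2) (X ^ 2 * f) = coeff n f := fun f n =>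
    coeff_X_pow_mul f 2 n
  have k3 := congrArg (coeff (1 + 2)) h'
  have k4 := congrArg (coeff (2 + 2)) h'
  have r0 := congrArg (coeff 0) hR
  have r1 := congrArg (coeff 1) hR
  have r2 := congrArg (coeff 2) hR
  simp only [map_sub, coeff_C_mul, coeff_zero_mul', coeff_one_mul', coeff_two_mul',
    hz, hw, hq, hR0, hR1, hR2] at r0 r1 r2
  simp only [map_add, coeff_C_mul, e] at k3 k4
  simp only [Nat.reduceAdd, coeff_zero_mul', coeff_one_mul', coeff_two_mul', coeff_three_mul',
    coeff_four_mul', hq, hG, h0, h1, h2] at k3 k4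
  generalize coeff 0 p = p₀ at *
  generalize coeff 1 p = p₁ at *
  generalize coeff 2 p = p₂ at *
  generalize coeff 3 p = p₃ at *
  generalize coeff 4 p = p₄ at *
  generalize coeff 1 G = G₁ at *
  generalize coeff 2 G = G₂ at *
  norm_num at k3 k4 r0 r1 r2
  -- Degrees 0, 1, 2 of the projectivity equation give p₂, p₃, p₄; degrees 3 and 4 of the main
  -- relation give G₁ and then G₂.
  have e2 : p₂ = (4 * p₁ ^ 2 - p₀ ^ 4 * g₀) / (4 * p₀) := by
    field_simp; linarith
  have e3 : p₃ = (8 * p₁ * p₂ - p₀ ^ 3 * (p₀ ^ 2 * g₁ + 4 * p₁ * g₀)) / (8 * p₀) := by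
    field_simp; linarith
  have e4 : p₄ = (48 * p₁ * p₃ + 72 * p₂ ^ 2 - 3 * p₀ ^ 6 * r₂ - 54 * p₀ ^ 4 * p₁ * g₁
      - 36 * p₀ ^ 3 * p₂ * g₀ - 72 * p₀ ^ 2 * p₁ ^ 2 * g₀) /
      (120 * p₀) := by
    field_simp; ring_nf at r2 ⊢; linarith
  have e5 : G₁ = (8 * p₀ * p₃ - 8 * p₁ * p₂ + p₀ ^ 5 * g₁ + 4 * p₀ ^ 3 * p₁ * g₀) / p₀ ^ 2 := by
    field_simp; linarith
  refine mul_right_cancel₀ (pow_ne_zero 2 hp) ?_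
  have e6 : G₂ * p₀ ^ 2 = 12 * p₀ * p₄ - 8 * p₁ * p₃ - 4 * p₂ ^ 2 - 2 * G₁ * p₀ * p₁
      + p₀ * (p₀ * (p₀ * p₀ * (g₂ * p₀ ^ 2 + g₁ * p₁) + (p₀ * p₁ + p₁ * p₀) * (g₁ * p₀) +
                (p₀ * p₂ + p₁ * p₁ + p₂ * p₀) * g₀) +
            2 * p₁ * (p₀ * p₀ * (g₁ * p₀) + (p₀ * p₁ + p₁ * p₀) * g₀) +
          3 * p₂ * (p₀ * p₀ * g₀)) := by linarith
  rw [e6, e5, e4, e3, e2]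
  field_simp
  ring

end SeriesRelations

/-! ### Generating functions under a change of parameter. -/

section Reparametrization

variable {W : Type*} [NormedAddCommGroup W] [NormedSpace ℝ W] [FiniteDimensional ℝ W]
  {σ : LinearMap.BilinForm ℝ W} {Λ : ℝ → Submodule ℝ W} {I V : Set ℝ} {e₁ e₂ f₁ f₂ : ℝ → W}
  {ψ : ℝ → ℝ} {g g' : ℝ → ℝ → ℝ}

namespace IsLagrangianFrame

variable (F : IsLagrangianFrame σ Λ I e₁ e₂ f₁ f₂)
include F

theorem ne_of_isCompl {t s : ℝ} (ht : t ∈ I) (h : IsCompl (Λ t) (Λ s)) : t ≠ s := by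
  rintro rfl
  refine (F.isCompl_iff ht ht).1 h ?_
  simp [pairDet, F.alt.self_eq_zero, F.e₁e₂ t ht]

/-- The Taylor series of the generating functions of a curve and of its reparametrization. -/
theorem taylorSeries_reparam (hg : IsGeneratingFunction Λ I 4 g) (hV : IsOpen V)
    (hmaps : Set.MapsTo ψ V I) (hψ : ContDiffOn ℝ ∞ ψ V)
    (hg' : IsGeneratingFunction (fun s => Λ (ψ s)) V 4 g') {t : ℝ} (ht : t ∈ V) :
    ∃ p : PowerSeries ℝ,
      (∀ n, PowerSeries.coeff n p = PowerSeries.coeff (n + 1) (taylorSeries ψ t)) ∧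
      (PowerSeries.C 4 + PowerSeries.X ^ 2 * taylorSeries (g' t) t) * (p * p) =
        PowerSeries.C (PowerSeries.coeff 0 p) * (taylorSeries (deriv ψ) t *
          (PowerSeries.C 4 + PowerSeries.X ^ 2 *
            (p * p * taylorSeries (fun s => g (ψ t) (ψ s)) t))) := by
  have hψt : ContDiffAt ℝ ∞ ψ t := hψ.contDiffAt (hV.mem_nhds ht)
  have hψ't : ContDiffAt ℝ ∞ (deriv ψ) t := hψt.derivWithin (by simp)
  obtain ⟨p, hp, hpc⟩ := taylorSeries_sub_const hψt
  have hgs := contDiffAt_uncurry_right (hg.contDiffAt_right (hmaps ht))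
  have hgs' := contDiffAt_uncurry_right (hg'.contDiffAt_right ht)
  have hgψ : ContDiffAt ℝ ∞ (fun s => g (ψ t) (ψ s)) t := hgs.comp t hψt
  have hsub : ContDiffAt ℝ ∞ (fun s : ℝ => s - t) t := by fun_prop
  have hψsub : ContDiffAt ℝ ∞ (fun s : ℝ => ψ s - ψ t) t := hψt.sub contDiffAt_const
  obtain ⟨O, hO, hdiag, -, hOeq⟩ := hg
  obtain ⟨O', hO', hdiag', -, hOeq'⟩ := hg'
  have hev' : ∀ᶠ s in 𝓝 t, (t, s) ∈ O' :=
    ContinuousAt.preimage_mem_nhds (f := fun s : ℝ => (t, s)) (by fun_prop)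
      (hO'.mem_nhds (hdiag' t ht))
  have hev : ∀ᶠ s in 𝓝 t, (ψ t, ψ s) ∈ O :=
    ContinuousAt.preimage_mem_nhds (f := fun s : ℝ => (ψ t, ψ s))
      (continuousAt_const.prodMk hψt.continuousAt) (hO.mem_nhds (hdiag _ (hmaps ht)))
  have hdiff : ∀ s ∈ V, DifferentiableAt ℝ ψ s := fun s hs =>
    (hψ.contDiffAt (hV.mem_nhds hs)).differentiableAt (by simp)
  -- The chain rule for the cross-ratio, multiplied by (s−t)²(ψ(s)−ψ(t))² to remove the poles.
  have key : taylorSeries (fun s => (4 + (s - t) ^ 2 * g' t s) * (ψ s - ψ t) ^ 2) t =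
      taylorSeries (fun s => (s - t) ^ 2 * (deriv ψ t * (deriv ψ s *
        (4 + (ψ s - ψ t) ^ 2 * g (ψ t) (ψ s))))) t := by
    refine taylorSeries_congr ?_
    filter_upwards [hev, hev', hV.mem_nhds ht] with s h1 h2 hs
    rcases eq_or_ne t s with rfl | hne
    · simp
    · obtain ⟨h3, h4⟩ := hOeq' t s h2 hne
      have h5 := F.ne_of_isCompl (hmaps ht) h3
      obtain ⟨h6, h7⟩ := hOeq _ _ h1 h5
      rw [F.crossTrace_comp (hmaps ht) (hmaps hs) (hdiff t ht) (hdiff s hs)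
        ((F.isCompl_iff (hmaps ht) (hmaps hs)).1 h3), h7] at h4
      have h8 : t - s ≠ 0 := sub_ne_zero.2 hne
      have h9 : ψ t - ψ s ≠ 0 := sub_ne_zero.2 h5
      have h10 : g' t s = -4 / (t - s) ^ 2 -
          deriv ψ t * deriv ψ s * (-4 / (ψ t - ψ s) ^ 2 - g (ψ t) (ψ s)) := by
        push_cast at h4; linarith
      have h11 : (s - t) ^ 2 = (t - s) ^ 2 := by ring
      have h12 : (ψ s - ψ t) ^ 2 = (ψ t - ψ s) ^ 2 := by ring
      rw [h10, h11, h12]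
      field_simp
      ring
  have h4 : ContDiffAt ℝ ∞ (fun s => 4 + (ψ s - ψ t) ^ 2 * g (ψ t) (ψ s)) t :=
    contDiffAt_const.add ((hψsub.pow 2).mul hgψ)
  rw [taylorSeries_mul (contDiffAt_const.add ((hsub.pow 2).mul hgs')) (hψsub.pow 2),
    taylorSeries_add contDiffAt_const ((hsub.pow 2).mul hgs'),
    taylorSeries_mul (hsub.pow 2) hgs',
    taylorSeries_mul (hsub.pow 2) (contDiffAt_const.mul (hψ't.mul h4)),
    taylorSeries_const_mul _ (hψ't.mul h4), taylorSeries_mul hψ't h4,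
    taylorSeries_add contDiffAt_const ((hψsub.pow 2).mul hgψ),
    taylorSeries_mul (hψsub.pow 2) hgψ,
    taylorSeries_pow hsub, taylorSeries_pow hψsub, taylorSeries_const,
    taylorSeries_sub_self, hp] at key
  refine ⟨p, hpc, X_pow_mul_cancel (n := 2) ?_⟩
  have hp0 : PowerSeries.coeff 0 p = deriv ψ t := by
    rw [hpc, coeff_succ_taylorSeries, coeff_zero_taylorSeries]; simp
  rw [hp0]
  linear_combination key

/-- A generating function exists in every regular parameter. -/
theorem exists_generatingFunction_comp (hg : IsGeneratingFunction Λ I 4 g) (hV : IsOpen V)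
    (hVc : V.OrdConnected) (hmaps : Set.MapsTo ψ V I) (hψ : ContDiffOn ℝ ∞ ψ V)
    (hψ0 : ∀ s ∈ V, deriv ψ s ≠ 0) :
    ∃ g', IsGeneratingFunction (fun s => Λ (ψ s)) V 4 g' := by
  obtain ⟨O, hO, hdiag, hgs, hOeq⟩ := hg
  have hfst : ContDiffOn ℝ ∞ (fun x : ℝ × ℝ => ψ x.1) (V ×ˢ V) :=
    hψ.comp contDiff_fst.contDiffOn fun x hx => hx.1
  have hsnd : ContDiffOn ℝ ∞ (fun x : ℝ × ℝ => ψ x.2) (V ×ˢ V) :=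
    hψ.comp contDiff_snd.contDiffOn fun x hx => hx.2
  have hψ' : ContDiffOn ℝ ∞ (deriv ψ) V := hψ.deriv_of_isOpen hV (by simp)
  have hfst' : ContDiffOn ℝ ∞ (fun x : ℝ × ℝ => deriv ψ x.1) (V ×ˢ V) :=
    hψ'.comp contDiff_fst.contDiffOn fun x hx => hx.1
  have hsnd' : ContDiffOn ℝ ∞ (fun x : ℝ × ℝ => deriv ψ x.2) (V ×ˢ V) :=
    hψ'.comp contDiff_snd.contDiffOn fun x hx => hx.2
  obtain ⟨q, hq, hqe⟩ := exists_eq_sub_pow_mul hV hVc 1 (hfst.sub hsnd) fun t ht j hj => by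
    obtain rfl : j = 0 := by omega
    rw [coeff_zero_taylorSeries]; simp
  have hcoef : ∀ t ∈ V, ∀ j, PowerSeries.coeff j (taylorSeries (fun s => q (s, t)) t) =
      PowerSeries.coeff (j + 1) (taylorSeries ψ t) := by
    intro t ht j
    rw [coeff_taylorSeries_quotient hV (f := fun x => ψ x.1 - ψ x.2) hq hqe ht]
    obtain ⟨p, hp, hpc⟩ := taylorSeries_sub_const (hψ.contDiffAt (hV.mem_nhds ht))
    simp only [hp, PowerSeries.coeff_succ_X_mul, hpc]
  have hq0 : ∀ t ∈ V, q (t, t) = deriv ψ t := by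
    intro t ht
    have := hcoef t ht 0
    rwa [coeff_succ_taylorSeries, coeff_zero_taylorSeries, coeff_zero_taylorSeries,
      Nat.cast_zero, zero_add, div_one] at this
  -- With q the divided difference of ψ, the double poles combine to 4(ψ′(x)ψ′(y) − q²)/((x−y)² q²).
  -- Its numerator vanishes to second order on the diagonal, so the singularity is removable.
  obtain ⟨n, hn, hne⟩ := exists_eq_sub_pow_mul hV hVc 2
    (f := fun x => deriv ψ x.1 * deriv ψ x.2 - q x * q x)
    ((hfst'.mul hsnd').sub (hq.mul hq)) fun t ht j hj => by
      have hqs := contDiffAt_slice hV hq ht ht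
      have hds : ContDiffAt ℝ ∞ (deriv ψ) t := hψ'.contDiffAt (hV.mem_nhds ht)
      change PowerSeries.coeff j (taylorSeries
        (fun s => deriv ψ s * deriv ψ t - q (s, t) * q (s, t)) t) = 0
      rw [taylorSeries_sub (hds.mul contDiffAt_const) (hqs.mul hqs),
        taylorSeries_mul hds contDiffAt_const, taylorSeries_mul hqs hqs, taylorSeries_const,
        map_sub, PowerSeries.coeff_mul_C, coeff_taylorSeries_deriv]
      have h1 : deriv ψ t = PowerSeries.coeff 1 (taylorSeries ψ t) := by
        rw [← zero_add 1, coeff_succ_taylorSeries, coeff_zero_taylorSeries]; simp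
      interval_cases j
      · rw [coeff_zero_mul', hcoef t ht, h1]; norm_num
      · rw [coeff_one_mul', hcoef t ht, hcoef t ht, h1]; norm_num; ring
  have hmapO : ContinuousOn (fun x : ℝ × ℝ => (ψ x.1, ψ x.2)) (V ×ˢ V) :=
    hfst.continuousOn.prodMk hsnd.continuousOn
  have hVV := hV.prod hV
  have hopen1 : IsOpen ((V ×ˢ V) ∩ q ⁻¹' {0}ᶜ) :=
    hq.continuousOn.isOpen_inter_preimage hVV isOpen_compl_singleton
  have hopen2 : IsOpen ((V ×ˢ V) ∩ (fun x : ℝ × ℝ => (ψ x.1, ψ x.2)) ⁻¹' O) :=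
    hmapO.isOpen_inter_preimage hVV hO
  refine ⟨fun x y => 4 * n (x, y) / q (x, y) ^ 2 + deriv ψ x * deriv ψ y * g (ψ x) (ψ y), _,
    hopen1.inter hopen2, fun t ht => ⟨⟨⟨ht, ht⟩, ?_⟩, ⟨ht, ht⟩, hdiag _ (hmaps ht)⟩, ?_, ?_⟩
  · simp [hq0 t ht, hψ0 t ht]
  · have hsub1 : ((V ×ˢ V) ∩ q ⁻¹' {0}ᶜ) ∩
        ((V ×ˢ V) ∩ (fun x : ℝ × ℝ => (ψ x.1, ψ x.2)) ⁻¹' O) ⊆ V ×ˢ V := fun x hx => hx.1.1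
    exact ((contDiffOn_const.mul (hn.mono hsub1)).div ((hq.mono hsub1).pow 2)
      fun x hx => pow_ne_zero 2 hx.1.2).add (((hfst'.mul hsnd').mono hsub1).mul
      (hgs.comp ((hfst.prodMk hsnd).mono hsub1) fun x hx => hx.2.2))
  · rintro x y ⟨⟨⟨hx, hy⟩, hxy⟩, -, hxyO⟩ hne'
    have hxy' : x - y ≠ 0 := sub_ne_zero.2 hne'
    have hqne : q (x, y) ≠ 0 := hxy
    have hqe' : ψ x - ψ y = (x - y) ^ 1 * q (x, y) := hqe x hx y hy
    rw [pow_one] at hqe'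
    have hψne : ψ x ≠ ψ y := sub_ne_zero.1 (by rw [hqe']; exact mul_ne_zero hxy' hqne)
    obtain ⟨h1, h2⟩ := hOeq _ _ hxyO hψne
    have hdiff : ∀ s ∈ V, DifferentiableAt ℝ ψ s := fun s hs =>
      (hψ.contDiffAt (hV.mem_nhds hs)).differentiableAt (by simp)
    refine ⟨h1, ?_⟩
    have hNe : deriv ψ x * deriv ψ y - q (x, y) * q (x, y) = (x - y) ^ 2 * n (x, y) :=
      hne x hx y hy
    rw [F.crossTrace_comp (hmaps hx) (hmaps hy) (hdiff x hx) (hdiff y hy)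
        ((F.isCompl_iff (hmaps hx) (hmaps hy)).1 h1), h2, hqe']
    push_cast
    field_simp
    linear_combination (-4) * hNe

end IsLagrangianFrame

end Reparametrization

/-! ### The third-order equation for projective parameters. -/

section ProjectiveParameters

/-- Smoothness of the integral curves of a smooth vector field. -/
theorem contDiffOn_of_hasDerivAt {E : Type*} [NormedAddCommGroup E] [NormedSpace ℝ E]
    {v : E → E} {O : Set E} {α : ℝ → E} {V : Set ℝ} (hv : ContDiffOn ℝ ∞ v O) (hV : IsOpen V)
    (hα : ∀ s ∈ V, HasDerivAt α (v (α s)) s) (hmaps : Set.MapsTo α V O) :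
    ContDiffOn ℝ ∞ α V := by
  rw [contDiffOn_infty]
  intro n
  induction n with
  | zero =>
    rw [Nat.cast_zero, contDiffOn_zero]
    exact fun s hs => (hα s hs).continuousAt.continuousWithinAt
  | succ n ih =>
    push_cast
    rw [contDiffOn_succ_iff_deriv_of_isOpen hV]
    refine ⟨fun s hs => (hα s hs).differentiableAt.differentiableWithinAt, by simp, ?_⟩
    exact ((hv.of_le (by exact_mod_cast le_top)).comp ih hmaps).congr fun s hs => (hα s hs).deriv

/-- Local solvability of the Schwarzian equation for projective parameters. -/
theorem exists_schwarzian_solution {I : Set ℝ} (hI : IsOpen I) {ρ : ℝ → ℝ}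
    (hρ : ContDiffOn ℝ ∞ ρ I) {t : ℝ} (ht : t ∈ I) :
    ∃ (ψ : ℝ → ℝ) (V : Set ℝ), IsOpen V ∧ V.OrdConnected ∧ (0 : ℝ) ∈ V ∧ ψ 0 = t ∧
      Set.MapsTo ψ V I ∧ ContDiffOn ℝ ∞ ψ V ∧ (∀ s ∈ V, deriv ψ s ≠ 0) ∧
      ∀ s ∈ V, 3 * deriv (deriv ψ) s ^ 2 - 2 * (deriv ψ s * deriv (deriv (deriv ψ)) s) =
        3 * (deriv ψ s ^ 4 * ρ (ψ s)) := by
  set O : Set (ℝ × ℝ × ℝ) := {x | x.1 ∈ I ∧ x.2.1 ≠ 0} with hOdef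
  have hO : IsOpen O := (hI.preimage continuous_fst).inter
    (isOpen_ne.preimage (continuous_fst.comp continuous_snd))
  -- The equation solved for ψ‴, as a first-order system for (ψ, ψ′, ψ″); the initial value (t, 1,
  -- 0) keeps ψ′ away from zero nearby.
  set v : ℝ × ℝ × ℝ → ℝ × ℝ × ℝ := fun x =>
    (x.2.1, x.2.2, 3 / 2 * (x.2.2 ^ 2 / x.2.1 - x.2.1 ^ 3 * ρ x.1)) with hvdef
  have hv : ContDiffOn ℝ ∞ v O := by
    have h1 : ContDiffOn ℝ ∞ (fun x : ℝ × ℝ × ℝ => x.2.1) O := by fun_prop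
    have h2 : ContDiffOn ℝ ∞ (fun x : ℝ × ℝ × ℝ => x.2.2) O := by fun_prop
    have h3 : ContDiffOn ℝ ∞ (fun x : ℝ × ℝ × ℝ => ρ x.1) O :=
      hρ.comp contDiff_fst.contDiffOn fun x hx => hx.1
    exact h1.prodMk (h2.prodMk (contDiffOn_const.mul
      (((h2.pow 2).div h1 fun x hx => hx.2).sub ((h1.pow 3).mul h3))))
  have h0 : ((t, 1, 0) : ℝ × ℝ × ℝ) ∈ O := ⟨ht, one_ne_zero⟩
  obtain ⟨α, hα0, ε, hε, hα⟩ :=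
    ((hv.contDiffAt (hO.mem_nhds h0)).of_le (m := 1) (by
      simp)).exists_forall_mem_closedBall_exists_eq_forall_mem_Ioo_hasDerivAt₀ 0
  have hc : ContinuousAt α 0 := (hα 0 (by constructor <;> linarith)).continuousAt
  have hnear : ∀ᶠ s in 𝓝 (0 : ℝ), α s ∈ O := hc.preimage_mem_nhds (hO.mem_nhds (by rwa [hα0]))
  obtain ⟨δ, hδ, hδO⟩ := Metric.eventually_nhds_iff_ball.1 hnear
  set V : Set ℝ := Set.Ioo (0 - ε) (0 + ε) ∩ Metric.ball 0 δ with hVdef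
  have hV : IsOpen V := isOpen_Ioo.inter Metric.isOpen_ball
  have hαV : ∀ s ∈ V, HasDerivAt α (v (α s)) s := fun s hs => hα s hs.1
  have hVO : Set.MapsTo α V O := fun s hs => hδO s hs.2
  have hαs := contDiffOn_of_hasDerivAt hv hV hαV hVO
  have hd1' : ∀ s ∈ V, HasDerivAt (fun s => (α s).1) (α s).2.1 s := fun s hs =>
    (ContinuousLinearMap.fst ℝ ℝ (ℝ × ℝ)).hasFDerivAt.comp_hasDerivAt s (hαV s hs)
  have hd' : ∀ s ∈ V, HasDerivAt (fun s => (α s).2) (v (α s)).2 s := fun s hs =>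
    (ContinuousLinearMap.snd ℝ ℝ (ℝ × ℝ)).hasFDerivAt.comp_hasDerivAt s (hαV s hs)
  have hd2' : ∀ s ∈ V, HasDerivAt (fun s => (α s).2.1) (α s).2.2 s := fun s hs =>
    (ContinuousLinearMap.fst ℝ ℝ ℝ).hasFDerivAt.comp_hasDerivAt s (hd' s hs)
  have hd3' : ∀ s ∈ V, HasDerivAt (fun s => (α s).2.2)
      (3 / 2 * ((α s).2.2 ^ 2 / (α s).2.1 - (α s).2.1 ^ 3 * ρ (α s).1)) s := fun s hs =>
    (ContinuousLinearMap.snd ℝ ℝ ℝ).hasFDerivAt.comp_hasDerivAt s (hd' s hs)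
  have hd1 : ∀ s ∈ V, deriv (fun s => (α s).1) s = (α s).2.1 := fun s hs => (hd1' s hs).deriv
  have hd2 : ∀ s ∈ V, deriv (deriv fun s => (α s).1) s = (α s).2.2 := fun s hs => by
    rw [(show deriv (fun s => (α s).1) =ᶠ[𝓝 s] fun s => (α s).2.1 from by
      filter_upwards [hV.mem_nhds hs] with r hr using hd1 r hr).deriv_eq, (hd2' s hs).deriv]
  have hd3 : ∀ s ∈ V, deriv (deriv (deriv fun s => (α s).1)) s =
      3 / 2 * ((α s).2.2 ^ 2 / (α s).2.1 - (α s).2.1 ^ 3 * ρ (α s).1) := fun s hs => by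
    rw [(show deriv (deriv (fun s => (α s).1)) =ᶠ[𝓝 s] fun s => (α s).2.2 from by
      filter_upwards [hV.mem_nhds hs] with r hr using hd2 r hr).deriv_eq, (hd3' s hs).deriv]
  refine ⟨fun s => (α s).1, V, hV, ?_, ⟨by constructor <;> linarith, Metric.mem_ball_self hδ⟩,
    by simp [hα0], fun s hs => (hVO hs).1, contDiff_fst.comp_contDiffOn hαs, fun s hs => ?_,
    fun s hs => ?_⟩
  · refine Set.OrdConnected.inter Set.ordConnected_Ioo ?_
    rw [Real.ball_eq_Ioo]; exact Set.ordConnected_Ioo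
  · rw [hd1 s hs]; exact (hVO hs).2
  · have hne : (α s).2.1 ≠ 0 := (hVO hs).2
    rw [hd1 s hs, hd2 s hs, hd3 s hs]
    field_simp
    ring

end ProjectiveParameters

/-! ### Transformation rules and the final formulas. -/

section Invariants

variable {W : Type*} [NormedAddCommGroup W] [NormedSpace ℝ W] [FiniteDimensional ℝ W]
  {σ : LinearMap.BilinForm ℝ W} {Λ : ℝ → Submodule ℝ W} {I V : Set ℝ} {e₁ e₂ f₁ f₂ : ℝ → W}
  {a₂₁ a₂₂ a₃₁ a₄₁ a₄₂ ψ : ℝ → ℝ} {g g' : ℝ → ℝ → ℝ}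

theorem isGeneratingFunction_empty (Λ : ℝ → Submodule ℝ W) (k : ℕ) (g : ℝ → ℝ → ℝ) :
    IsGeneratingFunction Λ ∅ k g :=
  ⟨∅, isOpen_empty, by simp, by simp, by simp⟩

theorem coeff_taylorSeries_deriv_eq (t : ℝ) :
    PowerSeries.coeff 0 (taylorSeries ψ t) = ψ t ∧
    PowerSeries.coeff 1 (taylorSeries ψ t) = deriv ψ t ∧
    PowerSeries.coeff 2 (taylorSeries ψ t) = deriv (deriv ψ) t / 2 ∧
    PowerSeries.coeff 3 (taylorSeries ψ t) = deriv (deriv (deriv ψ)) t / 6 := by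
  have h := fun {f : ℝ → ℝ} n => coeff_succ_taylorSeries (f := f) (τ := t) n
  refine ⟨coeff_zero_taylorSeries, ?_, ?_, ?_⟩
  · rw [← zero_add 1, h, coeff_zero_taylorSeries]; simp
  · rw [show 2 = 0 + 1 + 1 from rfl, h, h, coeff_zero_taylorSeries]; norm_num
  · rw [show 3 = 0 + 1 + 1 + 1 from rfl, h, h, h, coeff_zero_taylorSeries]; norm_num; ring

namespace IsLagrangianFrame

variable (F : IsLagrangianFrame σ Λ I e₁ e₂ f₁ f₂)
include F

/-- The transformation rule of the Ricci curvature. -/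
theorem ricci_reparam (hg : IsGeneratingFunction Λ I 4 g) (hV : IsOpen V)
    (hmaps : Set.MapsTo ψ V I) (hψ : ContDiffOn ℝ ∞ ψ V)
    (hg' : IsGeneratingFunction (fun s => Λ (ψ s)) V 4 g') {t : ℝ} (ht : t ∈ V) :
    3 * (g' t t * deriv ψ t ^ 2) = 2 * (deriv ψ t * deriv (deriv (deriv ψ)) t)
      - 3 * deriv (deriv ψ) t ^ 2 + 3 * (deriv ψ t ^ 4 * g (ψ t) (ψ t)) := by
  obtain ⟨p, hpc, hrel⟩ := F.taylorSeries_reparam hg hV hmaps hψ hg' ht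
  obtain ⟨-, h1, h2, h3⟩ := coeff_taylorSeries_deriv_eq (ψ := ψ) t
  have h := coeff_zero_of_reparam (fun n => by rw [coeff_taylorSeries_deriv, hpc]) hrel
  rw [coeff_zero_taylorSeries, coeff_zero_taylorSeries, hpc, hpc, hpc, zero_add, h1, h2, h3] at h
  linarith

/-- The Schwarzian equation is precisely the vanishing of the right-hand side of `ricci_reparam`,
and ψ′ ≠ 0 then makes the new Ricci curvature zero. -/
theorem exists_projectiveParameter (hg : IsGeneratingFunction Λ I 4 g)
    (hρ : ContDiffOn ℝ ∞ (fun t => g t t) I) {t : ℝ} (ht : t ∈ I) :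
    ∃ (ψ : ℝ → ℝ) (V : Set ℝ) (g' : ℝ → ℝ → ℝ),
      IsProjectiveParameter Λ I 4 ψ V g' ∧ 0 ∈ V ∧ ψ 0 = t := by
  obtain ⟨ψ, V, hV, hVc, h0, hψt, hmaps, hψ, hψ0, hode⟩ := exists_schwarzian_solution F.isOpen hρ ht
  obtain ⟨g', hg'⟩ := F.exists_generatingFunction_comp hg hV hVc hmaps hψ hψ0
  refine ⟨ψ, V, g', ⟨hV, hVc, hmaps, hψ, hψ0, hg', fun s hs => ?_⟩, h0, hψt⟩
  have h1 := F.ricci_reparam hg hV hmaps hψ hg' hs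
  have h2 := hode s hs
  have h3 : g' s s * deriv ψ s ^ 2 = 0 := by linarith
  exact (mul_eq_zero.1 h3).resolve_right (pow_ne_zero 2 (hψ0 s hs))

/-- The coefficient of the fundamental form in terms of the generating function in an arbitrary
parameter. -/
theorem fundamentalForm_reparam (hg : IsGeneratingFunction Λ I 4 g) {ρ : ℝ → ℝ}
    (hρ : ContDiffOn ℝ ∞ ρ I) (hgρ : ∀ t ∈ I, g t t = ρ t)
    (hg1 : ∀ t ∈ I, PowerSeries.coeff 1 (taylorSeries (g t) t) = deriv ρ t / 2)
    (hψ : IsProjectiveParameter Λ I 4 ψ V g') {s : ℝ} (hs : s ∈ V) :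
    1 / 2 * iteratedDeriv 2 (fun s₁ => g' s s₁) s = deriv ψ s ^ 4 *
      (PowerSeries.coeff 2 (taylorSeries (g (ψ s)) (ψ s)) -
        3 / 20 * (ρ (ψ s) ^ 2 + deriv (deriv ρ) (ψ s))) := by
  have hV := hψ.isOpen
  have hψs : ContDiffAt ℝ ∞ ψ s := hψ.contDiffOn.contDiffAt (hV.mem_nhds hs)
  have hψ's : ContDiffAt ℝ ∞ (deriv ψ) s := hψs.derivWithin (by simp)
  have hψ''s : ContDiffAt ℝ ∞ (deriv (deriv ψ)) s := hψ's.derivWithin (by simp)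
  have hψ'''s : ContDiffAt ℝ ∞ (deriv (deriv (deriv ψ))) s := hψ''s.derivWithin (by simp)
  have hI := hψ.mapsTo hs
  have hρs : ContDiffAt ℝ ∞ ρ (ψ s) := hρ.contDiffAt (F.isOpen.mem_nhds hI)
  have hρψ : ContDiffAt ℝ ∞ (fun s => ρ (ψ s)) s := hρs.comp s hψs
  have hgs := contDiffAt_uncurry_right (hg.contDiffAt_right hI)
  obtain ⟨p, hpc, hrel⟩ := F.taylorSeries_reparam hg hV hψ.mapsTo hψ.contDiffOn
    hψ.isGeneratingFunction hs
  obtain ⟨-, hp1, hp2, -⟩ := coeff_taylorSeries_deriv_eq (ψ := ψ) s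
  obtain ⟨-, hr1, hr2, -⟩ := coeff_taylorSeries_deriv_eq (ψ := ρ) (ψ s)
  -- In a projective parameter the transformation rule of ρ holds with zero left-hand side on all of
  -- V, so it may be used as an identity of Taylor series, not only of values at s.
  have hode : taylorSeries (fun s => 3 * (deriv (deriv ψ) s * deriv (deriv ψ) s)
      - 2 * (deriv ψ s * deriv (deriv (deriv ψ)) s)) s =
      taylorSeries (fun s => 3 * ((deriv ψ s * deriv ψ s) * (deriv ψ s * deriv ψ s)
        * ρ (ψ s))) s := by
    refine taylorSeries_congr ?_
    filter_upwards [hV.mem_nhds hs] with r hr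
    have h := F.ricci_reparam hg hV hψ.mapsTo hψ.contDiffOn hψ.isGeneratingFunction hr
    rw [hψ.ricci_eq_zero r hr, hgρ _ (hψ.mapsTo hr)] at h
    linarith
  have hsq := hψ's.mul hψ's
  rw [taylorSeries_sub (contDiffAt_const.mul (hψ''s.mul hψ''s))
      (contDiffAt_const.mul (hψ's.mul hψ'''s)),
    taylorSeries_const_mul _ (hψ''s.mul hψ''s), taylorSeries_const_mul _ (hψ's.mul hψ'''s),
    taylorSeries_mul hψ''s hψ''s, taylorSeries_mul hψ's hψ'''s,
    taylorSeries_const_mul _ ((hsq.mul hsq).mul hρψ), taylorSeries_mul (hsq.mul hsq) hρψ,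
    taylorSeries_mul hsq hsq, taylorSeries_mul hψ's hψ's] at hode
  have hp0 : PowerSeries.coeff 0 p = deriv ψ s := by rw [hpc, zero_add, hp1]
  have h2 := coeff_two_of_reparam (g₀ := ρ (ψ s)) (g₁ := deriv ρ (ψ s) / 2)
    (g₂ := PowerSeries.coeff 2 (taylorSeries (g (ψ s)) (ψ s)))
    (r₂ := deriv (deriv ρ) (ψ s) / 2)
    (by rw [hp0]; exact hψ.deriv_ne_zero s hs)
    (fun n => by rw [coeff_taylorSeries_deriv, hpc]) hrel
    (by rw [coeff_zero_taylorSeries, hψ.ricci_eq_zero s hs])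
    (by rw [coeff_zero_taylorSeries, hgρ _ hI])
    (by rw [coeff_one_taylorSeries_comp hgs hψs, hg1 _ hI, hpc])
    (by rw [coeff_two_taylorSeries_comp hgs hψs, hg1 _ hI, hpc, hpc])
    coeff_taylorSeries_deriv coeff_taylorSeries_deriv hode
    coeff_zero_taylorSeries
    (by rw [coeff_one_taylorSeries_comp hρs hψs, hr1, hpc]; ring)
    (by rw [coeff_two_taylorSeries_comp hρs hψs, hr1, hr2, hpc, hpc]; ring)
  rw [coeff_taylorSeries, hp0] at h2
  rw [show ((2 : ℕ).factorial : ℝ) = 2 by norm_num [Nat.factorial]] at h2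
  linear_combination h2

variable (S : HasStructureEquations I e₁ e₂ f₁ f₂ (fun _ => 0) (fun _ => 3) (fun _ => 4)
  a₂₁ a₂₂ a₃₁ a₄₁ a₄₂)
include S

theorem ricci_eq {ρ : ℝ → ℝ} (hρ : IsRicciCurvature Λ I 4 ρ) {t : ℝ} (ht : t ∈ I) :
    ρ t = 2 / 15 * secondInvariant a₂₁ a₂₂ a₄₂ t := by
  obtain ⟨g, hg, hgρ⟩ := hρ
  rw [hgρ t ht, ← (F.coeff_generatingFunction S hg ht ht rfl rfl).1, coeff_zero_taylorSeries]

/-- The jet of g is inserted into g₂ − (3/20)(ρ² + ρ″) with ρ = (2/15)U: the coefficients are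
11/2100 − 1/375 = 9/3500 and 1/35 − 1/50 = 3/350. -/
theorem fundamentalForm_eq (hg : IsGeneratingFunction Λ I 4 g)
    (hψ : IsProjectiveParameter Λ I 4 ψ V g') {s : ℝ} (hs : s ∈ V) :
    1 / 2 * iteratedDeriv 2 (fun s₁ => g' s s₁) s = deriv ψ s ^ 4 *
      (fourthInvariant a₂₁ a₂₂ a₃₁ a₄₁ (ψ s) / 35 +
        9 / 3500 * secondInvariant a₂₁ a₂₂ a₄₂ (ψ s) ^ 2 +
        3 / 350 * deriv (deriv (secondInvariant a₂₁ a₂₂ a₄₂)) (ψ s)) := by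
  have hU := S.smooth_secondInvariant F.isOpen
  set U := secondInvariant a₂₁ a₂₂ a₄₂ with hUdef
  have hd1 : deriv (fun t => 2 / 15 * U t) = fun t => 2 / 15 * deriv U t := by
    funext t; exact deriv_const_mul_field _
  have hd2 : deriv (fun t => 2 / 15 * deriv U t) = fun t => 2 / 15 * deriv (deriv U) t := by
    funext t; exact deriv_const_mul_field _
  have hc := fun t (ht : t ∈ I) => F.coeff_generatingFunction S hg ht ht hUdef rfl
  rw [F.fundamentalForm_reparam hg (ρ := fun t => 2 / 15 * U t) (contDiffOn_const.mul hU)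
    (fun t ht => by rw [← (hc t ht).1, coeff_zero_taylorSeries])
    (fun t ht => by rw [(hc t ht).2.1, hd1]; ring) hψ hs, (hc _ (hψ.mapsTo hs)).2.2, hd1, hd2]
  ring

/-- Whichever projective parameter witnesses the definition, the factor ψ′⁴ cancels, so the density
does not depend on the choice. -/
theorem density_eq {A : ℝ → ℝ} (hA : IsFundamentalDensity Λ I 4 A) {t : ℝ} (ht : t ∈ I) :
    A t = fourthInvariant a₂₁ a₂₂ a₃₁ a₄₁ t / 35 +
      9 / 3500 * secondInvariant a₂₁ a₂₂ a₄₂ t ^ 2 +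
      3 / 350 * deriv (deriv (secondInvariant a₂₁ a₂₂ a₄₂)) t := by
  obtain ⟨g, hg⟩ := F.exists_generatingFunction S
  obtain ⟨ψ, V, g', s, hψ, hs, rfl, hAs⟩ := hA t ht
  rw [F.fundamentalForm_eq S hg hψ hs, mul_comm] at hAs
  exact mul_left_cancel₀ (pow_ne_zero 4 (hψ.deriv_ne_zero s hs)) hAs

/-- The Ricci curvature and the density of the fundamental form in terms of the structural
functions. -/
theorem invariants_eq {ρ A : ℝ → ℝ} (hρ : IsRicciCurvature Λ I 4 ρ)
    (hA : IsFundamentalDensity Λ I 4 A) {t : ℝ} (ht : t ∈ I) :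
    ρ t = -(4 / 15) * (3 * a₂₁ t + 2 * a₄₂ t + 1 / 2 * deriv a₂₂ t + 1 / 2 * a₂₂ t ^ 2) ∧
    A t = 36 / 35 * (-(a₃₁ t) + 9 / 64 * ρ t ^ 2 + 1 / 16 * deriv (deriv ρ) t
      - 1 / 4 * a₂₁ t ^ 2 + 1 / 3 * deriv a₄₁ t + 1 / 12 * deriv (deriv a₂₁) t
      + 1 / 12 * deriv (fun s => a₂₁ s * a₂₂ s) t) := by
  have hs := fun {x : ℝ → ℝ} (hx : ContDiffOn ℝ ∞ x I) =>
    hasDerivAt_deriv_of_contDiffOn F.isOpen hx t ht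
  have hρt := fun s (hs : s ∈ I) => F.ricci_eq S hρ hs
  have hAt := F.density_eq S hA ht
  have hUt : secondInvariant a₂₁ a₂₂ a₄₂ t =
    -(deriv a₂₂ t + 6 * a₂₁ t + a₂₂ t ^ 2 + 4 * a₄₂ t) := rfl
  generalize secondInvariant a₂₁ a₂₂ a₄₂ = U at *
  have hρ' : deriv (deriv ρ) t = 2 / 15 * deriv (deriv U) t := by
    have h1 : ρ =ᶠ[𝓝 t] fun s => 2 / 15 * U s := by
      filter_upwards [F.isOpen.mem_nhds ht] with s hs using hρt s hs
    have h2 : deriv (fun s => 2 / 15 * U s) = fun s => 2 / 15 * deriv U s := by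
      funext s; exact deriv_const_mul_field _
    rw [h1.deriv.deriv_eq, h2]
    exact deriv_const_mul_field _
  have hκ : deriv (thirdDerivCoeff a₂₁ a₂₂ a₄₁) t =
      3 * deriv (deriv a₂₁) t + 3 * deriv (fun s => a₂₁ s * a₂₂ s) t + 12 * deriv a₄₁ t :=
    ((((hs (S.smooth_a₂₁.deriv_of_isOpen F.isOpen (by simp))).const_mul 3).add
      ((hs (S.smooth_a₂₁.mul S.smooth_a₂₂)).const_mul 3)).add
      ((hs S.smooth_a₄₁).const_mul 12)).deriv
  refine ⟨?_, ?_⟩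
  · rw [hρt t ht, hUt]; ring
  · rw [hAt, hρ', hρt t ht, fourthInvariant, hκ]; ring

theorem exists_invariants :
    ∃ ρ A : ℝ → ℝ, IsRicciCurvature Λ I 4 ρ ∧ IsFundamentalDensity Λ I 4 A := by
  obtain ⟨g, hg⟩ := F.exists_generatingFunction S
  have hρ : ContDiffOn ℝ ∞ (fun t => g t t) I := fun t ht =>
    (ContDiffAt.comp (f := fun t : ℝ => (t, t)) t (hg.contDiffAt_right ht)
      (by fun_prop)).contDiffWithinAt
  refine ⟨fun t => g t t, fun t => fourthInvariant a₂₁ a₂₂ a₃₁ a₄₁ t / 35 +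
      9 / 3500 * secondInvariant a₂₁ a₂₂ a₄₂ t ^ 2 +
      3 / 350 * deriv (deriv (secondInvariant a₂₁ a₂₂ a₄₂)) t, ⟨g, hg, fun _ _ => rfl⟩,
    fun t ht => ?_⟩
  obtain ⟨ψ, V, g', hψ, h0, rfl⟩ := F.exists_projectiveParameter hg hρ ht
  exact ⟨ψ, V, g', 0, hψ, h0, rfl, by rw [F.fundamentalForm_eq S hg hψ h0, mul_comm]⟩

end IsLagrangianFrame

end Invariants

end

end GrassmannCurve

theorem lemma4p1
    {W : Type*} [NormedAddCommGroup W] [NormedSpace ℝ W] [FiniteDimensional ℝ W]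
    (hdim : Module.finrank ℝ W = 4)
    (σ : LinearMap.BilinForm ℝ W) (hσalt : σ.IsAlt) (hσnd : σ.Nondegenerate)
    (I : Set ℝ) (hIopen : IsOpen I) (hIconn : I.OrdConnected)
    -- the curve
    (Λ : ℝ → Submodule ℝ W)
    (hLag : ∀ t ∈ I, GrassmannCurve.IsLagrangian σ (Λ t))
    (hsmooth : GrassmannCurve.IsSmoothCurve Λ I)
    (hrank : ∀ t ∈ I, GrassmannCurve.IsNondecreasingRankOneAt σ Λ t)
    (k : ℕ) (hweight : ∀ t ∈ I, GrassmannCurve.HasWeightAt 2 Λ t k)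
    -- the smooth moving frame, completing the canonical basis
    (e₁ e₂ f₁ f₂ : ℝ → W)
    (he₁ : ContDiffOn ℝ ∞ e₁ I) (he₂ : ContDiffOn ℝ ∞ e₂ I)
    (hf₁ : ContDiffOn ℝ ∞ f₁ I) (hf₂ : ContDiffOn ℝ ∞ f₂ I)
    (hcan : ∀ t ∈ I, GrassmannCurve.IsCanonicalBasis σ Λ t ![e₁ t, e₂ t])
    (hframe : ∀ t ∈ I, GrassmannCurve.IsSymplecticFrame σ ![e₁ t, e₂ t] ![f₁ t, f₂ t])
    -- the matrix of its structural equation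
    (M : ℝ → Matrix (Fin 4) (Fin 4) ℝ)
    (hM : ∀ t ∈ I, ∀ i : Fin 4, HasDerivAt ((![e₁, e₂, f₁, f₂] : Fin 4 → ℝ → W) i)
      (∑ j : Fin 4, M t i j • (![e₁, e₂, f₁, f₂] : Fin 4 → ℝ → W) j t) t) :
    ∃ a₂₁ a₂₂ a₃₁ a₄₁ a₄₂ : ℝ → ℝ,
      -- the form of the structural matrix
      ContDiffOn ℝ ∞ a₂₁ I ∧ ContDiffOn ℝ ∞ a₂₂ I ∧ ContDiffOn ℝ ∞ a₃₁ I ∧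
      ContDiffOn ℝ ∞ a₄₁ I ∧ ContDiffOn ℝ ∞ a₄₂ I ∧
      (∀ t ∈ I, M t =
        !![    0,     3,  0,       0;
           a₂₁ t, a₂₂ t,  0,       4;
           a₃₁ t, a₄₁ t,  0, -(a₂₁ t);
           a₄₁ t, a₄₂ t, -3, -(a₂₂ t)]) ∧
      -- the Ricci curvature and the density of the fundamental form exist
      (∃ ρ A : ℝ → ℝ, GrassmannCurve.IsRicciCurvature Λ I k ρ ∧
        GrassmannCurve.IsFundamentalDensity Λ I k A) ∧
      -- and they are given by the formulas
      ∀ ρ A : ℝ → ℝ, GrassmannCurve.IsRicciCurvature Λ I k ρ →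
        GrassmannCurve.IsFundamentalDensity Λ I k A → ∀ t ∈ I,
        ρ t = -(4 / 15) * (3 * a₂₁ t + 2 * a₄₂ t + 1 / 2 * deriv a₂₂ t + 1 / 2 * a₂₂ t ^ 2) ∧
        A t = 36 / 35 * (-(a₃₁ t) + 9 / 64 * ρ t ^ 2 + 1 / 16 * deriv (deriv ρ) t
          - 1 / 4 * a₂₁ t ^ 2 + 1 / 3 * deriv a₄₁ t + 1 / 12 * deriv (deriv a₂₁) t
          + 1 / 12 * deriv (fun s => a₂₁ s * a₂₂ s) t) := by
  have F := GrassmannCurve.isLagrangianFrame_of_isSymplecticFrame hσalt hIopen hIconn hLag he₁ he₂ hf₁ hf₂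
    (fun t ht => (hcan t ht).2.1) hframe
  obtain ⟨S, hMeq⟩ := F.structure_matrix hcan hrank hM
  refine ⟨_, _, _, _, _, S.smooth_a₂₁, S.smooth_a₂₂, S.smooth_a₃₁, S.smooth_a₄₁, S.smooth_a₄₂,
    hMeq, ?_, ?_⟩
  -- Over an empty interval the weight condition does not determine k, but then existence is
  -- vacuous; a point of I is needed to conclude k = 4.
  · rcases I.eq_empty_or_nonempty with rfl | ⟨t, ht⟩
    · exact ⟨0, 0, ⟨0, GrassmannCurve.isGeneratingFunction_empty Λ k 0, by simp⟩,
        fun t ht => ht.elim⟩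
    · obtain rfl := F.weight_eq S ht (by norm_num) (by norm_num) (hweight t ht)
      exact F.exists_invariants S
  · intro ρ A hρ hA t ht
    obtain rfl := F.weight_eq S ht (by norm_num) (by norm_num) (hweight t ht)
    exact F.invariants_eq S hρ hA ht
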